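/- **Setting.** Let $T>0$, let $C_0[0,T]$ be the space of continuous $x:[0,T]\to\mathbb R$ with $x(0)=0$, and let $\mathfrak m$ be Wiener measure on it. A property holds *s-a.e.* if it holds off a set $N$ with $\mathfrak m(\rho N)=0$ for all $\rho>0$; a functional $F$ is scale-invariant measurable if $F(\rho\,\cdot)$ is Wiener measurable for all $\rho>0$. Fix a complete orthonormal sequence $(\phi_j)$ of $L_2[0,T]$ consisting of functions of bounded variation; the Paley–Wiener–Zygmund integral of $u\in L_2[0,T]$ is $\langle u,x\rangle=\lim_n\sum_{j\le n}(u,\phi_j)_2\int_0^T\phi_j\,dx$ whenever the limit exists. For $h\in L_\infty[0,T]$ let $\mathcal Z_h(x,t)=\langle h\chi_{[0,t]},x\rangle$, in its version with paths in $C_0[0,T]$. Write $\mathbb C_+=\{\operatorname{Re}\lambda>0\}$. Given integrands $\Psi_\lambda(x)$ for $\lambda>0$, the *analytic Wiener integral* is the analytic function $J$ on $\mathbb C_+$ with $J(\lambda)=\int\Psi_\lambda\,d\mathfrak m$ (a finite integral) for all $\lambda>0$, if there is one; the *analytic Feynman integral* with parameter $q\in\mathbb R\setminus\{0\}$ is $\lim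 J(\lambda)$ as $\lambda\to-iq$ in $\mathbb C_+$. Let $T_{\lambda,h}(F)(y)$ be the analytic Wiener integral with $\Psi_\lambda(x)=F(y+\lambda^{-1/2}\mathcal Z_h(x,\cdot))$. The transform $T^{(p)}_{q,h}(F)$ is the limit of $T_{\lambda,h}(F)$ as $\lambda\to-iq$ in $\mathbb C_+$: for $p=1$ pointwise s-a.e., and for $1<p\le2$ in the sense that $\int|T_{\lambda,h}(F)(\rho y)-T^{(p)}_{q,h}(F)(\rho y)|^{p'}d\mathfrak m(y)\to0$ for every $\rho>0$, $1/p+1/p'=1$. The generalized convolution product $(F*G)_q^{(k_1,k_2)}(y)$ is the analytic Feynman integral with parameter $q$ of $\Psi_\lambda(x)=F\big(\tfrac{y+\lambda^{-1/2}\mathcal Z_{k_1}(x,\cdot)}{\sqrt2}\big)G\big(\tfrac{y-\lambda^{-1/2}\mathcal Z_{k_2}(x,\cdot)}{\sqrt2}\big)$. The class $\mathcal S(L_2[0,T])$ consists of the functionals $F$ for which there is a complex Borel measure $f$ on $L_2[0,T]$ such that $F(x)=\int_{L_2[0,T]}e^{i\langle u,x\rangle}\,df(u)$ at every $x$ for which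 $\langle u,x\rangle$ exists for $|f|$-almost every $u$ (these are s-a.e. $x$). For $h,k\in L_\infty[0,T]$, $\mathbf s(h,k)$ denotes any function in $L_2[0,T]$ with $\mathbf s(h,k)^2=h^2+k^2$ a.e. **Lemma 6.2.** Let $h,k_1,k_2$ be nonzero elements of $L_\infty[0,T]$ with $h^2=k_1k_2$ a.e. on $[0,T]$, let $F,G\in\mathcal S(L_2[0,T])$, and let $q,q_1,q_2$ be nonzero reals with the same sign. Then for every $p\in[1,2]$ and every choice of $\mathbf s(h,k_1)$ and $\mathbf s(h,k_2)$: (a) the transforms $T^{(p)}_{q_1,\sqrt{q_1/(2q)}\,\mathbf s(h,k_1)}(F)$ and $T^{(p)}_{q_2,\sqrt{q_2/(2q)}\,\mathbf s(h,k_2)}(G)$ exist and have versions in $\mathcal S(L_2[0,T])$, and $T^{(p)}_{q,h}\big(F(\tfrac{\cdot}{\sqrt2})G(\tfrac{\cdot}{\sqrt2})\big)$ exists; (b) for any such versions in $\mathcal S(L_2[0,T])$ of the first two transforms, and any version of the third, the convolution product below exists for s-a.e. $y\in C_0[0,T]$ and $$\Big(T^{(p)}_{q_1,\sqrt{q_1/(2q)}\,\mathbf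 s(h,k_1)}(F)*T^{(p)}_{q_2,\sqrt{q_2/(2q)}\,\mathbf s(h,k_2)}(G)\Big)^{(k_1,k_2)}_{-q}(y)=T^{(p)}_{q,h}\Big(F\big(\tfrac{\cdot}{\sqrt2}\big)G\big(\tfrac{\cdot}{\sqrt2}\big)\Big)(y).$$ -/

import Mathlib

open MeasureTheory ProbabilityTheory Filter Topology Set
open scoped NNReal ENNReal

noncomputable section

namespace WienerGFFT

/-- Lebesgue measure on `[0,T]`. -/
abbrev leb (T : ℝ) : Measure ℝ := volume.restrict (Icc (0 : ℝ) T)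

/-- The Hilbert space `L₂[0,T]`, with its Borel σ-algebra. -/
abbrev L2 (T : ℝ) : Type := Lp ℝ 2 (leb T)

instance instMeasurableSpaceL2 (T : ℝ) : MeasurableSpace (L2 T) := borel _

instance instBorelSpaceL2 (T : ℝ) : BorelSpace (L2 T) := ⟨rfl⟩

/-- The continuous real functions on `[0,T]` that vanish at `0`, as a subspace of `C[0,T]`. -/
def pathSubmodule (T : ℝ) : Submodule ℝ C(Icc (0 : ℝ) T, ℝ) where
  carrier := {x | ∀ t : Icc (0 : ℝ) T, (t : ℝ) = 0 → x t = 0}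
  add_mem' := by
    intro a b ha hb t ht
    simp [ha t ht, hb t ht]
  zero_mem' := by
    intro t _
    rfl
  smul_mem' := by
    intro c x hx t ht
    simp [hx t ht]

/-- Wiener space `C₀[0,T]`: normed by the supremum norm, with its Borel σ-algebra. -/
abbrev C0 (T : ℝ) : Type := pathSubmodule T

instance instMeasurableSpaceC0 (T : ℝ) : MeasurableSpace (C0 T) := borel _

instance instBorelSpaceC0 (T : ℝ) : BorelSpace (C0 T) := ⟨rfl⟩

/-- The value of the path `x` at the time `t` (and `0` when `t` is not in `[0,T]`). -/
def val {T : ℝ} (x : C0 T) (t : ℝ) : ℝ :=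
  open Classical in if h : t ∈ Icc (0 : ℝ) T then x.1 ⟨t, h⟩ else 0

/-- `m` is Wiener measure on `C₀[0,T]`: under the probability measure `m` the coordinate process
has independent increments, and `x(t) - x(s)` has the law `N(0, t - s)` for `s ≤ t`.
(Paths start at `0` by definition, so this determines `m`.) -/
structure IsWienerMeasure {T : ℝ} (m : Measure (C0 T)) : Prop where
  prob : IsProbabilityMeasure m
  indep : HasIndepIncrements (fun (t : Icc (0 : ℝ) T) (x : C0 T) => x.1 t) m
  gauss : ∀ s t : Icc (0 : ℝ) T, s ≤ t →
    m.map (fun x : C0 T => x.1 t - x.1 s) = gaussianReal 0 (Real.toNNReal ((t : ℝ) - s))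

section

variable {T : ℝ}

/-- `P` holds scale-invariant almost everywhere: the exceptional set `N` satisfies
`m(ρ⁻¹ N) = 0` for all `ρ > 0`, equivalently `m(ρ N) = 0` for all `ρ > 0`. -/
def SAE (m : Measure (C0 T)) (P : C0 T → Prop) : Prop :=
  ∀ ρ : ℝ, 0 < ρ → ∀ᵐ x ∂m, P (ρ • x)

/-- Scale-invariant measurability: `F(ρ ·)` is measurable with respect to the completion of `m`
for every `ρ > 0`. -/
def ScaleInvMeasurable (m : Measure (C0 T)) (F : C0 T → ℂ) : Prop :=
  ∀ ρ : ℝ, 0 < ρ → AEMeasurable (fun x => F (ρ • x)) m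

/-! ### The Paley–Wiener–Zygmund integral -/

/-- A complete orthonormal sequence in `L₂[0,T]` that consists of functions of bounded variation. -/
structure IsBVBasis (T : ℝ) (φ : ℕ → ℝ → ℝ) : Prop where
  bv : ∀ j, BoundedVariationOn (φ j) (Icc 0 T)
  orthonormal : ∀ i j, ∫ t, φ i t * φ j t ∂(leb T) = if i = j then 1 else 0
  complete : ∀ u : ℝ → ℝ, MemLp u 2 (leb T) → (∀ j, ∫ t, u t * φ j t ∂(leb T) = 0) →
    u =ᵐ[leb T] 0

/-- The Riemann–Stieltjes integral `∫₀ᵀ φ(t) dx(t)` of a function `φ` of bounded variation with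
respect to the continuous function `x`, as the limit of the Riemann–Stieltjes sums along the
partitions of `[0,T]` into `n` equal parts. -/
def rsIntegral (φ : ℝ → ℝ) (x : C0 T) : ℝ :=
  limUnder atTop fun n : ℕ => ∑ k ∈ Finset.range n,
    φ (k * T / n) * (val x ((k + 1) * T / n) - val x (k * T / n))

/-- The `n`-th partial sum `∑_{j<n} (u, φⱼ)₂ ∫₀ᵀ φⱼ(t) dx(t)`. -/
def pwzSum (φ : ℕ → ℝ → ℝ) (u : ℝ → ℝ) (x : C0 T) (n : ℕ) : ℝ :=
  ∑ j ∈ Finset.range n, (∫ t, u t * φ j t ∂(leb T)) * rsIntegral (φ j) x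

/-- The Paley–Wiener–Zygmund integral `⟨u,x⟩` exists. -/
def PWZExists (φ : ℕ → ℝ → ℝ) (u : ℝ → ℝ) (x : C0 T) : Prop :=
  ∃ c : ℝ, Tendsto (pwzSum φ u x) atTop (𝓝 c)

/-- The Paley–Wiener–Zygmund integral `⟨u,x⟩ = ∫₀ᵀ u(t) d̃x(t)`. -/
def pwz (φ : ℕ → ℝ → ℝ) (u : ℝ → ℝ) (x : C0 T) : ℝ :=
  limUnder atTop (pwzSum φ u x)

/-- `Z` is a version with paths in `C₀[0,T]` of the Gaussian process
`𝒵_h(x,t) = ∫₀ᵗ h(s) d̃x(s) = ⟨h χ_{[0,t]}, x⟩`. -/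
def IsProcessVersion (m : Measure (C0 T)) (φ : ℕ → ℝ → ℝ) (h : ℝ → ℝ) (Z : C0 T → C0 T) : Prop :=
  ∀ t : Icc (0 : ℝ) T, ∀ᵐ x ∂m,
    Tendsto (pwzSum φ ((Icc (0 : ℝ) t).indicator h) x) atTop (𝓝 ((Z x).1 t))

/-- The Gaussian process `𝒵_h`, as a map from `C₀[0,T]` to itself: the continuous version, which is
unique up to `m`-null sets. -/
def proc (m : Measure (C0 T)) (φ : ℕ → ℝ → ℝ) (h : ℝ → ℝ) : C0 T → C0 T :=
  open Classical in
  if H : ∃ Z, IsProcessVersion m φ h Z then H.choose else 0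

/-! ### Analytic Wiener and Feynman integrals -/

/-- The open right half-plane `ℂ₊`. -/
def rightHalf : Set ℂ := {z | 0 < z.re}

/-- The filter `λ → -iq`, `λ ∈ ℂ₊`. -/
def toFeynman (q : ℝ) : Filter ℂ := 𝓝[rightHalf] (-Complex.I * (q : ℂ))

/-- `J` is, on `ℂ₊`, the generalized analytic Wiener integral of the integrand `Ψ`: for every real
`l > 0` the functional `Ψ l` has the finite integral `J l`, and `J` is analytic on `ℂ₊`. Here `Ψ l`
is the integrand after `𝒵_h` has been replaced by `l^{-1/2} 𝒵_h`. -/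
def IsAnalyticWienerIntegral (m : Measure (C0 T)) (Ψ : ℝ → C0 T → ℂ) (J : ℂ → ℂ) : Prop :=
  (∀ l : ℝ, 0 < l → Integrable (Ψ l) m ∧ J (l : ℂ) = ∫ x, Ψ l x ∂m) ∧
    DifferentiableOn ℂ J rightHalf

/-- `F₁` is (a version of) the `L_p` analytic generalized Fourier–Feynman transform
`T_{q,h}^{(p)}(F)`, for `1 ≤ p ≤ 2`. The functional `Tl z` is `T_{z,h}(F)`, which exists s-a.e.
For `p = 1` the limit `z → -iq` is pointwise s-a.e.; for `1 < p ≤ 2` it is, at every scale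
`ρ > 0`, a limit in the mean of order `p' = p / (p - 1)`. -/
def IsGFFT (m : Measure (C0 T)) (φ : ℕ → ℝ → ℝ) (p q : ℝ) (h : ℝ → ℝ) (F F₁ : C0 T → ℂ) : Prop :=
  ScaleInvMeasurable m F ∧ ScaleInvMeasurable m F₁ ∧
  ∃ Tl : ℂ → C0 T → ℂ,
    (∀ z ∈ rightHalf, ScaleInvMeasurable m (Tl z)) ∧
    (SAE m fun y => IsAnalyticWienerIntegral m
      (fun l x => F (y + (Real.sqrt l)⁻¹ • proc m φ h x)) (fun z => Tl z y)) ∧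
    (p = 1 → SAE m fun y => Tendsto (fun z => Tl z y) (toFeynman q) (𝓝 (F₁ y))) ∧
    (1 < p → ∀ ρ : ℝ, 0 < ρ →
      Tendsto (fun z => ∫⁻ y, ‖Tl z (ρ • y) - F₁ (ρ • y)‖ₑ ^ (p / (p - 1)) ∂m)
        (toFeynman q) (𝓝 0))

/-- The generalized convolution product `(F * G)_q^{(k₁,k₂)}` exists at `y` and has the value `c`:
it is the analytic Feynman integral with parameter `q` of
`F((y + 𝒵_{k₁}(x,·))/√2) G((y - 𝒵_{k₂}(x,·))/√2)`. -/
def IsGCP (m : Measure (C0 T)) (φ : ℕ → ℝ → ℝ) (q : ℝ) (k₁ k₂ : ℝ → ℝ) (F G : C0 T → ℂ)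
    (y : C0 T) (c : ℂ) : Prop :=
  ∃ J : ℂ → ℂ,
    IsAnalyticWienerIntegral m
      (fun l x => F ((Real.sqrt 2)⁻¹ • (y + (Real.sqrt l)⁻¹ • proc m φ k₁ x)) *
        G ((Real.sqrt 2)⁻¹ • (y - (Real.sqrt l)⁻¹ • proc m φ k₂ x))) J ∧
    Tendsto J (toFeynman q) (𝓝 c)

/-! ### The Banach algebra `𝒮(L₂[0,T])` and the functions `s(h,k)` -/

/-- `F` belongs to `𝒮(L₂[0,T])`: for some complex Borel measure `f` on `L₂[0,T]`,
`F(x) = ∫ exp(i⟨u,x⟩) df(u)` at every `x` at which the right-hand side makes sense, that is, at which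
`⟨u,x⟩` exists for almost all `u` with respect to the total variation of `f` (this holds for
s-a.e. `x`). On the exceptional set `F` is arbitrary. -/
def MemS (φ : ℕ → ℝ → ℝ) (F : C0 T → ℂ) : Prop :=
  ∃ f : ComplexMeasure (L2 T), ∀ x : C0 T,
    (∀ᵐ u : L2 T ∂f.variation, PWZExists φ (u : ℝ → ℝ) x) →
    F x = ∫ᵛ u : L2 T, Complex.exp (Complex.I * (pwz φ (u : ℝ → ℝ) x : ℂ))
      ∂[ContinuousLinearMap.mul ℝ ℂ; f]

end

/-- `s` is one of the functions `s(h,k)`: `s ∈ L₂[0,T]` and `s² = h² + k²` a.e. on `[0,T]`. -/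
def IsS (T : ℝ) (h k s : ℝ → ℝ) : Prop :=
  MemLp s 2 (leb T) ∧ ∀ᵐ t ∂(leb T), s t ^ 2 = h t ^ 2 + k t ^ 2

/-- `h` is a nonzero element of `L_∞[0,T]`. -/
def IsNonzeroLinfty (T : ℝ) (h : ℝ → ℝ) : Prop :=
  MemLp h ∞ (leb T) ∧ ¬ h =ᵐ[leb T] 0

end WienerGFFT

end

/-! A member of $\mathcal S(L_2[0,T])$ is a superposition of exponentials $e^{i\langle u,x\rangle}$.
Since $\langle u,\mathcal Z_h(x,\cdot)\rangle=\langle hu,x\rangle$ almost surely is centered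
Gaussian with variance $\|hu\|^2$, the transform $T_{\lambda,h}$ only multiplies the density at $u$
by $\exp(-\|hu\|^2/(2\lambda))$. In the same way the convolution product is a superposition, over
pairs $(u,v)$, of $e^{i\langle(u+v)/\sqrt2,y\rangle}$ with the extra factor
$\exp(-\|k_1u-k_2v\|^2/(4\lambda))$. These factors are bounded by 1 for
$\operatorname{Re}\lambda\ge0$, $\lambda\neq0$, so the limit $\lambda\to-iq$ is dominated
convergence. What remains is an identity of exponents for each pair (`gaussian_exponent_identity`).
It rests on `energy_identity`, the integrated form of
$h^2(u+v)^2+(k_1u-k_2v)^2=(h^2+k_1^2)u^2+(h^2+k_2^2)v^2$, where the cross terms cancel because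
$h^2=k_1k_2$.

Two points need real work, both because the law of $\mathcal Z_h$ may be singular to every scaling
of Wiener measure, so that s-a.e. statements say nothing about paths of $\mathcal Z_h$.

The first is the Gaussian calculus along $\mathcal Z_h$. The continuous version comes from a
comparison of laws with a time-changed Wiener path (`ae_uniformContinuous_pwz`), and the convergence
of $\langle u,\mathcal Z_h\rangle$ from adding an independent complementary process
(`isStdGaussianSeq_mix`).

The second is that the versions of the transforms are known only s-a.e., yet the convolution
evaluates them at $y\pm\lambda^{-1/2}\mathcal Z_{k}$. Membership in $\mathcal S$ repairs this: the
representing measure is determined by the values at almost every Wiener path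
(`ae_eq_zero_of_integral_exp_pwz`, `MemS.eq_of_ae_eq`). Hence the explicit formula holds on a whole
linear set of paths (`IsGoodSet`) that carries Wiener measure and the law of every $\mathcal Z_h$.
-/

noncomputable section

namespace WienerGFFT

/-! ### Riemann–Stieltjes integrals against continuous paths -/

section RiemannStieltjes

variable {T : ℝ}

/-- The Riemann–Stieltjes sum along the partition of `[0,T]` into `n` equal parts. -/
def rsSum (ψ : ℝ → ℝ) (x : C0 T) (n : ℕ) : ℝ :=
  ∑ k ∈ Finset.range n, ψ (k * T / n) * (val x ((k + 1) * T / n) - val x (k * T / n))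

lemma grid_mem (hT : 0 < T) {k n : ℕ} (hk : k ≤ n) : (k * T / n : ℝ) ∈ Icc (0 : ℝ) T := by
  rcases Nat.eq_zero_or_pos n with rfl | hn
  · simp [hT.le]
  have hn' : (0 : ℝ) < n := by exact_mod_cast hn
  have hk' : (k : ℝ) ≤ n := by exact_mod_cast hk
  refine ⟨by positivity, ?_⟩
  rw [div_le_iff₀ hn', mul_comm]
  gcongr

lemma val_of_mem (x : C0 T) {t : ℝ} (ht : t ∈ Icc (0 : ℝ) T) : val x t = x.1 ⟨t, ht⟩ := by
  simp [val, ht]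

lemma val_add (x y : C0 T) (t : ℝ) : val (x + y) t = val x t + val y t := by
  unfold val; split_ifs <;> simp

lemma val_smul (c : ℝ) (x : C0 T) (t : ℝ) : val (c • x) t = c * val x t := by
  unfold val; split_ifs <;> simp

lemma continuous_val (t : ℝ) : Continuous fun x : C0 T => val x t := by
  by_cases ht : t ∈ Icc (0 : ℝ) T
  · simp only [val_of_mem _ ht]
    exact (continuous_eval_const _).comp continuous_subtype_val
  · have : (fun x : C0 T => val x t) = fun _ => 0 := by
      ext x; simp [val, ht]
    rw [this]; exact continuous_const

lemma val_zero (x : C0 T) : val x 0 = 0 := by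
  unfold val
  split_ifs with h
  · exact x.2 _ rfl
  · rfl

lemma sum_range_mul_eq_sum_sum (f : ℕ → ℝ) (n m : ℕ) :
    ∑ i ∈ Finset.range (n * m), f i =
      ∑ k ∈ Finset.range n, ∑ j ∈ Finset.range m, f (k * m + j) := by
  induction n with
  | zero => simp
  | succ n ih => rw [Nat.succ_mul, Finset.sum_range_add, ih, Finset.sum_range_succ]

/-- Abel summation anchored at the right end: the increments of `a` are weighted by differences of
`x` within one block, which are small when the block is short. -/
lemma sum_mul_sub_by_parts (a x : ℕ → ℝ) (m : ℕ) :
    ∑ j ∈ Finset.range m, a j * (x (j + 1) - x j) =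
      a 0 * (x m - x 0) + ∑ j ∈ Finset.range m, (a (j + 1) - a j) * (x m - x (j + 1)) := by
  induction m with
  | zero => simp
  | succ m ih =>
    rw [Finset.sum_range_succ, ih, Finset.sum_range_succ]
    have h1 : ∑ j ∈ Finset.range m, (a (j + 1) - a j) * (x (m + 1) - x (j + 1)) =
        ∑ j ∈ Finset.range m, (a (j + 1) - a j) * (x m - x (j + 1)) +
          (a m - a 0) * (x (m + 1) - x m) := by
      rw [← Finset.sum_range_sub, Finset.sum_mul, ← Finset.sum_add_distrib]
      exact Finset.sum_congr rfl fun j _ => by ring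
    rw [h1]; ring

lemma sum_abs_sub_le (hT : 0 < T) {ψ : ℝ → ℝ} (hψ : BoundedVariationOn ψ (Icc 0 T)) (n : ℕ) :
    ∑ k ∈ Finset.range n, |ψ ((k + 1 : ℕ) * T / n) - ψ (k * T / n)| ≤
      (eVariationOn ψ (Icc 0 T)).toReal := by
  have h := eVariationOn.sum_le_of_monotoneOn_Iic (f := ψ) (s := Icc 0 T) (n := n)
    (u := fun k : ℕ => (k * T / n : ℝ)) (by
      intro i _ j _ hij
      have : (i : ℝ) ≤ j := by exact_mod_cast hij
      dsimp only
      gcongr) (fun i hi => grid_mem hT hi)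
  have h2 := ENNReal.toReal_mono hψ h
  rw [ENNReal.toReal_sum (fun _ _ => edist_ne_top _ _)] at h2
  simpa [← dist_edist, Real.dist_eq] using h2

/-- Summation by parts in each coarse cell bounds the effect of a refinement by the oscillation of
the path over a cell times the variation of the integrand. -/
lemma abs_rsSum_sub_le (hT : 0 < T) {ψ : ℝ → ℝ} (hψ : BoundedVariationOn ψ (Icc 0 T)) (x : C0 T)
    {n m : ℕ} (hn : 0 < n) (hm : 0 < m) {η : ℝ}
    (hη : ∀ s ∈ Icc (0 : ℝ) T, ∀ t ∈ Icc (0 : ℝ) T, |s - t| ≤ T / n → |val x s - val x t| ≤ η) :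
    |rsSum ψ x (n * m) - rsSum ψ x n| ≤ η * (eVariationOn ψ (Icc 0 T)).toReal := by
  have hn' : (0 : ℝ) < n := by exact_mod_cast hn
  have hm' : (0 : ℝ) < m := by exact_mod_cast hm
  set s : ℕ → ℝ := fun i => i * T / (n * m : ℕ) with hs
  have hsk : ∀ k : ℕ, s (k * m) = k * T / n := by
    intro k; simp only [hs]; push_cast; field_simp
  have h1 : rsSum ψ x (n * m) = ∑ k ∈ Finset.range n, ∑ j ∈ Finset.range m,
      ψ (s (k * m + j)) * (val x (s (k * m + (j + 1))) - val x (s (k * m + j))) := by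
    rw [rsSum, sum_range_mul_eq_sum_sum]
    refine Finset.sum_congr rfl fun k _ => Finset.sum_congr rfl fun j _ => ?_
    simp only [hs]; push_cast; ring_nf
  have h2 : rsSum ψ x (n * m) - rsSum ψ x n = ∑ k ∈ Finset.range n, ∑ j ∈ Finset.range m,
      (ψ (s (k * m + (j + 1))) - ψ (s (k * m + j))) *
        (val x (s (k * m + m)) - val x (s (k * m + (j + 1)))) := by
    rw [h1, rsSum, ← Finset.sum_sub_distrib]
    refine Finset.sum_congr rfl fun k _ => ?_
    have := sum_mul_sub_by_parts (fun j => ψ (s (k * m + j))) (fun j => val x (s (k * m + j))) m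
    rw [this, add_zero, hsk, show k * m + m = (k + 1) * m by ring, hsk]
    push_cast; ring
  rw [h2]
  calc |∑ k ∈ Finset.range n, ∑ j ∈ Finset.range m,
      (ψ (s (k * m + (j + 1))) - ψ (s (k * m + j))) *
        (val x (s (k * m + m)) - val x (s (k * m + (j + 1))))|
      ≤ ∑ k ∈ Finset.range n, ∑ j ∈ Finset.range m,
        η * |ψ (s (k * m + j + 1)) - ψ (s (k * m + j))| := by
        refine (Finset.abs_sum_le_sum_abs _ _).trans (Finset.sum_le_sum fun k hk => ?_)
        refine (Finset.abs_sum_le_sum_abs _ _).trans (Finset.sum_le_sum fun j hj => ?_)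
        rw [Finset.mem_range] at hk hj
        rw [abs_mul, mul_comm, ← add_assoc]
        have hle : k * m + m ≤ n * m := by
          rw [← Nat.succ_mul]; exact Nat.mul_le_mul_right m hk
        refine mul_le_mul_of_nonneg_right (hη _ (grid_mem hT hle) _
          (grid_mem hT (by omega)) ?_) (abs_nonneg _)
        have e : s (k * m + m) - s (k * m + j + 1) = ((m : ℝ) - (j + 1)) * T / (n * m) := by
          simp only [hs]; push_cast; ring
        have hj' : (j : ℝ) + 1 ≤ m := by exact_mod_cast hj
        rw [e, abs_of_nonneg (by have : (0:ℝ) ≤ m - (j + 1) := by linarith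
                                 positivity)]
        rw [div_le_div_iff₀ (by positivity) hn']
        nlinarith [mul_pos hT hn', mul_nonneg (mul_pos hT hn').le (Nat.cast_nonneg (α := ℝ) j)]
    _ = η * ∑ i ∈ Finset.range (n * m), |ψ ((i + 1 : ℕ) * T / (n * m : ℕ)) -
          ψ (i * T / (n * m : ℕ))| := by
        rw [sum_range_mul_eq_sum_sum, Finset.mul_sum]
        simp only [Finset.mul_sum, hs]
    _ ≤ _ := by
        refine mul_le_mul_of_nonneg_left (sum_abs_sub_le hT hψ _) ?_
        exact (abs_nonneg _).trans (hη 0 ⟨le_rfl, hT.le⟩ 0 ⟨le_rfl, hT.le⟩ (by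
          simp; positivity))

lemma exists_delta_val (x : C0 T) {η : ℝ} (hη : 0 < η) : ∃ δ > 0, ∀ s ∈ Icc (0 : ℝ) T,
    ∀ t ∈ Icc (0 : ℝ) T, |s - t| ≤ δ → |val x s - val x t| ≤ η := by
  have huc : UniformContinuous x.1 := CompactSpace.uniformContinuous_of_continuous x.1.continuous
  obtain ⟨δ, hδ, h⟩ := Metric.uniformContinuous_iff.1 huc η hη
  refine ⟨δ / 2, by positivity, fun s hs t ht hst => ?_⟩
  rw [val_of_mem x hs, val_of_mem x ht]
  have := h (a := ⟨s, hs⟩) (b := ⟨t, ht⟩) (by rw [Subtype.dist_eq, Real.dist_eq]; linarith)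
  rw [Real.dist_eq] at this
  exact this.le

/-- For an integrand of bounded variation and a continuous path the Riemann–Stieltjes sums
converge. -/
theorem tendsto_rsSum (hT : 0 < T) {ψ : ℝ → ℝ} (hψ : BoundedVariationOn ψ (Icc 0 T)) (x : C0 T) :
    Tendsto (rsSum ψ x) atTop (𝓝 (rsIntegral ψ x)) := by
  have hc : CauchySeq (rsSum ψ x) := by
    rw [Metric.cauchySeq_iff']
    intro ε hε
    set V := (eVariationOn ψ (Icc 0 T)).toReal with hV
    have hV0 : 0 ≤ V := ENNReal.toReal_nonneg
    -- The summand 1 in `V + 1` covers vanishing variation. Each refinement then costs at most `ε /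
    -- 4`, and two are used.
    obtain ⟨δ, hδ, h⟩ := exists_delta_val x (η := ε / (4 * (V + 1))) (by positivity)
    obtain ⟨N, hN⟩ := exists_nat_gt (T / δ)
    have hb : ∀ n ≥ N + 1, ∀ m > 0, |rsSum ψ x (n * m) - rsSum ψ x n| ≤ ε / (4 * (V + 1)) * V := by
      intro n hn m hm
      have hn0 : (0 : ℝ) < n := by exact_mod_cast (by omega : 0 < n)
      refine abs_rsSum_sub_le hT hψ x (by omega) hm fun s hs t ht hst => h s hs t ht (hst.trans ?_)
      have : (N : ℝ) ≤ n := by exact_mod_cast (by omega : N ≤ n)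
      rw [div_le_iff₀ hn0, mul_comm, ← div_le_iff₀ hδ]
      linarith
    have hV1 : ε / (4 * (V + 1)) * V ≤ ε / 4 := by
      rw [div_mul_eq_mul_div, div_le_div_iff₀ (by positivity) (by norm_num)]
      nlinarith
    refine ⟨N + 1, fun n hn => ?_⟩
    -- The partitions into `n` and `N + 1` parts are compared through their common refinement into
    -- `n * (N + 1)` parts.
    have h1 := hb n hn (N + 1) (by omega)
    have h2 := hb (N + 1) le_rfl n (by omega)
    rw [mul_comm (N + 1) n] at h2
    rw [Real.dist_eq]
    have : |rsSum ψ x n - rsSum ψ x (N + 1)| ≤ |rsSum ψ x (n * (N + 1)) - rsSum ψ x n| +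
        |rsSum ψ x (n * (N + 1)) - rsSum ψ x (N + 1)| := by
      rw [abs_sub_comm (rsSum ψ x (n * (N + 1))) (rsSum ψ x n)]
      exact abs_sub_le _ _ _
    linarith
  exact tendsto_nhds_limUnder (cauchySeq_tendsto_of_complete hc)

lemma rsSum_add_path (ψ : ℝ → ℝ) (x y : C0 T) (n : ℕ) :
    rsSum ψ (x + y) n = rsSum ψ x n + rsSum ψ y n := by
  simp only [rsSum, val_add, ← Finset.sum_add_distrib]
  exact Finset.sum_congr rfl fun k _ => by ring

lemma rsSum_smul_path (ψ : ℝ → ℝ) (c : ℝ) (x : C0 T) (n : ℕ) :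
    rsSum ψ (c • x) n = c * rsSum ψ x n := by
  simp only [rsSum, val_smul, Finset.mul_sum]
  exact Finset.sum_congr rfl fun k _ => by ring

lemma rsIntegral_add_path (hT : 0 < T) {ψ : ℝ → ℝ} (hψ : BoundedVariationOn ψ (Icc 0 T))
    (x y : C0 T) : rsIntegral ψ (x + y) = rsIntegral ψ x + rsIntegral ψ y :=
  tendsto_nhds_unique (tendsto_rsSum hT hψ (x + y)) <| by
    simpa only [funext (rsSum_add_path ψ x y)] using
      (tendsto_rsSum hT hψ x).add (tendsto_rsSum hT hψ y)

lemma rsIntegral_smul_path (hT : 0 < T) {ψ : ℝ → ℝ} (hψ : BoundedVariationOn ψ (Icc 0 T))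
    (c : ℝ) (x : C0 T) : rsIntegral ψ (c • x) = c * rsIntegral ψ x :=
  tendsto_nhds_unique (tendsto_rsSum hT hψ (c • x)) <| by
    simpa only [funext (rsSum_smul_path ψ c x)] using (tendsto_rsSum hT hψ x).const_mul c

lemma measurable_rsSum (ψ : ℝ → ℝ) (n : ℕ) : Measurable fun x : C0 T => rsSum ψ x n := by
  unfold rsSum
  refine Finset.measurable_sum _ fun k _ => ?_
  exact (((continuous_val _).measurable).sub ((continuous_val _).measurable)).const_mul _

lemma measurable_rsIntegral (hT : 0 < T) {ψ : ℝ → ℝ} (hψ : BoundedVariationOn ψ (Icc 0 T)) :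
    Measurable (rsIntegral ψ : C0 T → ℝ) :=
  measurable_of_tendsto_metrizable (measurable_rsSum ψ)
    (tendsto_pi_nhds.2 fun x => tendsto_rsSum hT hψ x)

lemma bv_const (c : ℝ) (s : Set ℝ) : BoundedVariationOn (fun _ : ℝ => c) s := by
  have : eVariationOn (fun _ : ℝ => c) s = 0 :=
    eVariationOn.constant_on (by
      rintro _ ⟨_, _, rfl⟩ _ ⟨_, _, rfl⟩; rfl)
  simp [BoundedVariationOn, this]

lemma bv_add {f g : ℝ → ℝ} {s : Set ℝ} (hf : BoundedVariationOn f s)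
    (hg : BoundedVariationOn g s) : BoundedVariationOn (fun t => f t + g t) s := by
  have : eVariationOn (fun t => f t + g t) s ≤ eVariationOn f s + eVariationOn g s := by
    refine iSup_le fun p => ?_
    calc _ ≤ ∑ i ∈ Finset.range p.1, (edist (f (p.2.1 (i + 1))) (f (p.2.1 i)) +
          edist (g (p.2.1 (i + 1))) (g (p.2.1 i))) :=
          Finset.sum_le_sum fun i _ => edist_add_add_le _ _ _ _
      _ ≤ _ := by
          rw [Finset.sum_add_distrib]
          exact add_le_add (eVariationOn.sum_le p.2.2.1 p.2.2.2)
            (eVariationOn.sum_le p.2.2.1 p.2.2.2)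
  exact ne_top_of_le_ne_top (ENNReal.add_ne_top.2 ⟨hf, hg⟩) this

lemma bv_const_mul (c : ℝ) {f : ℝ → ℝ} {s : Set ℝ} (hf : BoundedVariationOn f s) :
    BoundedVariationOn (fun t => c * f t) s :=
  (bv_const c s).mul hf

lemma bv_sum {ι : Type*} (I : Finset ι) {f : ι → ℝ → ℝ} {s : Set ℝ}
    (hf : ∀ i ∈ I, BoundedVariationOn (f i) s) :
    BoundedVariationOn (fun t => ∑ i ∈ I, f i t) s := by
  classical
  induction I using Finset.induction_on with
  | empty => simpa using bv_const 0 s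
  | insert a I ha ih =>
    simp only [Finset.sum_insert ha]
    exact bv_add (hf a (Finset.mem_insert_self _ _))
      (ih fun i hi => hf i (Finset.mem_insert_of_mem hi))

lemma rsIntegral_sum {ι : Type*} (hT : 0 < T) (I : Finset ι) (c : ι → ℝ) {ψ : ι → ℝ → ℝ}
    (hψ : ∀ i ∈ I, BoundedVariationOn (ψ i) (Icc 0 T)) (x : C0 T) :
    rsIntegral (fun t => ∑ i ∈ I, c i * ψ i t) x = ∑ i ∈ I, c i * rsIntegral (ψ i) x := by
  refine tendsto_nhds_unique (tendsto_rsSum hT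
    (bv_sum I fun i hi => bv_const_mul (c i) (hψ i hi)) x) ?_
  have : ∀ n, rsSum (fun t => ∑ i ∈ I, c i * ψ i t) x n = ∑ i ∈ I, c i * rsSum (ψ i) x n := by
    intro n
    simp only [rsSum, Finset.mul_sum, Finset.sum_mul]
    rw [Finset.sum_comm]
    exact Finset.sum_congr rfl fun _ _ => Finset.sum_congr rfl fun _ _ => by ring
  simp only [funext this]
  exact tendsto_finsetSum _ fun i hi => (tendsto_rsSum hT (hψ i hi) x).const_mul _

end RiemannStieltjes

/-! ### Approximation by step functions -/

section StepFunctions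

variable {T : ℝ}

/-- The largest point of the grid of mesh `T / n` that is at most `s`. -/
def gridFloor (T : ℝ) (n : ℕ) (s : ℝ) : ℝ := (⌊n * s / T⌋₊ : ℝ) * T / n

/-- The step function that has on each interval of the partition into `n` equal parts the value
of `ψ` at the left endpoint. -/
def stepFn (T : ℝ) (ψ : ℝ → ℝ) (n : ℕ) (s : ℝ) : ℝ := ψ (gridFloor T n s)

lemma gridFloor_mem (hT : 0 < T) (n : ℕ) {s : ℝ} (hs : s ∈ Icc (0 : ℝ) T) :
    gridFloor T n s ∈ Icc (0 : ℝ) T := by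
  refine grid_mem hT (Nat.floor_le_of_le ?_)
  rw [div_le_iff₀ hT]
  exact mul_le_mul_of_nonneg_left hs.2 (Nat.cast_nonneg _)

lemma abs_gridFloor_sub_le (hT : 0 < T) {n : ℕ} (hn : 0 < n) {s : ℝ} (hs : s ∈ Icc (0 : ℝ) T) :
    |gridFloor T n s - s| ≤ T / n := by
  have hn' : (0 : ℝ) < n := by exact_mod_cast hn
  have h0 : (0 : ℝ) ≤ n * s / T := by have := hs.1; positivity
  have h1 := Nat.floor_le h0
  have h2 := Nat.lt_floor_add_one (n * s / T : ℝ)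
  have e : gridFloor T n s - s = ((⌊n * s / T⌋₊ : ℝ) - n * s / T) * (T / n) := by
    unfold gridFloor; field_simp
  rw [e, abs_mul, abs_of_pos (by positivity : 0 < T / n)]
  refine mul_le_of_le_one_left (by positivity) ?_
  rw [abs_le]; constructor <;> linarith

lemma tendsto_gridFloor (hT : 0 < T) {s : ℝ} (hs : s ∈ Icc (0 : ℝ) T) :
    Tendsto (fun n => gridFloor T n s) atTop (𝓝[Icc 0 T] s) := by
  refine tendsto_nhdsWithin_iff.2 ⟨?_, ?_⟩
  · rw [tendsto_iff_dist_tendsto_zero]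
    refine squeeze_zero' (Eventually.of_forall fun _ => dist_nonneg) ?_
      (tendsto_const_div_atTop_nhds_zero_nat T)
    filter_upwards [eventually_gt_atTop 0] with n hn
    exact abs_gridFloor_sub_le hT hn hs
  · filter_upwards [eventually_gt_atTop 0] with n hn using gridFloor_mem hT n hs

lemma measurable_stepFn (ψ : ℝ → ℝ) (n : ℕ) : Measurable (stepFn T ψ n) := by
  have h : Measurable fun s : ℝ => ⌊n * s / T⌋₊ := Nat.measurable_floor.comp (by fun_prop)
  exact (measurable_from_nat (f := fun k : ℕ => ψ (k * T / n))).comp h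

/-- By the Jordan decomposition, since a monotone function has only countably many discontinuities.
-/
lemma bv_ae_continuousWithinAt {ψ : ℝ → ℝ} (hψ : BoundedVariationOn ψ (Icc 0 T)) :
    ∀ᵐ s ∂(leb T), ContinuousWithinAt ψ (Icc 0 T) s := by
  obtain ⟨p, q, hp, hq, rfl⟩ :=
    hψ.locallyBoundedVariationOn.exists_monotoneOn_sub_monotoneOn
  rw [ae_restrict_iff' measurableSet_Icc]
  have h1 := hp.countable_not_continuousWithinAt.ae_notMem (volume : Measure ℝ)
  have h2 := hq.countable_not_continuousWithinAt.ae_notMem (volume : Measure ℝ)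
  filter_upwards [h1, h2] with s h1 h2 hs
  simp only [not_and, not_not] at h1 h2
  exact (h1 hs).sub (h2 hs)

lemma bv_aemeasurable {ψ : ℝ → ℝ} (hψ : BoundedVariationOn ψ (Icc 0 T)) :
    AEMeasurable ψ (leb T) := by
  obtain ⟨p, q, hp, hq, rfl⟩ :=
    hψ.locallyBoundedVariationOn.exists_monotoneOn_sub_monotoneOn
  exact (aemeasurable_restrict_of_monotoneOn measurableSet_Icc hp).sub
    (aemeasurable_restrict_of_monotoneOn measurableSet_Icc hq)

lemma bv_exists_bound {ψ : ℝ → ℝ} (hψ : BoundedVariationOn ψ (Icc 0 T)) :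
    ∃ M, 0 ≤ M ∧ ∀ s ∈ Icc (0 : ℝ) T, |ψ s| ≤ M := by
  refine ⟨|ψ 0| + (eVariationOn ψ (Icc 0 T)).toReal, by positivity, fun s hs => ?_⟩
  have h := hψ.dist_le hs (⟨le_rfl, hs.1.trans hs.2⟩ : (0 : ℝ) ∈ Icc 0 T)
  rw [Real.dist_eq] at h
  have := abs_sub_abs_le_abs_sub (ψ s) (ψ 0)
  linarith

lemma bv_memLp {ψ : ℝ → ℝ} (hψ : BoundedVariationOn ψ (Icc 0 T)) (p : ℝ≥0∞) :
    MemLp ψ p (leb T) := by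
  obtain ⟨M, _, hM⟩ := bv_exists_bound hψ
  refine MemLp.of_bound (bv_aemeasurable hψ).aestronglyMeasurable M ?_
  filter_upwards [ae_restrict_mem measurableSet_Icc] with s hs using hM s hs

lemma ae_tendsto_stepFn (hT : 0 < T) {ψ : ℝ → ℝ} (hψ : BoundedVariationOn ψ (Icc 0 T)) :
    ∀ᵐ s ∂(leb T), Tendsto (fun n => stepFn T ψ n s) atTop (𝓝 (ψ s)) := by
  filter_upwards [bv_ae_continuousWithinAt hψ, ae_restrict_mem measurableSet_Icc] with s hc hs
  exact hc.tendsto.comp (tendsto_gridFloor hT hs)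

/-- The indicator function of `[0,t]`. -/
def cut (t : ℝ) : ℝ → ℝ := (Icc (0 : ℝ) t).indicator 1

lemma indicator_eq_cut_mul (t : ℝ) (h : ℝ → ℝ) :
    (Icc (0 : ℝ) t).indicator h = fun s => h s * cut t s := by
  ext s; by_cases hs : s ∈ Icc (0 : ℝ) t <;> simp [cut, hs]

/-- Off the grid exactly one difference of cuts is nonzero, the one for the cell containing `s`.
Grid points are excluded because the cuts are closed on the right while the floor assigns a grid
point to the cell on its right. -/
lemma stepFn_eq_sum (hT : 0 < T) (ψ : ℝ → ℝ) {n : ℕ} (hn : 0 < n) :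
    ∀ᵐ s ∂(leb T), stepFn T ψ n s = ∑ k ∈ Finset.range n,
      ψ (k * T / n) * (cut ((k + 1) * T / n) s - cut (k * T / n) s) := by
  have hn' : (0 : ℝ) < n := by exact_mod_cast hn
  have hc : (Set.range fun k : ℕ => (k * T / n : ℝ)).Countable := Set.countable_range _
  have h1 : ∀ᵐ s ∂(leb T), s ∉ Set.range fun k : ℕ => (k * T / n : ℝ) :=
    ae_restrict_of_ae (hc.ae_notMem _)
  filter_upwards [h1, ae_restrict_mem measurableSet_Icc] with s hs hsT
  have h0 : (0 : ℝ) ≤ n * s / T := by have := hsT.1; positivity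
  have key : ∀ k : ℕ, cut (k * T / n) s = if ⌊n * s / T⌋₊ < k then 1 else 0 := by
    intro k
    rw [cut, indicator_apply]
    congr 1
    rw [Nat.floor_lt h0, div_lt_iff₀ hT, mem_Icc, le_div_iff₀ hn', mul_comm s, eq_iff_iff]
    refine ⟨fun h => lt_of_le_of_ne h.2 fun e => hs ⟨k, ?_⟩, fun h => ⟨hsT.1, h.le⟩⟩
    simp only [← e]; field_simp
  have hlt : ⌊n * s / T⌋₊ < n := by
    rw [Nat.floor_lt h0, div_lt_iff₀ hT]
    refine mul_lt_mul_of_pos_left (lt_of_le_of_ne hsT.2 fun e => hs ⟨n, ?_⟩) hn'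
    simp only [e]; field_simp
  have key' : ∀ k : ℕ, cut ((k + 1) * T / n) s = if ⌊n * s / T⌋₊ < k + 1 then 1 else 0 := by
    intro k; rw [← key (k + 1)]; push_cast; rfl
  simp only [key, key']
  rw [Finset.sum_eq_single_of_mem ⌊n * s / T⌋₊ (Finset.mem_range.2 hlt)]
  · simp [stepFn, gridFloor]
  · intro k _ hk
    rcases lt_or_gt_of_ne hk with h | h
    · simp [not_lt.2 h.le, not_lt.2 (Nat.succ_le_of_lt h)]
    · simp [h, Nat.lt_succ_of_lt h]

lemma abs_stepFn_le (hT : 0 < T) {ψ : ℝ → ℝ} {M : ℝ} (hM : ∀ s ∈ Icc (0 : ℝ) T, |ψ s| ≤ M)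
    (n : ℕ) {s : ℝ} (hs : s ∈ Icc (0 : ℝ) T) : |stepFn T ψ n s| ≤ M :=
  hM _ (gridFloor_mem hT n hs)

lemma tendsto_integral_stepFn (hT : 0 < T) {ψ : ℝ → ℝ} (hψ : BoundedVariationOn ψ (Icc 0 T)) :
    Tendsto (fun n => ∫ s, stepFn T ψ n s ∂(leb T)) atTop (𝓝 (∫ s, ψ s ∂(leb T))) := by
  obtain ⟨M, hM0, hM⟩ := bv_exists_bound hψ
  refine tendsto_integral_filter_of_dominated_convergence (fun _ => M) ?_ ?_
    (integrable_const M) (ae_tendsto_stepFn hT hψ)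
  · exact Eventually.of_forall fun n => (measurable_stepFn ψ n).aestronglyMeasurable
  · refine Eventually.of_forall fun n => ?_
    filter_upwards [ae_restrict_mem measurableSet_Icc] with s hs
    exact abs_stepFn_le hT hM n hs

lemma tendsto_integral_sq_mul_stepFn_sub (hT : 0 < T) {ψ h : ℝ → ℝ}
    (hψ : BoundedVariationOn ψ (Icc 0 T)) (hh : MemLp h 2 (leb T)) :
    Tendsto (fun n => ∫ s, (h s * stepFn T ψ n s - h s * ψ s) ^ 2 ∂(leb T)) atTop (𝓝 0) := by
  obtain ⟨M, hM0, hM⟩ := bv_exists_bound hψ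
  have : (0 : ℝ) = ∫ s, (h s * ψ s - h s * ψ s) ^ 2 ∂(leb T) := by simp
  rw [this]
  refine tendsto_integral_filter_of_dominated_convergence (fun s => (2 * M) ^ 2 * h s ^ 2) ?_ ?_
    (hh.integrable_sq.const_mul _) ?_
  · exact Eventually.of_forall fun n =>
      ((hh.1.mul (measurable_stepFn ψ n).aestronglyMeasurable).sub
        (hh.1.mul (bv_aemeasurable hψ).aestronglyMeasurable)).pow 2
  · refine Eventually.of_forall fun n => ?_
    filter_upwards [ae_restrict_mem measurableSet_Icc] with s hs
    have h1 := abs_stepFn_le hT hM n hs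
    have h2 := hM s hs
    rw [Real.norm_eq_abs, abs_of_nonneg (sq_nonneg _), ← mul_sub, mul_pow, mul_comm]
    refine mul_le_mul_of_nonneg_right (sq_le_sq' ?_ ?_) (sq_nonneg _)
    · linarith [(abs_le.1 h1).1, (abs_le.1 h2).2]
    · linarith [(abs_le.1 h1).2, (abs_le.1 h2).1]
  · filter_upwards [ae_tendsto_stepFn hT hψ] with s hs
    exact (((hs.const_mul (h s)).sub tendsto_const_nhds).pow 2)

lemma measurable_cut (t : ℝ) : Measurable (cut t) :=
  measurable_one.indicator measurableSet_Icc

lemma abs_cut_le (t s : ℝ) : |cut t s| ≤ 1 := by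
  by_cases hs : s ∈ Icc (0 : ℝ) t <;> simp [cut, hs]

lemma memLp_cut (t : ℝ) (p : ℝ≥0∞) : MemLp (cut t) p (leb T) :=
  MemLp.of_bound (measurable_cut t).aestronglyMeasurable 1
    (Eventually.of_forall fun s => abs_cut_le t s)

lemma integral_cut {t : ℝ} (ht : t ∈ Icc (0 : ℝ) T) : ∫ s, cut t s ∂(leb T) = t := by
  have : Icc (0 : ℝ) t ∩ Icc 0 T = Icc 0 t :=
    inter_eq_left.2 (Icc_subset_Icc_right ht.2)
  rw [cut, integral_indicator_one measurableSet_Icc, measureReal_restrict_apply measurableSet_Icc,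
    this, Real.volume_real_Icc_of_le ht.1, sub_zero]

lemma integral_stepFn (hT : 0 < T) (ψ : ℝ → ℝ) {n : ℕ} (hn : 0 < n) :
    ∫ s, stepFn T ψ n s ∂(leb T) = ∑ k ∈ Finset.range n, ψ (k * T / n) * (T / n) := by
  have hn' : (0 : ℝ) < n := by exact_mod_cast hn
  have hi : ∀ t : ℝ, Integrable (cut t) (leb T) := fun t =>
    memLp_one_iff_integrable.1 (memLp_cut t 1)
  rw [integral_congr_ae (stepFn_eq_sum hT ψ hn), integral_finsetSum]
  · refine Finset.sum_congr rfl fun k hk => ?_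
    rw [Finset.mem_range] at hk
    have h1 : ((k + 1) * T / n : ℝ) ∈ Icc (0 : ℝ) T := by
      have := grid_mem (n := n) hT (Nat.succ_le_of_lt hk)
      push_cast at this; exact this
    rw [integral_const_mul, integral_sub (hi _) (hi _), integral_cut h1,
      integral_cut (grid_mem hT hk.le)]
    congr 1; ring
  · exact fun k _ => ((hi _).sub (hi _)).const_mul _

end StepFunctions

/-! ### Centered Gaussian random variables and Gaussian series -/

section Gaussian

variable {Ω : Type*} [MeasurableSpace Ω] {P : Measure Ω}

/-- `X` is a centered Gaussian random variable with variance `v`. -/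
def IsCG (P : Measure Ω) (X : Ω → ℝ) (v : ℝ) : Prop :=
  AEMeasurable X P ∧ ∀ s : ℝ, charFun (P.map X) s = Complex.exp (-(v * s ^ 2 / 2 : ℝ))

lemma IsCG.congr {X Y : Ω → ℝ} {v : ℝ} (h : IsCG P X v) (hXY : X =ᵐ[P] Y) : IsCG P Y v :=
  ⟨h.1.congr hXY, fun s => by rw [← Measure.map_congr hXY]; exact h.2 s⟩

lemma IsCG.congr_var {X : Ω → ℝ} {v w : ℝ} (h : IsCG P X v) (hvw : v = w) : IsCG P X w := hvw ▸ h

lemma IsCG.const_mul {X : Ω → ℝ} {v : ℝ} (h : IsCG P X v) (c : ℝ) :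
    IsCG P (fun ω => c * X ω) (c ^ 2 * v) := by
  refine ⟨h.1.const_mul c, fun s => ?_⟩
  rw [charFun_map_mul_comp h.1, h.2]
  congr 3; ring

lemma charFun_map_eq_integral {X : Ω → ℝ} (hX : AEMeasurable X P) (s : ℝ) :
    charFun (P.map X) s = ∫ ω, Complex.exp (s * X ω * Complex.I) ∂P := by
  rw [charFun_apply_real, integral_map hX (by fun_prop)]

lemma IsCG.integral_exp {X : Ω → ℝ} {v : ℝ} (h : IsCG P X v) (s : ℝ) :
    ∫ ω, Complex.exp (Complex.I * (s * X ω : ℝ)) ∂P = Complex.exp (-(v * s ^ 2 / 2 : ℝ)) := by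
  rw [← h.2 s, charFun_map_eq_integral h.1]
  congr 1; ext ω; congr 1; push_cast; ring

lemma IsCG.hasLaw [IsProbabilityMeasure P] {X : Ω → ℝ} {v : ℝ} (h : IsCG P X v) (hv : 0 ≤ v) :
    HasLaw X (gaussianReal 0 v.toNNReal) P := by
  refine ⟨h.1, ?_⟩
  have := Measure.isProbabilityMeasure_map h.1
  refine Measure.ext_of_charFun ?_
  ext s
  rw [h.2, charFun_gaussianReal]
  congr 1
  have : ((v.toNNReal : ℝ) : ℂ) = (v : ℂ) := by rw [Real.coe_toNNReal v hv]
  simp only [Complex.ofReal_zero, mul_zero, zero_mul, zero_sub]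
  push_cast
  rw [← this]

lemma IsCG.memLp [IsProbabilityMeasure P] {X : Ω → ℝ} {v : ℝ} (h : IsCG P X v) (hv : 0 ≤ v) :
    MemLp X 2 P := by
  have hl := h.hasLaw hv
  have := memLp_id_gaussianReal (μ := 0) (v := v.toNNReal) 2
  rw [← hl.map_eq, memLp_map_measure_iff (by fun_prop) h.1] at this
  exact this

lemma IsCG.integral_eq_zero [IsProbabilityMeasure P] {X : Ω → ℝ} {v : ℝ} (h : IsCG P X v)
    (hv : 0 ≤ v) : ∫ ω, X ω ∂P = 0 := by
  rw [(h.hasLaw hv).integral_eq, integral_id_gaussianReal]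

lemma IsCG.integral_sq [IsProbabilityMeasure P] {X : Ω → ℝ} {v : ℝ} (h : IsCG P X v)
    (hv : 0 ≤ v) : ∫ ω, X ω ^ 2 ∂P = v := by
  have h1 := (h.hasLaw hv).variance_eq
  rw [variance_id_gaussianReal, variance_of_integral_eq_zero h.1 (h.integral_eq_zero hv),
    Real.coe_toNNReal v hv] at h1
  exact h1

/-- Characteristic functions pass to almost sure limits by bounded convergence. The limit variance
may be 0, which is how almost sure equalities are obtained later. -/
lemma isCG_of_tendsto [IsProbabilityMeasure P] {X : ℕ → Ω → ℝ} {Y : Ω → ℝ} {v : ℕ → ℝ} {w : ℝ}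
    (hX : ∀ᶠ n in atTop, IsCG P (X n) (v n)) (hY : AEMeasurable Y P)
    (hXY : ∀ᵐ ω ∂P, Tendsto (fun n => X n ω) atTop (𝓝 (Y ω))) (hv : Tendsto v atTop (𝓝 w)) :
    IsCG P Y w := by
  refine ⟨hY, fun s => ?_⟩
  have h1 : Tendsto (fun n => ∫ ω, Complex.exp (s * X n ω * Complex.I) ∂P) atTop
      (𝓝 (∫ ω, Complex.exp (s * Y ω * Complex.I) ∂P)) := by
    refine tendsto_integral_filter_of_dominated_convergence (fun _ => 1) ?_ ?_
      (integrable_const 1) ?_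
    · filter_upwards [hX] with n hn
      have := hn.1
      exact (by fun_prop : AEMeasurable _ P).aestronglyMeasurable
    · refine Eventually.of_forall fun n => Eventually.of_forall fun ω => ?_
      rw [show (s * X n ω * Complex.I : ℂ) = ((s * X n ω : ℝ) : ℂ) * Complex.I by push_cast; ring,
        Complex.norm_exp_ofReal_mul_I]
    · filter_upwards [hXY] with ω hω
      refine (Complex.continuous_exp.tendsto _).comp ?_
      exact (((Complex.continuous_ofReal.tendsto _).comp hω).const_mul _).mul_const _
  rw [charFun_map_eq_integral hY]
  refine tendsto_nhds_unique h1 ?_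
  have h2 : Tendsto (fun n => Complex.exp (-(v n * s ^ 2 / 2 : ℝ))) atTop
      (𝓝 (Complex.exp (-(w * s ^ 2 / 2 : ℝ)))) := by
    refine (Complex.continuous_exp.tendsto _).comp ?_
    refine Tendsto.neg ((Complex.continuous_ofReal.tendsto _).comp ?_)
    exact (hv.mul_const _).div_const _
  refine h2.congr' ?_
  filter_upwards [hX] with n hn
  rw [← charFun_map_eq_integral hn.1, hn.2]

lemma IsCG.sum_of_iIndepFun [IsProbabilityMeasure P] {X : ℕ → Ω → ℝ} {v : ℕ → ℝ} {n : ℕ}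
    (hX : ∀ k < n, IsCG P (X k) (v k)) (hi : iIndepFun ((Finset.range n).restrict X) P) :
    IsCG P (fun ω => ∑ k ∈ Finset.range n, X k ω) (∑ k ∈ Finset.range n, v k) := by
  refine ⟨?_, fun s => ?_⟩
  · exact Finset.aemeasurable_fun_sum _ fun k hk => (hX k (Finset.mem_range.1 hk)).1
  rw [hi.charFun_map_fun_finsetSum_eq_prod fun k hk => (hX k (Finset.mem_range.1 hk)).1,
    Finset.prod_apply, Finset.prod_congr rfl fun k hk => (hX k (Finset.mem_range.1 hk)).2 s,
    ← Complex.exp_sum]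
  congr 1
  rw [Finset.sum_neg_distrib, ← Complex.ofReal_sum, Finset.sum_mul, Finset.sum_div]

/-- A sequence of independent standard Gaussian random variables, in terms of the laws of its
linear combinations. -/
def IsStdGaussianSeq (P : Measure Ω) (a : ℕ → Ω → ℝ) : Prop :=
  (∀ j, Measurable (a j)) ∧ ∀ (S : Finset ℕ) (c : ℕ → ℝ),
    IsCG P (fun ω => ∑ j ∈ S, c j * a j ω) (∑ j ∈ S, c j ^ 2)

lemma IsStdGaussianSeq.isCG {a : ℕ → Ω → ℝ} (ha : IsStdGaussianSeq P a) (j : ℕ) :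
    IsCG P (a j) 1 := by
  have := ha.2 {j} 1
  simpa using this

/-- The laws of the linear combinations give the joint characteristic function, which factorizes. -/
lemma IsStdGaussianSeq.indep [IsProbabilityMeasure P] {a : ℕ → Ω → ℝ}
    (ha : IsStdGaussianSeq P a) : iIndepFun a P := by
  rw [iIndepFun_iff_finset]
  intro S
  rw [iIndepFun_iff_charFun_pi (ι := S) (X := S.restrict a) fun i => (ha.1 i).aemeasurable]
  intro t
  have hm : AEMeasurable (fun ω => WithLp.toLp 2 (fun j : S => S.restrict a j ω)) P := by
    have : ∀ i : S, Measurable (S.restrict a i) := fun i => ha.1 i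
    fun_prop
  set c : ℕ → ℝ := fun j => if hj : j ∈ S then t ⟨j, hj⟩ else 0 with hc
  have h1 := (ha.2 S c).integral_exp 1
  have hsum : ∀ f : ℕ → ℝ → ℝ, ∑ j ∈ S, f j (c j) = ∑ j : S, f j (t j) := by
    intro f
    rw [← Finset.sum_coe_sort S]
    refine Finset.sum_congr rfl fun j _ => ?_
    simp [hc]
  have h2 : charFun (P.map fun ω => WithLp.toLp 2 (fun j : S => S.restrict a j ω)) t =
      ∫ ω, Complex.exp (Complex.I * (1 * ∑ j ∈ S, c j * a j ω : ℝ)) ∂P := by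
    rw [charFun_apply, integral_map hm (by fun_prop)]
    congr 1; ext ω
    rw [mul_comm Complex.I, one_mul, hsum fun j y => y * a j ω, PiLp.inner_apply]
    congr 3
  rw [h2, h1, hsum fun _ y => y ^ 2]
  have h3 : ∀ i : S, charFun (P.map (S.restrict a i)) (t i) =
      Complex.exp (-(1 * t i ^ 2 / 2 : ℝ)) := fun i => (ha.isCG i).2 (t i)
  rw [Finset.prod_congr rfl fun i _ => h3 i, ← Complex.exp_sum]
  congr 1
  rw [Finset.sum_neg_distrib, ← Complex.ofReal_sum, Finset.sum_mul, Finset.sum_div]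
  simp

/-- Almost sure convergence of Gaussian series with square summable coefficients. -/
theorem IsStdGaussianSeq.ae_tendsto [IsProbabilityMeasure P] {a : ℕ → Ω → ℝ}
    (ha : IsStdGaussianSeq P a) {c : ℕ → ℝ} (hc : Summable fun j => c j ^ 2) :
    ∀ᵐ ω ∂P, ∃ l, Tendsto (fun n => ∑ j ∈ Finset.range n, c j * a j ω) atTop (𝓝 l) := by
  have hsm : ∀ j, StronglyMeasurable (a j) := fun j => (ha.1 j).stronglyMeasurable
  have hint : ∀ j, Integrable (a j) P := fun j =>
    ((ha.isCG j).memLp zero_le_one).integrable (by norm_num)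
  set ℱ := Filtration.natural a hsm
  -- The sum runs up to `a n` inclusive, to match the natural filtration at time `n`; the shift is
  -- undone at the end.
  set f : ℕ → Ω → ℝ := fun n ω => ∑ j ∈ Finset.range (n + 1), c j * a j ω with hf
  have hfint : ∀ n, Integrable (f n) P := fun n =>
    integrable_finsetSum _ fun j _ => (hint j).const_mul _
  have hadp : StronglyAdapted ℱ f := by
    intro n
    refine Finset.stronglyMeasurable_fun_sum _ fun j hj => ?_
    have hj' : j ≤ n := Nat.lt_succ_iff.1 (Finset.mem_range.1 hj)
    exact ((Filtration.stronglyAdapted_natural hsm j).mono (ℱ.mono hj')).const_mul _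
  have hmart : Martingale f ℱ P := by
    refine martingale_nat hadp hfint fun n => ?_
    have h1 : f (n + 1) = f n + fun ω => c (n + 1) * a (n + 1) ω := by
      ext ω; simp [hf, Finset.sum_range_succ _ (n + 1)]
    have h2 : P[fun ω => c (n + 1) * a (n + 1) ω | ℱ n] =ᵐ[P] fun _ => 0 := by
      have h3 := ha.indep.condExp_natural_ae_eq_of_lt hsm (Nat.lt_succ_self n)
      refine (condExp_smul (c (n + 1)) (a (n + 1)) (ℱ n)).trans ?_
      filter_upwards [h3] with ω hω
      rw [Pi.smul_apply, hω, (ha.isCG (n + 1)).integral_eq_zero zero_le_one, smul_zero]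
    rw [h1]
    have h4 := condExp_add (hfint n) ((hint (n + 1)).const_mul (c (n + 1))) (ℱ n)
    rw [condExp_of_stronglyMeasurable (ℱ.le n) (hadp n) (hfint n)] at h4
    filter_upwards [h2, h4] with ω h2 h4
    rw [h4, Pi.add_apply, h2, add_zero]
  set K := ∑' j, c j ^ 2 with hK
  -- The bound `1 + K` comes from $|t|\le1+t^2$; bounded $L_1$ norms suffice for martingale
  -- convergence.
  have hbdd : ∀ n, eLpNorm (f n) 1 P ≤ ((1 + K).toNNReal : ℝ≥0) := by
    intro n
    have hcg := ha.2 (Finset.range (n + 1)) c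
    have hv : 0 ≤ ∑ j ∈ Finset.range (n + 1), c j ^ 2 := Finset.sum_nonneg fun _ _ => sq_nonneg _
    have hle : ∑ j ∈ Finset.range (n + 1), c j ^ 2 ≤ K :=
      hc.sum_le_tsum _ fun _ _ => sq_nonneg _
    have hsq : Integrable (fun ω => f n ω ^ 2) P := (hcg.memLp hv).integrable_sq
    rw [eLpNorm_one_eq_lintegral_enorm, ← ofReal_integral_norm_eq_lintegral_enorm (hfint n)]
    refine ENNReal.ofReal_le_ofReal ?_
    calc ∫ ω, ‖f n ω‖ ∂P ≤ ∫ ω, (1 + f n ω ^ 2) ∂P := by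
          refine integral_mono (hfint n).norm ((integrable_const 1).add hsq) fun ω => ?_
          dsimp only
          rw [Real.norm_eq_abs]
          nlinarith [sq_nonneg (|f n ω| - 1), sq_abs (f n ω), sq_nonneg (f n ω)]
      _ = 1 + ∑ j ∈ Finset.range (n + 1), c j ^ 2 := by
          rw [integral_add (integrable_const 1) hsq, ← hcg.integral_sq hv]
          simp [hf]
      _ ≤ 1 + K := by linarith
  filter_upwards [hmart.submartingale.exists_ae_tendsto_of_bdd hbdd] with ω ⟨l, hl⟩
  exact ⟨l, (tendsto_add_atTop_iff_nat 1).1 hl⟩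

end Gaussian

/-! ### The Paley–Wiener–Zygmund integral on Wiener space -/

section PWZ

variable {T : ℝ} {m : Measure (C0 T)} {φ : ℕ → ℝ → ℝ}

lemma IsWienerMeasure.isCG_increment (hm : IsWienerMeasure m) {s t : ℝ}
    (hs : s ∈ Icc (0 : ℝ) T) (ht : t ∈ Icc (0 : ℝ) T) (hst : s ≤ t) :
    IsCG m (fun x => val x t - val x s) (t - s) := by
  refine ⟨((continuous_val t).sub (continuous_val s)).measurable.aemeasurable, fun r => ?_⟩
  have h := hm.gauss ⟨s, hs⟩ ⟨t, ht⟩ hst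
  simp only [val_of_mem _ hs, val_of_mem _ ht]
  rw [h, charFun_gaussianReal]
  congr 1
  have : ((Real.toNNReal (t - s) : ℝ) : ℂ) = ((t - s : ℝ) : ℂ) := by
    rw [Real.coe_toNNReal _ (sub_nonneg.2 hst)]
  simp only [Complex.ofReal_zero, mul_zero, zero_mul, zero_sub]
  push_cast at this ⊢
  rw [← this]

lemma IsWienerMeasure.isCG_rsSum (hT : 0 < T) (hm : IsWienerMeasure m) (ψ : ℝ → ℝ) (n : ℕ) :
    IsCG m (fun x => rsSum ψ x n) (∑ k ∈ Finset.range n, ψ (k * T / n) ^ 2 * (T / n)) := by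
  have := hm.prob
  -- Independence of increments is used along a monotone sequence indexed by all of `ℕ`; the
  -- projection freezes it at `T` beyond the index `n`.
  set t : ℕ → Icc (0 : ℝ) T := fun k => projIcc 0 T hT.le (k * T / n) with ht
  have htm : Monotone t := by
    intro i j hij
    refine monotone_projIcc _ ?_
    have : (i : ℝ) ≤ j := by exact_mod_cast hij
    gcongr
  have hgrid : ∀ (k : ℕ) (hk : k ≤ n), t k = ⟨k * T / n, grid_mem hT hk⟩ := fun k hk =>
    projIcc_of_mem _ (grid_mem (n := n) hT hk)
  have hval : ∀ k ≤ n, ∀ x : C0 T, x.1 (t k) = val x (k * T / n) := fun k hk x => by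
    rw [hgrid k hk, val_of_mem x (grid_mem (n := n) hT hk)]
  have hind := hm.indep.nat htm
  have hind' : iIndepFun
      (fun (k : ℕ) (x : C0 T) => ψ (k * T / n) * (x.1 (t (k + 1)) - x.1 (t k))) m :=
    hind.comp (fun (k : ℕ) y => ψ (k * T / n) * y) fun k => measurable_const_mul _
  refine (IsCG.sum_of_iIndepFun (n := n)
    (X := fun (k : ℕ) (x : C0 T) => ψ (k * T / n) * (x.1 (t (k + 1)) - x.1 (t k)))
    (v := fun k : ℕ => ψ (k * T / n) ^ 2 * (T / n)) ?_ (hind'.restrict _)).congr ?_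
  · intro k hk
    have h1 := hm.isCG_increment (grid_mem hT hk.le) (grid_mem hT (Nat.succ_le_of_lt hk))
      (by push_cast; gcongr; linarith)
    have h2 := h1.const_mul (ψ (k * T / n))
    simp only [hval k hk.le, hval (k + 1) hk]
    convert h2 using 2
    push_cast; ring
  · refine Eventually.of_forall fun x => ?_
    refine Finset.sum_congr rfl fun k hk => ?_
    rw [Finset.mem_range] at hk
    rw [hval k hk.le, hval (k + 1) hk]
    push_cast; rfl

/-- The variance of a Riemann–Stieltjes sum is the integral of the step function of `ψ ^ 2`, and
these integrals converge. -/
theorem IsWienerMeasure.isCG_rsIntegral (hT : 0 < T) (hm : IsWienerMeasure m) {ψ : ℝ → ℝ}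
    (hψ : BoundedVariationOn ψ (Icc 0 T)) :
    IsCG m (rsIntegral ψ) (∫ t, ψ t ^ 2 ∂(leb T)) := by
  have := hm.prob
  have h2 : BoundedVariationOn (fun t => ψ t ^ 2) (Icc 0 T) := by
    simp only [pow_two]; exact hψ.mul hψ
  refine isCG_of_tendsto (v := fun n => ∫ s, stepFn T (fun t => ψ t ^ 2) n s ∂(leb T)) ?_
    (measurable_rsIntegral hT hψ).aemeasurable
    (Eventually.of_forall fun x => tendsto_rsSum hT hψ x) (tendsto_integral_stepFn hT h2)
  filter_upwards [eventually_gt_atTop 0] with n hn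
  rw [integral_stepFn hT _ hn]
  exact hm.isCG_rsSum hT ψ n

lemma IsBVBasis.memLp (hφ : IsBVBasis T φ) (j : ℕ) : MemLp (φ j) 2 (leb T) := bv_memLp (hφ.bv j) 2

lemma MemLp.integrable_mul_two {u v : ℝ → ℝ} (hu : MemLp u 2 (leb T)) (hv : MemLp v 2 (leb T)) :
    Integrable (fun t => u t * v t) (leb T) :=
  MemLp.integrable_mul hu hv

lemma IsBVBasis.integral_mul_sum (hφ : IsBVBasis T φ) {u : ℝ → ℝ} (hu : MemLp u 2 (leb T))
    (S : Finset ℕ) (c : ℕ → ℝ) :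
    ∫ t, u t * ∑ j ∈ S, c j * φ j t ∂(leb T) = ∑ j ∈ S, c j * ∫ t, u t * φ j t ∂(leb T) := by
  simp only [Finset.mul_sum]
  rw [integral_finsetSum]
  · refine Finset.sum_congr rfl fun j _ => ?_
    rw [← integral_const_mul]
    congr 1; ext t; ring
  · intro j _
    have := (MemLp.integrable_mul_two hu (hφ.memLp j)).const_mul (c j)
    exact this.congr (Eventually.of_forall fun t => by dsimp only; ring)

lemma IsBVBasis.memLp_sum (hφ : IsBVBasis T φ) (S : Finset ℕ) (c : ℕ → ℝ) :
    MemLp (fun t => ∑ j ∈ S, c j * φ j t) 2 (leb T) :=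
  memLp_finsetSum _ fun j _ => (hφ.memLp j).const_mul (c j)

lemma IsBVBasis.integral_sum_sq (hφ : IsBVBasis T φ) (S : Finset ℕ) (c : ℕ → ℝ) :
    ∫ t, (∑ j ∈ S, c j * φ j t) ^ 2 ∂(leb T) = ∑ j ∈ S, c j ^ 2 := by
  simp only [pow_two]
  rw [hφ.integral_mul_sum (hφ.memLp_sum S c) S c]
  refine Finset.sum_congr rfl fun j hj => ?_
  congr 1
  simp only [mul_comm _ (φ j _)]
  rw [hφ.integral_mul_sum (hφ.memLp j)]
  simp [hφ.orthonormal, hj]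

/-- A finite combination of the integrals is the integral of a single function of bounded variation,
whose squared norm is given by orthonormality. -/
lemma isStdGaussianSeq_rsIntegral (hT : 0 < T) (hm : IsWienerMeasure m) (hφ : IsBVBasis T φ) :
    IsStdGaussianSeq m fun j (x : C0 T) => rsIntegral (φ j) x := by
  refine ⟨fun j => measurable_rsIntegral hT (hφ.bv j), fun S c => ?_⟩
  simp only [← rsIntegral_sum hT S c fun j _ => hφ.bv j]
  rw [← hφ.integral_sum_sq S c]
  exact hm.isCG_rsIntegral hT (bv_sum S fun j _ => bv_const_mul _ (hφ.bv j))

/-- The Hilbert basis of `L₂[0,T]` given by a complete orthonormal sequence of functions of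
bounded variation. -/
def IsBVBasis.hilbertBasis (hφ : IsBVBasis T φ) : HilbertBasis ℕ ℝ (L2 T) :=
  HilbertBasis.mkOfOrthogonalEqBot (v := fun j => (hφ.memLp j).toLp (φ j))
    (by
      rw [orthonormal_iff_ite]
      intro i j
      rw [L2.inner_def, ← hφ.orthonormal i j]
      refine integral_congr_ae ?_
      filter_upwards [(hφ.memLp i).coeFn_toLp, (hφ.memLp j).coeFn_toLp] with t h1 h2
      rw [h1, h2]; simp [mul_comm])
    (by
      rw [Submodule.eq_bot_iff]
      intro u hu
      have h1 := hφ.complete u (Lp.memLp u) fun j => by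
        have h2 := (Submodule.mem_orthogonal _ _).1 hu _ (Submodule.subset_span ⟨j, rfl⟩)
        rw [L2.inner_def] at h2
        rw [← h2]
        refine integral_congr_ae ?_
        filter_upwards [(hφ.memLp j).coeFn_toLp] with t h1
        rw [h1]; simp
      exact (Lp.eq_zero_iff_ae_eq_zero).2 h1)

lemma IsBVBasis.hilbertBasis_apply (hφ : IsBVBasis T φ) (j : ℕ) :
    hφ.hilbertBasis j = (hφ.memLp j).toLp (φ j) := by
  simp [IsBVBasis.hilbertBasis]

lemma inner_toLp {u v : ℝ → ℝ} (hu : MemLp u 2 (leb T)) (hv : MemLp v 2 (leb T)) :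
    inner ℝ (hu.toLp u) (hv.toLp v) = ∫ t, u t * v t ∂(leb T) := by
  rw [L2.inner_def]
  refine integral_congr_ae ?_
  filter_upwards [hu.coeFn_toLp, hv.coeFn_toLp] with t h1 h2
  rw [h1, h2]; simp [mul_comm]

/-- Parseval's identity. -/
lemma IsBVBasis.hasSum_sq (hφ : IsBVBasis T φ) {u : ℝ → ℝ} (hu : MemLp u 2 (leb T)) :
    HasSum (fun j => (∫ t, u t * φ j t ∂(leb T)) ^ 2) (∫ t, u t ^ 2 ∂(leb T)) := by
  have h := hφ.hilbertBasis.hasSum_inner_mul_inner (hu.toLp u) (hu.toLp u)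
  simp only [hφ.hilbertBasis_apply, inner_toLp] at h
  simp only [pow_two]
  simpa only [mul_comm (φ _ _) (u _)] using h

lemma IsBVBasis.tendsto_integral_sq_sub (hφ : IsBVBasis T φ) {u : ℝ → ℝ}
    (hu : MemLp u 2 (leb T)) :
    Tendsto (fun n => ∫ t, ((∑ j ∈ Finset.range n, (∫ s, u s * φ j s ∂(leb T)) * φ j t) - u t) ^ 2
      ∂(leb T)) atTop (𝓝 0) := by
  set c : ℕ → ℝ := fun j => ∫ s, u s * φ j s ∂(leb T) with hc
  have h1 : ∀ n, ∫ t, ((∑ j ∈ Finset.range n, c j * φ j t) - u t) ^ 2 ∂(leb T) =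
      ∫ t, u t ^ 2 ∂(leb T) - ∑ j ∈ Finset.range n, c j ^ 2 := by
    intro n
    have hs := hφ.memLp_sum (Finset.range n) c
    have e : ∀ t, ((∑ j ∈ Finset.range n, c j * φ j t) - u t) ^ 2 =
        (∑ j ∈ Finset.range n, c j * φ j t) ^ 2 - 2 * (u t * ∑ j ∈ Finset.range n, c j * φ j t) +
          u t ^ 2 := fun t => by ring
    simp only [e]
    have hi : Integrable (fun t => (∑ j ∈ Finset.range n, c j * φ j t) ^ 2 -
        2 * (u t * ∑ j ∈ Finset.range n, c j * φ j t)) (leb T) :=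
      hs.integrable_sq.sub ((MemLp.integrable_mul_two hu hs).const_mul 2)
    rw [integral_add hi hu.integrable_sq, integral_sub hs.integrable_sq
      ((MemLp.integrable_mul_two hu hs).const_mul 2), integral_const_mul, hφ.integral_sum_sq,
      hφ.integral_mul_sum hu]
    simp only [hc, pow_two]
    ring
  refine (tendsto_congr h1).2 ?_
  have h2 := (hφ.hasSum_sq hu).tendsto_sum_nat
  have h3 := (tendsto_const_nhds (x := ∫ t, u t ^ 2 ∂(leb T))).sub h2
  rwa [sub_self] at h3

lemma measurable_pwzSum (hT : 0 < T) (hφ : IsBVBasis T φ) (u : ℝ → ℝ) (n : ℕ) :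
    Measurable fun x : C0 T => pwzSum φ u x n :=
  Finset.measurable_sum _ fun j _ => (measurable_rsIntegral hT (hφ.bv j)).const_mul _

lemma measurable_pwz (hT : 0 < T) (hφ : IsBVBasis T φ) (u : ℝ → ℝ) :
    Measurable fun x : C0 T => pwz φ u x :=
  (StronglyMeasurable.limUnder (l := atTop) fun n =>
    (measurable_pwzSum hT hφ u n).stronglyMeasurable).measurable

lemma PWZExists.tendsto {u : ℝ → ℝ} {x : C0 T} (h : PWZExists φ u x) :
    Tendsto (pwzSum φ u x) atTop (𝓝 (pwz φ u x)) :=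
  tendsto_nhds_limUnder h

lemma PWZExists.of_tendsto {u : ℝ → ℝ} {x : C0 T} {c : ℝ}
    (h : Tendsto (pwzSum φ u x) atTop (𝓝 c)) : PWZExists φ u x ∧ pwz φ u x = c :=
  ⟨⟨c, h⟩, h.limUnder_eq⟩

lemma pwzSum_congr {u v : ℝ → ℝ} (h : u =ᵐ[leb T] v) (x : C0 T) (n : ℕ) :
    pwzSum φ u x n = pwzSum φ v x n := by
  refine Finset.sum_congr rfl fun j _ => ?_
  congr 1
  refine integral_congr_ae ?_
  filter_upwards [h] with t ht
  rw [ht]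

lemma pwz_congr {u v : ℝ → ℝ} (h : u =ᵐ[leb T] v) (x : C0 T) : pwz φ u x = pwz φ v x := by
  unfold pwz; rw [funext (pwzSum_congr h x)]

lemma pwzExists_congr {u v : ℝ → ℝ} (h : u =ᵐ[leb T] v) (x : C0 T) :
    PWZExists φ u x ↔ PWZExists φ v x := by
  unfold PWZExists; rw [funext (pwzSum_congr h x)]

lemma pwzSum_linear (hφ : IsBVBasis T φ) {u v : ℝ → ℝ} (hu : MemLp u 2 (leb T))
    (hv : MemLp v 2 (leb T)) (a b : ℝ) (x : C0 T) (n : ℕ) :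
    pwzSum φ (fun t => a * u t + b * v t) x n = a * pwzSum φ u x n + b * pwzSum φ v x n := by
  simp only [pwzSum, Finset.mul_sum, ← Finset.sum_add_distrib]
  refine Finset.sum_congr rfl fun j _ => ?_
  have h1 := (MemLp.integrable_mul_two hu (hφ.memLp j)).const_mul a
  have h2 := (MemLp.integrable_mul_two hv (hφ.memLp j)).const_mul b
  have e : ∫ t, (a * u t + b * v t) * φ j t ∂(leb T) =
      a * ∫ t, u t * φ j t ∂(leb T) + b * ∫ t, v t * φ j t ∂(leb T) := by
    rw [← integral_const_mul, ← integral_const_mul, ← integral_add h1 h2]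
    congr 1; ext t; ring
  rw [e]; ring

lemma PWZExists.linear (hφ : IsBVBasis T φ) {u v : ℝ → ℝ} (hu : MemLp u 2 (leb T))
    (hv : MemLp v 2 (leb T)) (a b : ℝ) {x : C0 T} (h1 : PWZExists φ u x) (h2 : PWZExists φ v x) :
    PWZExists φ (fun t => a * u t + b * v t) x ∧
      pwz φ (fun t => a * u t + b * v t) x = a * pwz φ u x + b * pwz φ v x := by
  refine PWZExists.of_tendsto ?_
  rw [funext (pwzSum_linear hφ hu hv a b x)]
  exact (h1.tendsto.const_mul a).add (h2.tendsto.const_mul b)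

lemma pwzSum_path (hT : 0 < T) (hφ : IsBVBasis T φ) (u : ℝ → ℝ) (x y : C0 T) (a b : ℝ) (n : ℕ) :
    pwzSum φ u (a • x + b • y) n = a * pwzSum φ u x n + b * pwzSum φ u y n := by
  simp only [pwzSum, Finset.mul_sum, ← Finset.sum_add_distrib]
  refine Finset.sum_congr rfl fun j _ => ?_
  rw [rsIntegral_add_path hT (hφ.bv j), rsIntegral_smul_path hT (hφ.bv j),
    rsIntegral_smul_path hT (hφ.bv j)]
  ring

lemma PWZExists.path (hT : 0 < T) (hφ : IsBVBasis T φ) {u : ℝ → ℝ} {x y : C0 T}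
    (hx : PWZExists φ u x) (hy : PWZExists φ u y) (a b : ℝ) :
    PWZExists φ u (a • x + b • y) ∧
      pwz φ u (a • x + b • y) = a * pwz φ u x + b * pwz φ u y := by
  refine PWZExists.of_tendsto ?_
  rw [funext (pwzSum_path hT hφ u x y a b)]
  exact (hx.tendsto.const_mul a).add (hy.tendsto.const_mul b)

theorem ae_pwzExists (hT : 0 < T) (hm : IsWienerMeasure m) (hφ : IsBVBasis T φ) {u : ℝ → ℝ}
    (hu : MemLp u 2 (leb T)) : ∀ᵐ x ∂m, PWZExists φ u x :=
  have := hm.prob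
  (isStdGaussianSeq_rsIntegral hT hm hφ).ae_tendsto (hφ.hasSum_sq hu).summable

/-- The partial sums are centered Gaussian, and by Parseval their variances increase to the squared
norm of `u`. -/
theorem isCG_pwz (hT : 0 < T) (hm : IsWienerMeasure m) (hφ : IsBVBasis T φ) {u : ℝ → ℝ}
    (hu : MemLp u 2 (leb T)) : IsCG m (pwz φ u) (∫ t, u t ^ 2 ∂(leb T)) := by
  have := hm.prob
  refine isCG_of_tendsto (X := fun n x => pwzSum φ u x n) (Eventually.of_forall fun n =>
    (isStdGaussianSeq_rsIntegral hT hm hφ).2 (Finset.range n) fun j => ∫ t, u t * φ j t ∂(leb T))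
    (measurable_pwz hT hφ u).aemeasurable ?_ (hφ.hasSum_sq hu).tendsto_sum_nat
  filter_upwards [ae_pwzExists hT hm hφ hu] with x hx using hx.tendsto

lemma ae_pwz_linear (hT : 0 < T) (hm : IsWienerMeasure m) (hφ : IsBVBasis T φ) {u v : ℝ → ℝ}
    (hu : MemLp u 2 (leb T)) (hv : MemLp v 2 (leb T)) (a b : ℝ) :
    ∀ᵐ x ∂m, pwz φ (fun t => a * u t + b * v t) x = a * pwz φ u x + b * pwz φ v x := by
  filter_upwards [ae_pwzExists hT hm hφ hu, ae_pwzExists hT hm hφ hv] with x h1 h2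
  exact (h1.linear hφ hu hv a b h2).2

lemma ae_pwz_sum (hT : 0 < T) (hm : IsWienerMeasure m) (hφ : IsBVBasis T φ) {ι : Type*}
    (S : Finset ι) (c : ι → ℝ) {u : ι → ℝ → ℝ} (hu : ∀ i, MemLp (u i) 2 (leb T)) :
    ∀ᵐ x ∂m, pwz φ (fun t => ∑ i ∈ S, c i * u i t) x = ∑ i ∈ S, c i * pwz φ (u i) x := by
  classical
  induction S using Finset.induction_on with
  | empty =>
    refine Eventually.of_forall fun x => ?_
    simp only [Finset.sum_empty]
    refine (PWZExists.of_tendsto ?_).2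
    exact tendsto_const_nhds.congr fun n => by simp [pwzSum]
  | insert a S ha ih =>
    have hS : MemLp (fun t => ∑ i ∈ S, c i * u i t) 2 (leb T) :=
      memLp_finsetSum _ fun j _ => (hu j).const_mul (c j)
    filter_upwards [ih, ae_pwz_linear hT hm hφ (hu a) hS (c a) 1] with x h1 h2
    simp only [Finset.sum_insert ha]
    simp only [one_mul] at h2
    rw [h2, h1]

/-- An almost sure limit of Paley–Wiener–Zygmund integrals whose integrands converge in `L₂` is the
integral of the limit. -/
lemma ae_eq_pwz_of_tendsto (hT : 0 < T) (hm : IsWienerMeasure m) (hφ : IsBVBasis T φ)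
    {u : ℕ → ℝ → ℝ} {v : ℝ → ℝ} (hu : ∀ n, MemLp (u n) 2 (leb T)) (hv : MemLp v 2 (leb T))
    (huv : Tendsto (fun n => ∫ t, (u n t - v t) ^ 2 ∂(leb T)) atTop (𝓝 0)) {ζ : C0 T → ℝ}
    (hζ : ∀ᵐ x ∂m, Tendsto (fun n => pwz φ (u n) x) atTop (𝓝 (ζ x))) :
    ζ =ᵐ[m] pwz φ v := by
  have := hm.prob
  have hζm : AEMeasurable ζ m :=
    aemeasurable_of_tendsto_metrizable_ae atTop
      (fun n => (measurable_pwz hT hφ (u n)).aemeasurable) hζ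
  have hd : ∀ n, MemLp (fun t => u n t - v t) 2 (leb T) := fun n => (hu n).sub hv
  -- The difference is an almost sure limit of centered Gaussians with variances tending to 0, so
  -- its second moment vanishes.
  have hcg : IsCG m (fun x => ζ x - pwz φ v x) 0 := by
    refine isCG_of_tendsto (X := fun n => pwz φ fun t => u n t - v t)
      (Eventually.of_forall fun n => isCG_pwz hT hm hφ (hd n))
      (hζm.sub (measurable_pwz hT hφ v).aemeasurable) ?_ huv
    have hl : ∀ᵐ x ∂m, ∀ n, pwz φ (fun t => u n t - v t) x = pwz φ (u n) x - pwz φ v x := by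
      rw [ae_all_iff]
      intro n
      filter_upwards [ae_pwz_linear hT hm hφ (hu n) hv 1 (-1)] with x hx
      simpa [sub_eq_add_neg] using hx
    filter_upwards [hζ, hl] with x h1 h2
    simp only [h2]
    exact h1.sub tendsto_const_nhds
  have h0 := hcg.integral_sq le_rfl
  rw [integral_eq_zero_iff_of_nonneg (fun _ => sq_nonneg _) (hcg.memLp le_rfl).integrable_sq] at h0
  filter_upwards [h0] with x hx
  exact sub_eq_zero.1 (pow_eq_zero_iff two_ne_zero |>.1 hx)

end PWZ

/-! ### Existence of the Gaussian processes `𝒵_h` -/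

section ProcessExistence

variable {T : ℝ} {m : Measure (C0 T)} {φ : ℕ → ℝ → ℝ}

/-- The indicator function of `[0,t)` within `[0,T]`. -/
def leftInd (t : ℝ) (s : ℝ) : ℝ := if s < t then 1 else 0

lemma bv_leftInd (t : ℝ) : BoundedVariationOn (leftInd t) (Icc 0 T) := by
  have hmono : MonotoneOn (fun s => (-1 : ℝ) * leftInd t s) (Icc 0 T) := by
    intro a _ b _ hab
    simp only [leftInd]
    split_ifs <;> linarith
  have h1 : BoundedVariationOn (fun s => (-1 : ℝ) * leftInd t s) (Icc 0 T) := by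
    by_cases hT : (0 : ℝ) ≤ T
    · have := hmono.locallyBoundedVariationOn 0 T ⟨le_rfl, hT⟩ ⟨hT, le_rfl⟩
      rwa [inter_self] at this
    · rw [Icc_eq_empty hT]
      exact BoundedVariationOn.of_subsingleton subsingleton_empty
  have h2 := bv_const_mul (-1) h1
  simpa using h2

lemma tendsto_val {x : C0 T} {ι : Type*} {l : Filter ι} {t : ι → ℝ} {s : ℝ}
    (ht : ∀ᶠ i in l, t i ∈ Icc (0 : ℝ) T) (hs : s ∈ Icc (0 : ℝ) T) (h : Tendsto t l (𝓝 s)) :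
    Tendsto (fun i => val x (t i)) l (𝓝 (val x s)) := by
  rw [Metric.tendsto_nhds]
  intro ε hε
  obtain ⟨δ, hδ, hx⟩ := exists_delta_val x (half_pos hε)
  filter_upwards [ht, Metric.tendsto_nhds.1 h δ hδ] with i hi hd
  rw [Real.dist_eq] at hd ⊢
  exact (hx _ hi _ hs hd.le).trans_lt (half_lt_self hε)

/-- The sum telescopes to the value of the path at the first grid point not below `t`. Writing path
values as integrals makes every combination of them Gaussian with a computable variance. -/
lemma rsIntegral_leftInd (hT : 0 < T) (x : C0 T) {t : ℝ} (ht : t ∈ Icc (0 : ℝ) T) :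
    rsIntegral (leftInd t) x = val x t := by
  refine tendsto_nhds_unique (tendsto_rsSum hT (bv_leftInd t) x) ?_
  -- The ceiling counts the grid points strictly below `t`, that is, the left endpoints at which the
  -- indicator is 1.
  have hK : ∀ n : ℕ, 0 < n → ⌈n * t / T⌉₊ ≤ n := fun n hn => by
    refine Nat.ceil_le.2 ?_
    rw [div_le_iff₀ hT]
    exact mul_le_mul_of_nonneg_left ht.2 (Nat.cast_nonneg _)
  have hsum : ∀ n : ℕ, 0 < n → val x (⌈n * t / T⌉₊ * T / n) = rsSum (leftInd t) x n := by
    intro n hn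
    have hn' : (0 : ℝ) < n := by exact_mod_cast hn
    have hlt : ∀ k : ℕ, (k * T / n : ℝ) < t ↔ k < ⌈n * t / T⌉₊ := by
      intro k
      rw [Nat.lt_ceil, div_lt_iff₀ hn', lt_div_iff₀ hT, mul_comm t]
    rw [rsSum, ← Finset.sum_subset (Finset.range_mono (hK n hn))]
    · have h1 := Finset.sum_range_sub (fun k : ℕ => val x (k * T / n)) ⌈n * t / T⌉₊
      simp only [Nat.cast_zero, zero_mul, zero_div, val_zero, sub_zero] at h1
      rw [← h1]
      refine Finset.sum_congr rfl fun k hk => ?_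
      rw [Finset.mem_range] at hk
      rw [leftInd, if_pos ((hlt k).2 hk)]
      push_cast; ring
    · intro k _ hk
      rw [Finset.mem_range] at hk
      rw [leftInd, if_neg (mt (hlt k).1 hk), zero_mul]
  have hlim : Tendsto (fun n : ℕ => (⌈n * t / T⌉₊ * T / n : ℝ)) atTop (𝓝 t) := by
    rw [tendsto_iff_dist_tendsto_zero]
    refine squeeze_zero' (Eventually.of_forall fun _ => dist_nonneg) ?_
      (tendsto_const_div_atTop_nhds_zero_nat T)
    filter_upwards [eventually_gt_atTop 0] with n hn
    have hn' : (0 : ℝ) < n := by exact_mod_cast hn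
    have h0 : (0 : ℝ) ≤ n * t / T := by have := ht.1; positivity
    have h1 := Nat.le_ceil (n * t / T : ℝ)
    have h2 := Nat.ceil_lt_add_one h0
    have e : (⌈n * t / T⌉₊ * T / n : ℝ) - t = ((⌈n * t / T⌉₊ : ℝ) - n * t / T) * (T / n) := by
      field_simp
    rw [Real.dist_eq, e, abs_mul, abs_of_pos (by positivity : 0 < T / n)]
    refine mul_le_of_le_one_left (by positivity) ?_
    rw [abs_le]; constructor <;> linarith
  refine (tendsto_val (x := x) ?_ ht hlim).congr' ?_
  · filter_upwards [eventually_gt_atTop 0] with n hn using grid_mem hT (hK n hn)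
  · filter_upwards [eventually_gt_atTop 0] with n hn using hsum n hn

lemma exists_bound_of_memLp_top {h : ℝ → ℝ} (hh : MemLp h ∞ (leb T)) :
    ∃ C : ℝ, 0 < C ∧ ∀ᵐ t ∂(leb T), h t ^ 2 ≤ C := by
  have hfin : eLpNormEssSup h (leb T) < ∞ := by simpa using hh.2
  -- The added 1 makes the bound positive even for vanishing `h`, because it later serves as a
  -- divisor.
  refine ⟨(eLpNormEssSup h (leb T)).toReal ^ 2 + 1, by positivity, ?_⟩
  filter_upwards [ae_le_eLpNormEssSup (f := h) (μ := leb T)] with t ht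
  have h1 := ENNReal.toReal_mono hfin.ne ht
  rw [toReal_enorm, Real.norm_eq_abs] at h1
  rw [← sq_abs]
  nlinarith [abs_nonneg (h t)]

lemma memLp_mul_of_memLp_top {h u : ℝ → ℝ} (hh : MemLp h ∞ (leb T)) (hu : MemLp u 2 (leb T)) :
    MemLp (fun t => h t * u t) 2 (leb T) :=
  hu.mul' hh

lemma memLp_two_of_top {h : ℝ → ℝ} (hh : MemLp h ∞ (leb T)) : MemLp h 2 (leb T) :=
  hh.mono_exponent le_top

lemma cut_mul_cut (s t r : ℝ) : cut s r * cut t r = cut (min s t) r := by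
  have : Icc (0 : ℝ) (min s t) = Icc 0 s ∩ Icc 0 t := by ext; simp; tauto
  simp only [cut, this]
  by_cases h1 : r ∈ Icc (0 : ℝ) s <;> by_cases h2 : r ∈ Icc (0 : ℝ) t <;>
    simp [h1, h2]

lemma integral_sq_sum {ι : Type*} (S : Finset ι) (c : ι → ℝ) {f : ι → ℝ → ℝ}
    (hf : ∀ i, MemLp (f i) 2 (leb T)) :
    ∫ r, (∑ i ∈ S, c i * f i r) ^ 2 ∂(leb T) =
      ∑ i ∈ S, ∑ j ∈ S, c i * c j * ∫ r, f i r * f j r ∂(leb T) := by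
  have e : ∀ r, (∑ i ∈ S, c i * f i r) ^ 2 =
      ∑ i ∈ S, ∑ j ∈ S, c i * c j * (f i r * f j r) := fun r => by
    rw [pow_two, Finset.sum_mul_sum]
    exact Finset.sum_congr rfl fun i _ => Finset.sum_congr rfl fun j _ => by ring
  have hi : ∀ i j, Integrable (fun r => c i * c j * (f i r * f j r)) (leb T) := fun i j =>
    (MemLp.integrable_mul_two (hf i) (hf j)).const_mul _
  simp only [e]
  rw [integral_finsetSum _ fun i _ => integrable_finsetSum _ fun j _ => hi i j]
  refine Finset.sum_congr rfl fun i _ => ?_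
  rw [integral_finsetSum _ fun j _ => hi i j]
  exact Finset.sum_congr rfl fun j _ => integral_const_mul _ _

/-- The variance `∫₀ᵗ h²` of `𝒵_h(·,t)`. -/
def clock (T : ℝ) (h : ℝ → ℝ) (t : ℝ) : ℝ := ∫ r, h r ^ 2 * cut t r ∂(leb T)

lemma integrable_sq_mul_cut {h : ℝ → ℝ} (hh : MemLp h 2 (leb T)) (t : ℝ) :
    Integrable (fun r => h r ^ 2 * cut t r) (leb T) :=
  hh.integrable_sq.mul_bdd (measurable_cut t).aestronglyMeasurable
    (Eventually.of_forall fun r => abs_cut_le t r)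

lemma cut_mono {s t : ℝ} (hst : s ≤ t) (r : ℝ) : cut s r ≤ cut t r :=
  indicator_le_indicator_of_subset (Icc_subset_Icc_right hst) (fun _ => zero_le_one) r

lemma clock_mono {h : ℝ → ℝ} (hh : MemLp h 2 (leb T)) : Monotone (clock T h) := fun s t hst =>
  integral_mono (integrable_sq_mul_cut hh s) (integrable_sq_mul_cut hh t) fun r =>
    mul_le_mul_of_nonneg_left (cut_mono hst r) (sq_nonneg _)

lemma clock_sub_le {h : ℝ → ℝ} (hh : MemLp h 2 (leb T)) {C : ℝ}
    (hC : ∀ᵐ t ∂(leb T), h t ^ 2 ≤ C) {s t : ℝ} (hs : s ∈ Icc (0 : ℝ) T) (ht : t ∈ Icc (0 : ℝ) T)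
    (hst : s ≤ t) : clock T h t - clock T h s ≤ C * (t - s) := by
  have hi : ∀ t : ℝ, Integrable (cut t) (leb T) := fun t =>
    memLp_one_iff_integrable.1 (memLp_cut t 1)
  rw [clock, clock, ← integral_sub (integrable_sq_mul_cut hh t) (integrable_sq_mul_cut hh s)]
  calc _ ≤ ∫ r, C * (cut t r - cut s r) ∂(leb T) := by
        refine integral_mono_ae ((integrable_sq_mul_cut hh t).sub (integrable_sq_mul_cut hh s))
          (((hi t).sub (hi s)).const_mul C) ?_
        filter_upwards [hC] with r hr
        rw [← mul_sub]
        exact mul_le_mul_of_nonneg_right hr (sub_nonneg.2 (cut_mono hst r))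
    _ = C * (t - s) := by
        rw [integral_const_mul, integral_sub (hi t) (hi s), integral_cut ht, integral_cut hs]

lemma clock_nonneg (h : ℝ → ℝ) (t : ℝ) : 0 ≤ clock T h t := by
  refine integral_nonneg fun r => mul_nonneg (sq_nonneg _) ?_
  by_cases hs : r ∈ Icc (0 : ℝ) t <;> simp [cut, hs]

lemma clock_zero (h : ℝ → ℝ) : clock T h 0 = 0 := by
  have : cut 0 =ᵐ[leb T] 0 := by
    have h0 : ∀ᵐ r ∂(leb T), r ≠ 0 := ae_restrict_of_ae (by simp [ae_iff])
    filter_upwards [h0] with r hr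
    simp [cut, hr]
  rw [clock]
  refine (integral_congr_ae (g := fun _ => (0 : ℝ)) ?_).trans (by simp)
  filter_upwards [this] with r hr
  rw [hr]; simp

lemma integral_mul_cut_mul (h : ℝ → ℝ) (s t : ℝ) :
    ∫ r, (h r * cut s r) * (h r * cut t r) ∂(leb T) = clock T h (min s t) := by
  rw [clock]
  congr 1; ext r
  rw [← cut_mul_cut]; ring

lemma integral_leftInd_mul {s t : ℝ} (hs : s ∈ Icc (0 : ℝ) T) (ht : t ∈ Icc (0 : ℝ) T) :
    ∫ r, leftInd s r * leftInd t r ∂(leb T) = min s t := by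
  have hmem : min s t ∈ Icc (0 : ℝ) T := ⟨le_min hs.1 ht.1, (min_le_left _ _).trans hs.2⟩
  rw [← integral_cut hmem]
  refine integral_congr_ae ?_
  have h0 : ∀ᵐ r ∂(leb T), r ≠ min s t := ae_restrict_of_ae (by simp [ae_iff])
  filter_upwards [h0, ae_restrict_mem measurableSet_Icc] with r hr hrT
  have : r ∈ Icc 0 (min s t) ↔ r < s ∧ r < t := by
    rw [← lt_min_iff, mem_Icc]
    exact ⟨fun h => lt_of_le_of_ne h.2 hr, fun h => ⟨hrT.1, h.le⟩⟩
  by_cases hs' : r < s <;> by_cases ht' : r < t <;> simp [leftInd, cut, *]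

end ProcessExistence

/-! ### The continuous version, by comparison with a time-changed Wiener path -/

section ProcessExistence

variable {T : ℝ} {m : Measure (C0 T)} {φ : ℕ → ℝ → ℝ}

/-- The Cramér–Wold device: a functional on a finite product is a linear combination of coordinates,
so the laws of these combinations fix the joint law. -/
lemma IsCG.sum_congr_law {Ω : Type*} [MeasurableSpace Ω] {P : Measure Ω} [IsProbabilityMeasure P]
    {ι : Type*} [Fintype ι] {X Y : ι → Ω → ℝ} (hX : ∀ i, Measurable (X i))
    (hY : ∀ i, Measurable (Y i)) {v : (ι → ℝ) → ℝ}
    (h1 : ∀ c : ι → ℝ, IsCG P (fun ω => ∑ i, c i * X i ω) (v c))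
    (h2 : ∀ c : ι → ℝ, IsCG P (fun ω => ∑ i, c i * Y i ω) (v c)) :
    P.map (fun ω i => X i ω) = P.map (fun ω i => Y i ω) := by
  classical
  have hXm : Measurable fun ω i => X i ω := measurable_pi_lambda _ hX
  have hYm : Measurable fun ω i => Y i ω := measurable_pi_lambda _ hY
  have := Measure.isProbabilityMeasure_map (μ := P) hXm.aemeasurable
  have := Measure.isProbabilityMeasure_map (μ := P) hYm.aemeasurable
  refine Measure.ext_of_charFunDual ?_
  ext L
  have hL : ∀ f : ι → ℝ, L f = ∑ i, L (Pi.single i 1) * f i := by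
    intro f
    conv_lhs => rw [← Finset.univ_sum_single f, map_sum]
    refine Finset.sum_congr rfl fun i _ => ?_
    have : Pi.single i (f i) = f i • (Pi.single i (1 : ℝ) : ι → ℝ) := by
      rw [← Pi.single_smul]; simp
    rw [this, map_smul, smul_eq_mul, mul_comm]
  have key : ∀ {Z : ι → Ω → ℝ}, Measurable (fun ω i => Z i ω) →
      IsCG P (fun ω => ∑ i, L (Pi.single i 1) * Z i ω) (v fun i => L (Pi.single i 1)) →
      charFunDual (P.map fun ω i => Z i ω) L =
        Complex.exp (-(v (fun i => L (Pi.single i 1)) * 1 ^ 2 / 2 : ℝ)) := by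
    intro Z hZ hcg
    rw [charFunDual_apply, integral_map hZ.aemeasurable (by fun_prop), ← hcg.integral_exp 1]
    congr 1; ext ω
    rw [hL, one_mul, mul_comm]
  rw [key hXm (h1 _), key hYm (h2 _)]

/-- Over a countable index set uniform continuity is a countable condition on coordinates, so it can
be transferred between processes with the same law. -/
lemma measurableSet_uniformContinuous {D : Type*} [PseudoMetricSpace D] [Countable D] :
    MeasurableSet {f : D → ℝ | UniformContinuous f} := by
  have : {f : D → ℝ | UniformContinuous f} = ⋂ n : ℕ, ⋃ k : ℕ, ⋂ a : D, ⋂ b : D,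
      {f | dist a b < 1 / (k + 1) → dist (f a) (f b) < 1 / (n + 1)} := by
    ext f
    simp only [mem_ofPred_eq, mem_iInter, mem_iUnion]
    rw [Metric.uniformity_basis_dist_inv_nat_succ.uniformContinuous_iff
      Metric.uniformity_basis_dist_inv_nat_succ]
    simp
  rw [this]
  refine MeasurableSet.iInter fun n => MeasurableSet.iUnion fun k => MeasurableSet.iInter fun a =>
    MeasurableSet.iInter fun b => ?_
  by_cases hab : dist a b < 1 / ((k : ℝ) + 1)
  · simp only [hab, forall_true_left]
    exact measurableSet_lt ((measurable_pi_apply a).dist (measurable_pi_apply b)) measurable_const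
  · simp only [hab, false_imp_iff]
    exact MeasurableSet.const True

lemma exists_continuousMap_extension {X : Type*} [MetricSpace X] {D : Set X} (hD : Dense D)
    {f : D → ℝ} (hf : UniformContinuous f) : ∃ g : C(X, ℝ), ∀ d : D, g d = f d := by
  have hi : IsUniformInducing ((↑) : D → X) := isUniformEmbedding_subtype_val.isUniformInducing
  have hd : DenseRange ((↑) : D → X) := hD.denseRange_val
  refine ⟨⟨(hi.isDenseInducing hd).extend f,
    (uniformContinuous_uniformly_extend hi hd hf).continuous⟩, fun d => ?_⟩
  exact uniformly_extend_of_ind hi hd hf d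

lemma uniformContinuous_time_change (x : C0 T) {D : Set (Icc (0 : ℝ) T)}
    {τ : ℝ → ℝ} (hτ : ∀ t ∈ Icc (0 : ℝ) T, τ t ∈ Icc (0 : ℝ) T)
    (hτc : ∀ s ∈ Icc (0 : ℝ) T, ∀ t ∈ Icc (0 : ℝ) T, |τ s - τ t| ≤ |s - t|) (K : ℝ) :
    UniformContinuous fun t : D => K * val x (τ t) := by
  have h1 : UniformContinuous fun t : D => val x (τ t) := by
    rw [Metric.uniformContinuous_iff]
    intro ε hε
    obtain ⟨δ, hδ, hx⟩ := exists_delta_val x (half_pos hε)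
    refine ⟨δ, hδ, fun a b hab => ?_⟩
    rw [Subtype.dist_eq, Subtype.dist_eq, Real.dist_eq] at hab
    rw [Real.dist_eq]
    exact (hx _ (hτ _ a.1.2) _ (hτ _ b.1.2) ((hτc _ a.1.2 _ b.1.2).trans hab.le)).trans_lt
      (half_lt_self hε)
  exact (uniformContinuous_const_smul K).comp h1

lemma integral_sq_mul_cut_sub_le {h : ℝ → ℝ} {C : ℝ}
    (hC : ∀ᵐ t ∂(leb T), h t ^ 2 ≤ C) {s t : ℝ} (hs : s ∈ Icc (0 : ℝ) T)
    (ht : t ∈ Icc (0 : ℝ) T) :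
    ∫ r, (h r * cut s r - h r * cut t r) ^ 2 ∂(leb T) ≤ C * |s - t| := by
  have hi : ∀ t : ℝ, Integrable (cut t) (leb T) := fun t =>
    memLp_one_iff_integrable.1 (memLp_cut t 1)
  have hmin : min s t ∈ Icc (0 : ℝ) T := ⟨le_min hs.1 ht.1, (min_le_left _ _).trans hs.2⟩
  have e : ∀ r, (cut s r - cut t r) ^ 2 = cut s r + cut t r - 2 * cut (min s t) r := fun r => by
    have h1 := cut_mul_cut s s r
    have h2 := cut_mul_cut t t r
    rw [min_self] at h1 h2
    rw [← cut_mul_cut s t]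
    linear_combination h1 + h2
  calc _ ≤ ∫ r, C * (cut s r + cut t r - 2 * cut (min s t) r) ∂(leb T) := by
        refine integral_mono_of_nonneg (Eventually.of_forall fun r => sq_nonneg _)
          ((((hi s).add (hi t)).sub ((hi _).const_mul 2)).const_mul C) ?_
        filter_upwards [hC] with r hr
        rw [← mul_sub, mul_pow, e]
        exact mul_le_mul_of_nonneg_right hr (by rw [← e]; exact sq_nonneg _)
    _ = C * |s - t| := by
        have hst : Integrable (fun r => cut s r + cut t r) (leb T) := (hi s).add (hi t)
        rw [integral_const_mul, integral_sub hst ((hi _).const_mul 2),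
          integral_add (hi s) (hi t), integral_const_mul, integral_cut hs, integral_cut ht,
          integral_cut hmin]
        congr 1
        rcases le_total s t with h | h
        · rw [min_eq_left h, abs_of_nonpos (by linarith)]; ring
        · rw [min_eq_right h, abs_of_nonneg (by linarith)]; ring

/-- On the countable set `D` the family $\langle h\chi_{[0,t]},x\rangle$ has the law of $\sqrt
C\,x(\tau(t))$, with $\tau$ the normalized variance. The latter is uniformly continuous for every
path, so the former is almost surely. -/
lemma ae_uniformContinuous_pwz (hT : 0 < T) (hm : IsWienerMeasure m) (hφ : IsBVBasis T φ)
    {h : ℝ → ℝ} (hh : MemLp h ∞ (leb T)) {D : Set (Icc (0 : ℝ) T)} (hD : D.Countable) :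
    ∀ᵐ x ∂m, UniformContinuous fun t : D => pwz φ (fun r => h r * cut t r) x := by
  have := hm.prob
  have := hD.to_subtype
  obtain ⟨C, hC0, hC⟩ := exists_bound_of_memLp_top hh
  have hh2 := memLp_two_of_top hh
  -- Division by a bound of $h^2$ makes the clock 1-Lipschitz, so the new time stays in `[0,T]`; the
  -- factor `√C` in `Y` restores the variance.
  set τ : ℝ → ℝ := fun t => clock T h t / C with hτdef
  have hmono : Monotone τ := fun s t hst =>
    div_le_div_of_nonneg_right (clock_mono hh2 hst) hC0.le
  have hτc : ∀ s ∈ Icc (0 : ℝ) T, ∀ t ∈ Icc (0 : ℝ) T, |τ s - τ t| ≤ |s - t| := by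
    have key : ∀ s ∈ Icc (0 : ℝ) T, ∀ t ∈ Icc (0 : ℝ) T, s ≤ t → |τ s - τ t| ≤ |s - t| := by
      intro s hs t ht hst
      rw [abs_sub_comm, abs_of_nonneg (sub_nonneg.2 (hmono hst)), abs_sub_comm,
        abs_of_nonneg (sub_nonneg.2 hst), hτdef]
      dsimp only
      rw [← sub_div, div_le_iff₀ hC0, mul_comm]
      exact clock_sub_le hh2 hC hs ht hst
    intro s hs t ht
    rcases le_total s t with hst | hst
    · exact key s hs t ht hst
    · rw [abs_sub_comm, abs_sub_comm s]; exact key t ht s hs hst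
  have hτ : ∀ t ∈ Icc (0 : ℝ) T, τ t ∈ Icc (0 : ℝ) T := by
    intro t ht
    have h0 : τ 0 = 0 := by simp [hτdef, clock_zero]
    have h1 : 0 ≤ τ t := div_nonneg (clock_nonneg h t) hC0.le
    have h2 := hτc t ht 0 ⟨le_rfl, hT.le⟩
    rw [h0, sub_zero, sub_zero, abs_of_nonneg h1, abs_of_nonneg ht.1] at h2
    exact ⟨h1, h2.trans ht.2⟩
  set X : D → C0 T → ℝ := fun t => pwz φ (fun r => h r * cut t r) with hX
  set Y : D → C0 T → ℝ := fun t x => √C * val x (τ t) with hY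
  have hXm : ∀ t, Measurable (X t) := fun t => measurable_pwz hT hφ _
  have hYm : ∀ t, Measurable (Y t) := fun t => (continuous_val _).measurable.const_mul _
  -- Equality of laws reduces to finite sets of times, where both families are centered Gaussian
  -- with covariance `clock T h (min s t)`. For `Y` this uses that the monotone `τ` commutes with
  -- `min`.
  have hlaw : m.map (fun x t => X t x) = m.map (fun x t => Y t x) := by
    rw [map_eq_iff_forall_finset_map_restrict_eq (measurable_pi_lambda _ hXm).aemeasurable
      (measurable_pi_lambda _ hYm).aemeasurable]
    intro I
    refine IsCG.sum_congr_law (P := m) (X := fun i : I => X i) (Y := fun i : I => Y i)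
      (fun i => hXm _) (fun i => hYm _)
      (v := fun c => ∑ i, ∑ j, c i * c j * clock T h (min (i : ℝ) (j : ℝ))) ?_ ?_
    · intro c
      have hmem : ∀ i : I, MemLp (fun r => h r * cut (i : ℝ) r) 2 (leb T) := fun i =>
        memLp_mul_of_memLp_top hh (memLp_cut _ 2)
      have h1 := isCG_pwz hT hm hφ (memLp_finsetSum Finset.univ fun i _ => (hmem i).const_mul (c i))
      rw [integral_sq_sum _ _ hmem] at h1
      simp only [integral_mul_cut_mul] at h1
      exact h1.congr (ae_pwz_sum hT hm hφ Finset.univ c hmem)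
    · intro c
      have h1 := (hm.isCG_rsIntegral hT (bv_sum Finset.univ fun (i : I) _ =>
        bv_const_mul (c i) (bv_leftInd (τ i)))).const_mul √C
      rw [integral_sq_sum _ _ fun i => bv_memLp (bv_leftInd _) 2, Real.sq_sqrt hC0.le,
        Finset.mul_sum] at h1
      simp only [integral_leftInd_mul (hτ _ (Subtype.prop _)) (hτ _ (Subtype.prop _)),
        ← hmono.map_min, Finset.mul_sum] at h1
      convert h1 using 1
      · ext x
        rw [rsIntegral_sum hT _ _ fun i _ => bv_leftInd _, Finset.mul_sum]
        refine Finset.sum_congr rfl fun i _ => ?_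
        rw [rsIntegral_leftInd hT x (hτ _ (Subtype.prop _))]
        simp only [hY]; ring
      · refine Finset.sum_congr rfl fun i _ => Finset.sum_congr rfl fun j _ => ?_
        simp only [hτdef]; field_simp
  have hYae : ∀ᵐ f ∂(m.map fun x t => X t x), UniformContinuous f := by
    rw [hlaw, ae_map_iff (measurable_pi_lambda _ hYm).aemeasurable measurableSet_uniformContinuous]
    exact Eventually.of_forall fun x => uniformContinuous_time_change x hτ hτc _
  rwa [ae_map_iff (measurable_pi_lambda _ hXm).aemeasurable
    measurableSet_uniformContinuous] at hYae

theorem exists_isProcessVersion (hT : 0 < T) (hm : IsWienerMeasure m) (hφ : IsBVBasis T φ)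
    {h : ℝ → ℝ} (hh : MemLp h ∞ (leb T)) : ∃ Z, IsProcessVersion m φ h Z := by
  classical
  obtain ⟨D, hDc, hDd⟩ := TopologicalSpace.exists_countable_dense (Icc (0 : ℝ) T)
  obtain ⟨C, hC0, hC⟩ := exists_bound_of_memLp_top hh
  have hmem : ∀ t : ℝ, MemLp (fun r => h r * cut t r) 2 (leb T) := fun t =>
    memLp_mul_of_memLp_top hh (memLp_cut _ 2)
  set G : C0 T → C(Icc (0 : ℝ) T, ℝ) := fun x =>
    if H : UniformContinuous fun t : D => pwz φ (fun r => h r * cut t r) x then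
      (exists_continuousMap_extension hDd H).choose else 0 with hG
  -- At a time outside `D` the extension is the limit of its values along `D`, and $L_2$ convergence
  -- of the integrands identifies that limit.
  have hGae : ∀ t : Icc (0 : ℝ) T, (fun x => G x t) =ᵐ[m] pwz φ fun r => h r * cut t r := by
    intro t
    obtain ⟨d, hd, hdt⟩ := mem_closure_iff_seq_limit.1 (hDd t)
    refine ae_eq_pwz_of_tendsto hT hm hφ (u := fun n r => h r * cut (d n) r)
      (fun n => hmem _) (hmem _) ?_ ?_
    · refine squeeze_zero (fun n => integral_nonneg fun r => sq_nonneg _)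
        (fun n => integral_sq_mul_cut_sub_le hC (d n).2 t.2) ?_
      have h1 : Tendsto (fun n => |((d n : ℝ)) - t|) atTop (𝓝 0) := by
        have := tendsto_iff_dist_tendsto_zero.1 hdt
        simpa only [Subtype.dist_eq, Real.dist_eq] using this
      simpa using h1.const_mul C
    · filter_upwards [ae_uniformContinuous_pwz hT hm hφ hh hDc] with x hx
      have h1 : ∀ s : D, G x s = pwz φ (fun r => h r * cut s r) x := fun s => by
        simp only [hG, dif_pos hx]
        exact (exists_continuousMap_extension hDd hx).choose_spec s
      have h2 : Tendsto (fun n => G x (d n)) atTop (𝓝 (G x t)) :=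
          ((G x).continuous.tendsto t).comp hdt
      refine h2.congr fun n => h1 ⟨d n, hd n⟩
  refine ⟨fun x => if H : ∀ t : Icc (0 : ℝ) T, (t : ℝ) = 0 → G x t = 0 then ⟨G x, H⟩ else 0,
    fun t => ?_⟩
  -- The extension vanishes at time 0 only almost surely; on the exceptional paths it is replaced by
  -- the zero path.
  have hzero : ∀ᵐ x ∂m, ∀ t : Icc (0 : ℝ) T, (t : ℝ) = 0 → G x t = 0 := by
    filter_upwards [hGae ⟨0, le_rfl, hT.le⟩] with x hx s hs
    have hs' : s = ⟨0, le_rfl, hT.le⟩ := Subtype.ext hs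
    rw [hs', hx]
    have h0 : (fun r => h r * cut (0 : ℝ) r) =ᵐ[leb T] fun _ => 0 := by
      have h0 : ∀ᵐ r ∂(leb T), r ≠ 0 := ae_restrict_of_ae (by simp [ae_iff])
      filter_upwards [h0] with r hr
      simp [cut, hr]
    rw [pwz_congr h0]
    refine (PWZExists.of_tendsto (tendsto_const_nhds.congr fun n => ?_)).2
    simp [pwzSum]
  filter_upwards [hzero, hGae t, ae_pwzExists hT hm hφ (hmem t)] with x h1 h2 h3
  rw [dif_pos h1, indicator_eq_cut_mul]
  have := h3.tendsto
  rw [← h2] at this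
  exact this

lemma proc_spec (hT : 0 < T) (hm : IsWienerMeasure m) (hφ : IsBVBasis T φ)
    {h : ℝ → ℝ} (hh : MemLp h ∞ (leb T)) : IsProcessVersion m φ h (proc m φ h) := by
  have H := exists_isProcessVersion hT hm hφ hh
  unfold proc
  rw [dif_pos H]
  exact H.choose_spec

lemma ae_val_proc (hT : 0 < T) (hm : IsWienerMeasure m) (hφ : IsBVBasis T φ)
    {h : ℝ → ℝ} (hh : MemLp h ∞ (leb T)) {t : ℝ} (ht : t ∈ Icc (0 : ℝ) T) :
    ∀ᵐ x ∂m, val (proc m φ h x) t = pwz φ (fun r => h r * cut t r) x := by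
  filter_upwards [proc_spec hT hm hφ hh ⟨t, ht⟩] with x hx
  rw [indicator_eq_cut_mul] at hx
  rw [val_of_mem _ ht, (PWZExists.of_tendsto hx).2]

/-! ### Paley–Wiener–Zygmund integrals against `𝒵_h` -/

/-- A Riemann–Stieltjes sum along $\mathcal Z_h$ is a combination of finitely many values of the
process, hence almost surely $\langle h\psi_n,x\rangle$ with the step function $\psi_n$ of `ψ`. Then
$h\psi_n\to h\psi$ in $L_2$. -/
lemma ae_rsIntegral_proc (hT : 0 < T) (hm : IsWienerMeasure m) (hφ : IsBVBasis T φ)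
    {h ψ : ℝ → ℝ} (hh : MemLp h ∞ (leb T)) (hψ : BoundedVariationOn ψ (Icc 0 T)) :
    ∀ᵐ x ∂m, rsIntegral ψ (proc m φ h x) = pwz φ (fun r => h r * ψ r) x := by
  have hmem : ∀ t : ℝ, MemLp (fun r => h r * cut t r) 2 (leb T) := fun t =>
    memLp_mul_of_memLp_top hh (memLp_cut _ 2)
  have hstep : ∀ n, MemLp (fun r => h r * stepFn T ψ n r) 2 (leb T) := by
    intro n
    obtain ⟨M, _, hM⟩ := bv_exists_bound hψ
    refine memLp_mul_of_memLp_top hh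
      (MemLp.of_bound (measurable_stepFn ψ n).aestronglyMeasurable M ?_)
    filter_upwards [ae_restrict_mem measurableSet_Icc] with s hs using abs_stepFn_le hT hM n hs
  refine ae_eq_pwz_of_tendsto hT hm hφ (u := fun n r => h r * stepFn T ψ n r) hstep
    (memLp_mul_of_memLp_top hh (bv_memLp hψ 2))
    (tendsto_integral_sq_mul_stepFn_sub hT hψ (memLp_two_of_top hh)) ?_
  have key : ∀ᵐ x ∂m, ∀ n : ℕ, 0 < n → rsSum ψ (proc m φ h x) n =
      pwz φ (fun r => h r * stepFn T ψ n r) x := by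
    rw [ae_all_iff]
    intro n
    rcases Nat.eq_zero_or_pos n with rfl | hn
    · simp
    have h1 : ∀ᵐ x ∂m, ∀ k ∈ Finset.range (n + 1), val (proc m φ h x) (k * T / n) =
        pwz φ (fun r => h r * cut (k * T / n) r) x := by
      rw [Finset.eventually_all]
      intro k hk
      exact ae_val_proc hT hm hφ hh (grid_mem hT (Nat.lt_succ_iff.1 (Finset.mem_range.1 hk)))
    have hd : ∀ k : ℕ, MemLp (fun r => h r * (cut ((k + 1) * T / n) r - cut (k * T / n) r)) 2
        (leb T) := fun k => memLp_mul_of_memLp_top hh ((memLp_cut _ 2).sub (memLp_cut _ 2))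
    have h2 := ae_pwz_sum hT hm hφ (Finset.range n) (fun k : ℕ => ψ (k * T / n)) hd
    have h3 : ∀ᵐ x ∂m, ∀ k : ℕ,
        pwz φ (fun r => h r * (cut ((k + 1) * T / n) r - cut (k * T / n) r)) x =
        pwz φ (fun r => h r * cut ((k + 1) * T / n) r) x -
          pwz φ (fun r => h r * cut (k * T / n) r) x := by
      rw [ae_all_iff]
      intro k
      filter_upwards [ae_pwz_linear hT hm hφ (hmem ((k + 1) * T / n)) (hmem (k * T / n)) 1 (-1)]
        with x hx
      simp only [mul_sub]
      simpa [sub_eq_add_neg] using hx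
    filter_upwards [h1, h2, h3] with x h1 h2 h3 _
    have e : (fun r => h r * stepFn T ψ n r) =ᵐ[leb T] fun r => ∑ k ∈ Finset.range n,
        ψ (k * T / n) * (h r * (cut ((k + 1) * T / n) r - cut (k * T / n) r)) := by
      filter_upwards [stepFn_eq_sum hT ψ hn] with r hr
      rw [hr, Finset.mul_sum]
      exact Finset.sum_congr rfl fun k _ => by ring
    rw [pwz_congr e, h2, rsSum]
    refine Finset.sum_congr rfl fun k hk => ?_
    rw [Finset.mem_range] at hk
    have h4 := h1 (k + 1) (Finset.mem_range.2 (by omega))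
    push_cast at h4
    rw [h3, h1 k (Finset.mem_range.2 (by omega)), h4]
  filter_upwards [key] with x hx
  refine (tendsto_rsSum hT hψ _).congr' ?_
  filter_upwards [eventually_gt_atTop 0] with n hn using hx n hn

end ProcessExistence

section ProcessIntegrals

variable {T : ℝ} {m : Measure (C0 T)} {φ : ℕ → ℝ → ℝ}

lemma IsCG.prod_add {Ω Ω' : Type*} [MeasurableSpace Ω] [MeasurableSpace Ω'] {P : Measure Ω}
    {Q : Measure Ω'} [IsProbabilityMeasure P] [IsProbabilityMeasure Q] {X : Ω → ℝ} {Y : Ω' → ℝ}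
    {v w : ℝ} (hX : IsCG P X v) (hY : IsCG Q Y w) :
    IsCG (P.prod Q) (fun p => X p.1 + Y p.2) (v + w) := by
  have hXm : AEMeasurable (fun p : Ω × Ω' => X p.1) (P.prod Q) :=
    hX.1.comp_quasiMeasurePreserving Measure.quasiMeasurePreserving_fst
  have hYm : AEMeasurable (fun p : Ω × Ω' => Y p.2) (P.prod Q) :=
    hY.1.comp_quasiMeasurePreserving Measure.quasiMeasurePreserving_snd
  have hs : AEMeasurable (fun p : Ω × Ω' => X p.1 + Y p.2) (P.prod Q) := hXm.add hYm
  refine ⟨hs, fun s => ?_⟩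
  rw [charFun_map_eq_integral hs]
  have e : ∀ p : Ω × Ω', Complex.exp (s * ((X p.1 + Y p.2 : ℝ) : ℂ) * Complex.I) =
      Complex.exp (s * X p.1 * Complex.I) * Complex.exp (s * Y p.2 * Complex.I) := fun p => by
    rw [← Complex.exp_add]; congr 1; push_cast; ring
  simp only [e]
  rw [integral_prod_mul (fun ω => Complex.exp (s * X ω * Complex.I))
    (fun ω => Complex.exp (s * Y ω * Complex.I)), ← charFun_map_eq_integral hX.1,
    ← charFun_map_eq_integral hY.1, hX.2, hY.2, ← Complex.exp_add]
  congr 1; push_cast; ring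

/-- The functions $h\phi_j$ are in general not orthogonal, so the coordinates of $\mathcal Z_h$ are
dependent. An independent copy with complementary weight `k` restores orthogonality up to the factor
`C`. -/
lemma isStdGaussianSeq_mix (hT : 0 < T) (hm : IsWienerMeasure m) (hφ : IsBVBasis T φ)
    {h k : ℝ → ℝ} (hh : MemLp h ∞ (leb T)) (hk : MemLp k ∞ (leb T)) {C : ℝ} (hC : 0 < C)
    (hhk : ∀ᵐ t ∂(leb T), h t ^ 2 + k t ^ 2 = C) {ε : ℝ} (hε : ε ^ 2 = 1) :
    IsStdGaussianSeq (m.prod m) fun j p => (√C)⁻¹ *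
      (pwz φ (fun t => h t * φ j t) p.1 + ε * pwz φ (fun t => k t * φ j t) p.2) := by
  have := hm.prob
  refine ⟨fun j => ?_, fun S c => ?_⟩
  · exact (((measurable_pwz hT hφ _).comp measurable_fst).add
      (((measurable_pwz hT hφ _).comp measurable_snd).const_mul _)).const_mul _
  have hmem : ∀ {g : ℝ → ℝ}, MemLp g ∞ (leb T) → ∀ j, MemLp (fun t => g t * φ j t) 2 (leb T) :=
    fun hg j => memLp_mul_of_memLp_top hg (hφ.memLp j)
  have hX : ∀ {g : ℝ → ℝ}, MemLp g ∞ (leb T) →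
      IsCG m (fun x => ∑ j ∈ S, c j * pwz φ (fun t => g t * φ j t) x)
        (∫ t, g t ^ 2 * (∑ j ∈ S, c j * φ j t) ^ 2 ∂(leb T)) := by
    intro g hg
    have h1 := isCG_pwz hT hm hφ (memLp_finsetSum S fun j _ => (hmem hg j).const_mul (c j))
    refine (h1.congr (ae_pwz_sum hT hm hφ S c (hmem hg))).congr_var ?_
    refine integral_congr_ae (Eventually.of_forall fun t => ?_)
    dsimp only
    rw [← mul_pow, Finset.mul_sum]
    congr 1
    exact Finset.sum_congr rfl fun j _ => by ring
  have hint : ∀ {g : ℝ → ℝ}, MemLp g ∞ (leb T) →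
      Integrable (fun t => g t ^ 2 * (∑ j ∈ S, c j * φ j t) ^ 2) (leb T) := by
    intro g hg
    have := (memLp_mul_of_memLp_top hg (hφ.memLp_sum S c)).integrable_sq
    simpa only [mul_pow] using this
  have h2 := ((hX hh).prod_add ((hX hk).const_mul ε)).const_mul (√C)⁻¹
  refine (h2.congr (Eventually.of_forall fun p => ?_)).congr_var ?_
  · dsimp only
    rw [Finset.mul_sum, ← Finset.sum_add_distrib, Finset.mul_sum]
    exact Finset.sum_congr rfl fun j _ => by ring
  · rw [hε, one_mul, ← integral_add (hint hh) (hint hk), inv_pow, Real.sq_sqrt hC.le,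
      ← hφ.integral_sum_sq S c, inv_mul_eq_iff_eq_mul₀ hC.ne', ← integral_const_mul]
    refine integral_congr_ae ?_
    filter_upwards [hhk] with t ht
    rw [← add_mul, ht]

/-- The Paley–Wiener–Zygmund integral of a fixed function against `𝒵_h` exists almost surely. -/
theorem ae_pwzExists_proc (hT : 0 < T) (hm : IsWienerMeasure m) (hφ : IsBVBasis T φ)
    {h u : ℝ → ℝ} (hh : MemLp h ∞ (leb T)) (hu : MemLp u 2 (leb T)) :
    ∀ᵐ x ∂m, PWZExists φ u (proc m φ h x) := by
  have := hm.prob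
  obtain ⟨C, hC0, hC⟩ := exists_bound_of_memLp_top hh
  set k : ℝ → ℝ := fun t => √(C - h t ^ 2) with hkdef
  have hk : MemLp k ∞ (leb T) := by
    refine memLp_top_of_bound ?_ √C ?_
    · exact (Real.continuous_sqrt.comp_aestronglyMeasurable
        (aestronglyMeasurable_const.sub (hh.1.pow 2)))
    · refine Eventually.of_forall fun t => ?_
      rw [Real.norm_eq_abs, abs_of_nonneg (Real.sqrt_nonneg _)]
      exact Real.sqrt_le_sqrt (by linarith [sq_nonneg (h t)])
  have hhk : ∀ᵐ t ∂(leb T), h t ^ 2 + k t ^ 2 = C := by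
    filter_upwards [hC] with t ht
    rw [hkdef, Real.sq_sqrt (by linarith)]; ring
  have hsum := (hφ.hasSum_sq hu).summable
  -- Both signs give convergent series on the product space; in their sum the `k` part cancels and
  -- only the `h` part remains.
  have h1 := (isStdGaussianSeq_mix hT hm hφ hh hk hC0 hhk (ε := 1) (by norm_num)).ae_tendsto hsum
  have h2 := (isStdGaussianSeq_mix hT hm hφ hh hk hC0 hhk (ε := -1) (by norm_num)).ae_tendsto hsum
  have h3 : ∀ᵐ p ∂(m.prod m), ∃ l, Tendsto (fun n => ∑ j ∈ Finset.range n,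
      (∫ t, u t * φ j t ∂(leb T)) * pwz φ (fun t => h t * φ j t) p.1) atTop (𝓝 l) := by
    filter_upwards [h1, h2] with p ⟨l1, hl1⟩ ⟨l2, hl2⟩
    refine ⟨√C / 2 * (l1 + l2), ((hl1.add hl2).const_mul (√C / 2)).congr fun n => ?_⟩
    have hs : √C ≠ 0 := (Real.sqrt_pos.2 hC0).ne'
    rw [← Finset.sum_add_distrib, Finset.mul_sum]
    refine Finset.sum_congr rfl fun j _ => ?_
    field_simp
    ring
  have h4 := Measure.ae_ae_of_ae_prod h3
  have h5 : ∀ᵐ x ∂m, ∀ j, rsIntegral (φ j) (proc m φ h x) = pwz φ (fun t => h t * φ j t) x :=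
    ae_all_iff.2 fun j => ae_rsIntegral_proc hT hm hφ hh (hφ.bv j)
  filter_upwards [h4, h5] with x h4 h5
  -- The series no longer involves the second coordinate, so a single admissible value of it is
  -- enough.
  obtain ⟨_, l, hl⟩ := h4.exists
  refine ⟨l, hl.congr fun n => ?_⟩
  simp only [pwzSum, h5]

/-- `⟨u, 𝒵_h(x,·)⟩ = ⟨u h, x⟩` almost surely. -/
theorem ae_pwz_proc (hT : 0 < T) (hm : IsWienerMeasure m) (hφ : IsBVBasis T φ)
    {h u : ℝ → ℝ} (hh : MemLp h ∞ (leb T)) (hu : MemLp u 2 (leb T)) :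
    ∀ᵐ x ∂m, pwz φ u (proc m φ h x) = pwz φ (fun t => h t * u t) x := by
  obtain ⟨C, hC0, hC⟩ := exists_bound_of_memLp_top hh
  set c : ℕ → ℝ := fun j => ∫ t, u t * φ j t ∂(leb T) with hc
  have hmem : ∀ j, MemLp (fun t => h t * φ j t) 2 (leb T) :=
    fun j => memLp_mul_of_memLp_top hh (hφ.memLp j)
  -- The partial sums of $\langle u,\mathcal Z_h\rangle$ are almost surely the integrals of $hP_nu$,
  -- with $P_nu$ the partial expansion of `u`. As `h` is bounded, $hP_nu\to hu$ in $L_2$.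
  refine ae_eq_pwz_of_tendsto hT hm hφ
    (u := fun n t => h t * ∑ j ∈ Finset.range n, c j * φ j t)
    (fun n => memLp_mul_of_memLp_top hh (hφ.memLp_sum _ c)) (memLp_mul_of_memLp_top hh hu) ?_ ?_
  · have h1 := (hφ.tendsto_integral_sq_sub hu).const_mul C
    rw [mul_zero] at h1
    refine squeeze_zero (fun n => integral_nonneg fun t => sq_nonneg _) (fun n => ?_) h1
    rw [← integral_const_mul]
    refine integral_mono_of_nonneg (Eventually.of_forall fun t => sq_nonneg _)
      (((hφ.memLp_sum _ _).sub hu).integrable_sq.const_mul C) ?_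
    filter_upwards [hC] with t ht
    rw [← mul_sub, mul_pow]
    exact mul_le_mul_of_nonneg_right ht (sq_nonneg _)
  · have h5 : ∀ᵐ x ∂m, ∀ j, rsIntegral (φ j) (proc m φ h x) = pwz φ (fun t => h t * φ j t) x :=
      ae_all_iff.2 fun j => ae_rsIntegral_proc hT hm hφ hh (hφ.bv j)
    have h6 : ∀ᵐ x ∂m, ∀ n, pwz φ (fun t => ∑ j ∈ Finset.range n, c j * (h t * φ j t)) x =
        ∑ j ∈ Finset.range n, c j * pwz φ (fun t => h t * φ j t) x :=
      ae_all_iff.2 fun n => ae_pwz_sum hT hm hφ _ c hmem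
    filter_upwards [h5, h6, ae_pwzExists_proc hT hm hφ hh hu] with x h5 h6 h7
    refine h7.tendsto.congr fun n => ?_
    have e : (fun t => h t * ∑ j ∈ Finset.range n, c j * φ j t) =
        fun t => ∑ j ∈ Finset.range n, c j * (h t * φ j t) := by
      ext t
      rw [Finset.mul_sum]
      exact Finset.sum_congr rfl fun j _ => by ring
    rw [e, h6]
    simp only [pwzSum, h5, hc]

/-! ### Joint measurability -/

lemma measurable_integral_mul {ψ : ℝ → ℝ} (hψ : MemLp ψ 2 (leb T)) :
    Measurable fun u : L2 T => ∫ t, u t * ψ t ∂(leb T) := by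
  have h : Continuous fun u : L2 T => inner ℝ u (hψ.toLp ψ) :=
    continuous_id.inner continuous_const
  refine (h.congr fun u => ?_).measurable
  rw [L2.inner_def]
  refine integral_congr_ae ?_
  filter_upwards [hψ.coeFn_toLp] with t h1
  rw [h1]; simp [mul_comm]

lemma measurable_coeff (hφ : IsBVBasis T φ) (j : ℕ) :
    Measurable fun u : L2 T => ∫ t, u t * φ j t ∂(leb T) :=
  measurable_integral_mul (hφ.memLp j)

/-- Parseval reduces the energy to the coefficients, so no joint measurability in `(ω, t)` is
needed. -/
lemma measurable_integral_sq (hφ : IsBVBasis T φ) {Ω : Type*} [MeasurableSpace Ω]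
    {W : Ω → ℝ → ℝ} (hW : ∀ ω, MemLp (W ω) 2 (leb T))
    (hmeas : ∀ j, Measurable fun ω => ∫ t, W ω t * φ j t ∂(leb T)) :
    Measurable fun ω => ∫ t, W ω t ^ 2 ∂(leb T) :=
  measurable_of_tendsto_metrizable
    (fun n => Finset.measurable_sum (Finset.range n) fun j _ => (hmeas j).pow_const 2)
    (tendsto_pi_nhds.2 fun ω => (hφ.hasSum_sq (hW ω)).tendsto_sum_nat)

lemma measurable_coeff_mul (hφ : IsBVBasis T φ) {h : ℝ → ℝ} (hh : MemLp h ∞ (leb T)) (j : ℕ) :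
    Measurable fun u : L2 T => ∫ t, h t * u t * φ j t ∂(leb T) := by
  convert measurable_integral_mul (memLp_mul_of_memLp_top hh (hφ.memLp j)) using 4
  ring

lemma measurable_integral_sq_mul (hφ : IsBVBasis T φ) {h : ℝ → ℝ} (hh : MemLp h ∞ (leb T)) :
    Measurable fun u : L2 T => ∫ t, (h t * u t) ^ 2 ∂(leb T) :=
  measurable_integral_sq hφ (fun u => memLp_mul_of_memLp_top hh (Lp.memLp u))
    (measurable_coeff_mul hφ hh)

variable {Ω : Type*} [MeasurableSpace Ω] {μ : Measure Ω} {U : Ω → L2 T}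
  {A : C0 T → C0 T}

/-- A version of the sequence of Wiener integrals of the basis functions along `A` that is
measurable, together with the resulting jointly measurable partial sums. -/
lemma exists_measurable_coordinates (hA : ∀ j, AEMeasurable (fun x => rsIntegral (φ j) (A x)) m) :
    ∃ a : ℕ → C0 T → ℝ, (∀ j, Measurable (a j)) ∧
      ∀ᵐ x ∂m, ∀ u n, pwzSum φ u (A x) n =
        ∑ j ∈ Finset.range n, (∫ t, u t * φ j t ∂(leb T)) * a j x := by
  refine ⟨fun j => (hA j).mk _, fun j => (hA j).measurable_mk, ?_⟩
  have h1 : ∀ᵐ x ∂m, ∀ j, rsIntegral (φ j) (A x) = (hA j).mk _ x :=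
    ae_all_iff.2 fun j => (hA j).ae_eq_mk
  filter_upwards [h1] with x hx u n
  simp only [pwzSum, hx]

lemma measurable_coordinates_sum (hφ : IsBVBasis T φ) (hU : Measurable U) {a : ℕ → C0 T → ℝ}
    (ha : ∀ j, Measurable (a j)) (n : ℕ) :
    Measurable fun p : Ω × C0 T =>
      ∑ j ∈ Finset.range n, (∫ t, U p.1 t * φ j t ∂(leb T)) * a j p.2 :=
  Finset.measurable_sum _ fun j _ =>
    (((measurable_coeff hφ j).comp hU).comp measurable_fst).mul ((ha j).comp measurable_snd)

lemma aemeasurable_pwz_prod [SFinite m] (hφ : IsBVBasis T φ) (hU : Measurable U)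
    (hA : ∀ j, AEMeasurable (fun x => rsIntegral (φ j) (A x)) m) :
    AEMeasurable (fun p : Ω × C0 T => pwz φ (U p.1) (A p.2)) (μ.prod m) := by
  obtain ⟨a, ha, hae⟩ := exists_measurable_coordinates hA
  refine ⟨fun p => limUnder atTop fun n =>
    ∑ j ∈ Finset.range n, (∫ t, U p.1 t * φ j t ∂(leb T)) * a j p.2, ?_, ?_⟩
  · exact (StronglyMeasurable.limUnder (l := atTop) fun n =>
      (measurable_coordinates_sum hφ hU ha n).stronglyMeasurable).measurable
  · filter_upwards [Measure.quasiMeasurePreserving_snd.ae hae] with p hp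
    rw [pwz, funext (hp (U p.1))]

/-- Fubini, applied to the convergence set of the partial sums built from measurable versions of the
coordinates, which is measurable in both variables. -/
lemma ae_ae_pwzExists [SFinite μ] [SFinite m] (hφ : IsBVBasis T φ) (hU : Measurable U)
    (hA : ∀ j, AEMeasurable (fun x => rsIntegral (φ j) (A x)) m)
    (hE : ∀ u : L2 T, ∀ᵐ x ∂m, PWZExists φ u (A x)) :
    ∀ᵐ x ∂m, ∀ᵐ ω ∂μ, PWZExists φ (U ω) (A x) := by
  obtain ⟨a, ha, hae⟩ := exists_measurable_coordinates hA
  have hmeas : MeasurableSet {p : Ω × C0 T | ∃ l, Tendsto (fun n =>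
      ∑ j ∈ Finset.range n, (∫ t, U p.1 t * φ j t ∂(leb T)) * a j p.2) atTop (𝓝 l)} :=
    measurableSet_exists_tendsto fun n => measurable_coordinates_sum hφ hU ha n
  have h1 : ∀ᵐ ω ∂μ, ∀ᵐ x ∂m, (ω, x) ∈ {p : Ω × C0 T | ∃ l, Tendsto (fun n =>
      ∑ j ∈ Finset.range n, (∫ t, U p.1 t * φ j t ∂(leb T)) * a j p.2) atTop (𝓝 l)} := by
    refine Eventually.of_forall fun ω => ?_
    filter_upwards [hE (U ω), hae] with x ⟨l, hl⟩ hx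
    exact ⟨l, hl.congr (hx (U ω))⟩
  have h2 := (Measure.ae_ae_comm hmeas).1 h1
  filter_upwards [h2, hae] with x h2 hx
  filter_upwards [h2] with ω ⟨l, hl⟩
  exact ⟨l, hl.congr fun n => (hx (U ω) n).symm⟩

lemma aemeasurable_rsIntegral_proc (hT : 0 < T) (hm : IsWienerMeasure m) (hφ : IsBVBasis T φ)
    {h : ℝ → ℝ} (hh : MemLp h ∞ (leb T)) (j : ℕ) :
    AEMeasurable (fun x => rsIntegral (φ j) (proc m φ h x)) m :=
  (measurable_pwz hT hφ _).aemeasurable.congr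
    ((ae_rsIntegral_proc hT hm hφ hh (hφ.bv j)).mono fun _ h => h.symm)

end ProcessIntegrals

/-! ### Integrals against complex measures through densities -/

section ComplexMeasures

variable {X : Type*} [MeasurableSpace X]

lemma SignedMeasure.exists_withDensityᵥ_eq (s : SignedMeasure X) (μ : Measure X) [IsFiniteMeasure μ]
    (h : s.totalVariation ≪ μ) : ∃ g : X → ℝ, Integrable g μ ∧ s = μ.withDensityᵥ g := by
  refine ⟨s.rnDeriv μ, SignedMeasure.integrable_rnDeriv _ _, ?_⟩
  refine (SignedMeasure.withDensityᵥ_rnDeriv_eq s μ ?_).symm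
  rw [SignedMeasure.absolutelyContinuous_ennreal_iff]
  exact (VectorMeasure.ennrealToMeasure_toENNRealVectorMeasure μ).symm ▸ h

/-- A complex measure has an integrable density with respect to a finite measure. -/
theorem exists_eq_withDensityᵥ (f : ComplexMeasure X) :
    ∃ (μ : Measure X) (g : X → ℂ), IsFiniteMeasure μ ∧ Integrable g μ ∧ f = μ.withDensityᵥ g := by
  set a := ComplexMeasure.re f
  set b := ComplexMeasure.im f
  set μ : Measure X := a.totalVariation + b.totalVariation with hμ
  have hfin : IsFiniteMeasure μ := by
    rw [hμ, SignedMeasure.totalVariation, SignedMeasure.totalVariation]; infer_instance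
  obtain ⟨g₁, hg₁, e₁⟩ := SignedMeasure.exists_withDensityᵥ_eq a μ
    (Measure.AbsolutelyContinuous.rfl.add_right _)
  obtain ⟨g₂, hg₂, e₂⟩ := SignedMeasure.exists_withDensityᵥ_eq b μ (by
    rw [hμ, add_comm]; exact Measure.AbsolutelyContinuous.rfl.add_right _)
  have hg : Integrable (fun x => (g₁ x : ℂ) + g₂ x * Complex.I) μ :=
    hg₁.ofReal.add (hg₂.ofReal.mul_const _)
  refine ⟨μ, _, hfin, hg, ?_⟩
  ext s hs
  rw [withDensityᵥ_apply hg hs, integral_add hg₁.ofReal.restrict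
    (hg₂.ofReal.mul_const _).restrict, integral_mul_const, integral_complex_ofReal,
    integral_complex_ofReal,
    ← withDensityᵥ_apply hg₁ hs, ← withDensityᵥ_apply hg₂ hs, ← e₁, ← e₂]
  exact (Complex.re_add_im (f s)).symm

variable {μ : Measure X} {g : X → ℂ}

lemma integrable_mul_of_variation (hg : Integrable g μ) {F : X → ℂ}
    (hF : Integrable F (μ.withDensity fun x => ‖g x‖ₑ)) : Integrable (fun x => F x * g x) μ := by
  have h := (integrable_withDensity_iff_integrable_smul₀ (f := fun x => ‖g x‖₊)
    hg.1.nnnorm.aemeasurable).1 hF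
  -- The phase of `g`, with value 0 where `g` vanishes; it turns `‖g‖ F` into `F g` and is bounded
  -- by 1.
  have hs : AEStronglyMeasurable (fun x => ‖g x‖⁻¹ • g x) μ :=
    (hg.1.norm.aemeasurable.inv.aestronglyMeasurable).smul hg.1
  refine (h.mul_bdd (c := 1) hs (Eventually.of_forall fun x => ?_)).congr
    (Eventually.of_forall fun x => ?_)
  · rw [norm_smul, norm_inv, norm_norm]
    exact inv_mul_le_one
  · rcases eq_or_ne (g x) 0 with h0 | h0
    · simp [h0]
    · have : (‖g x‖ : ℂ) ≠ 0 := by simpa using h0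
      simp only [NNReal.smul_def, coe_nnnorm, Complex.real_smul, Complex.ofReal_inv]
      field_simp

/-- The variation of the measure is `‖g‖ μ`, so the identity spreads from indicators to all
integrable functions: it is additive and closed in $L_1$ of the variation. -/
lemma vectorIntegral_withDensityᵥ (hg : Integrable g μ) {F : X → ℂ}
    (hF : Integrable F (μ.withDensity fun x => ‖g x‖ₑ)) :
    ∫ᵛ x, F x ∂[ContinuousLinearMap.mul ℝ ℂ; μ.withDensityᵥ g] = ∫ x, F x * g x ∂μ := by
  have hv := Measure.variation_withDensityᵥ hg
  have hfin : IsFiniteMeasure (μ.withDensity fun x => ‖g x‖ₑ) := ⟨by simpa using! hg.2⟩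
  have hfin' : IsFiniteMeasure (μ.withDensityᵥ g).variation := by rwa [hv]
  refine Integrable.induction (μ := μ.withDensity fun x => ‖g x‖ₑ)
    (fun F : X → ℂ => ∫ᵛ x, F x ∂[ContinuousLinearMap.mul ℝ ℂ; μ.withDensityᵥ g] =
      ∫ x, F x * g x ∂μ) ?_ ?_ ?_ ?_ hF
  · intro c s hs _
    rw [VectorMeasure.integral_indicator hs]
    have : IsFiniteMeasure ((μ.withDensityᵥ g).restrict s).variation := by
      rw [VectorMeasure.variation_restrict hs]; infer_instance
    rw [VectorMeasure.integral_const, VectorMeasure.restrict_apply _ hs MeasurableSet.univ,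
      univ_inter, withDensityᵥ_apply hg hs]
    have : (fun x => s.indicator (fun _ => c) x * g x) = s.indicator fun x => c * g x := by
      ext x; by_cases hx : x ∈ s <;> simp [hx]
    rw [this, integral_indicator hs, integral_const_mul]
    rfl
  · intro F G _ h1 h2 hF hG
    rw [VectorMeasure.integral_add (by rwa [VectorMeasure.Integrable, hv])
      (by rwa [VectorMeasure.Integrable, hv]), hF, hG,
      ← integral_add (integrable_mul_of_variation hg h1) (integrable_mul_of_variation hg h2)]
    simp only [Pi.add_apply, add_mul]
  · rw [← hv]
    refine isClosed_eq (VectorMeasure.continuous_integral) ?_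
    rw [hv]
    refine continuous_iff_seqContinuous.2 fun F F₀ hF => ?_
    refine tendsto_integral_of_L1 _ (integrable_mul_of_variation hg (L1.integrable_coeFn F₀)).1
      (Eventually.of_forall fun n => integrable_mul_of_variation hg (L1.integrable_coeFn (F n))) ?_
    have h1 := (tendsto_iff_edist_tendsto_0.1 hF)
    refine h1.congr fun n => ?_
    rw [L1.edist_def, lintegral_withDensity_eq_lintegral_mul₀ hg.1.enorm]
    · refine lintegral_congr fun x => ?_
      rw [← sub_mul, enorm_mul, Pi.mul_apply, edist_eq_enorm_sub, mul_comm]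
    · simp only [edist_eq_enorm_sub]
      exact ((Lp.stronglyMeasurable (F n)).sub (Lp.stronglyMeasurable F₀)).enorm.aemeasurable
  · intro F G hFG h1 hF
    rw [← VectorMeasure.integral_congr_ae (hv ▸ hFG), hF]
    refine integral_congr_ae ?_
    have := (ae_withDensity_iff' hg.1.enorm).1 hFG
    filter_upwards [this] with x hx
    rcases eq_or_ne (g x) 0 with h0 | h0
    · simp [h0]
    · exact congrArg (· * g x) (hx (by simpa using h0))

lemma vectorIntegral_withDensityᵥ_of_bounded (hg : Integrable g μ) {F : X → ℂ} {C : ℝ}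
    (hF : Measurable F) (hC : ∀ x, ‖F x‖ ≤ C) :
    ∫ᵛ x, F x ∂[ContinuousLinearMap.mul ℝ ℂ; μ.withDensityᵥ g] = ∫ x, F x * g x ∂μ := by
  have hfin : IsFiniteMeasure (μ.withDensity fun x => ‖g x‖ₑ) := ⟨by simpa using! hg.2⟩
  exact vectorIntegral_withDensityᵥ hg
    (Integrable.of_bound hF.aestronglyMeasurable C (Eventually.of_forall hC))

end ComplexMeasures

/-- Makes the product σ-algebra on pairs of frequencies the Borel one, so that continuous maps of
pairs are measurable. -/
instance instSecondCountableTopologyL2 (T : ℝ) : SecondCountableTopology (L2 T) :=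
  have : Fact ((2 : ℝ≥0∞) ≠ ∞) := ⟨ENNReal.ofNat_ne_top⟩
  inferInstance

/-! ### Gaussian superpositions as analytic functions of the parameter -/

section AnalyticIntegrals

/-- A shortcut: the general search for this instance is slow on path spaces. -/
instance sFinite_of_isFiniteMeasure_C0 {T : ℝ} (m : Measure (C0 T)) [IsFiniteMeasure m] :
    SFinite m :=
  have := IsFiniteMeasure.toSigmaFinite m
  instSFiniteOfSigmaFinite

variable {T : ℝ} {m : Measure (C0 T)} {Ω : Type*} [MeasurableSpace Ω] {μ : Measure Ω}
  {g : Ω → ℂ} {N : Ω → ℝ}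

/-- The superposition, with complex density `g`, of the Gaussian factors `exp(-N/(2z))`. -/
def gaussTransform (μ : Measure Ω) (g : Ω → ℂ) (N : Ω → ℝ) (z : ℂ) : ℂ :=
  ∫ ω, g ω * Complex.exp (-(N ω / 2 : ℝ) * z⁻¹) ∂μ

lemma norm_exp_neg_mul_le_one {a : ℝ} (ha : 0 ≤ a) {w : ℂ} (hw : 0 ≤ w.re) :
    ‖Complex.exp (-(a : ℂ) * w)‖ ≤ 1 := by
  rw [Complex.norm_exp, Real.exp_le_one_iff, neg_mul, Complex.neg_re, Complex.re_ofReal_mul]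
  nlinarith [mul_nonneg ha hw]

lemma isOpen_rightHalf : IsOpen rightHalf := isOpen_lt continuous_const Complex.continuous_re

lemma inv_re_nonneg {z : ℂ} (hz : 0 ≤ z.re) : 0 ≤ z⁻¹.re := by
  rw [Complex.inv_re]; exact div_nonneg hz (Complex.normSq_nonneg z)

lemma aestronglyMeasurable_gauss (hg : Integrable g μ) (hN : Measurable N) (w : ℂ) :
    AEStronglyMeasurable (fun ω => g ω * Complex.exp (-(N ω / 2 : ℝ) * w)) μ := by
  refine hg.1.mul (Measurable.aestronglyMeasurable ?_)
  fun_prop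

lemma integrable_gauss (hg : Integrable g μ) (hN : Measurable N) (hN0 : ∀ ω, 0 ≤ N ω) {z : ℂ}
    (hz : 0 ≤ z.re) : Integrable (fun ω => g ω * Complex.exp (-(N ω / 2 : ℝ) * z⁻¹)) μ := by
  refine hg.mono (aestronglyMeasurable_gauss hg hN _) (Eventually.of_forall fun ω => ?_)
  rw [norm_mul]
  exact mul_le_of_le_one_right (norm_nonneg _)
    (norm_exp_neg_mul_le_one (div_nonneg (hN0 ω) zero_le_two) (inv_re_nonneg hz))

lemma differentiableOn_gaussTransform (hg : Integrable g μ) (hN : Measurable N)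
    (hN0 : ∀ ω, 0 ≤ N ω) : DifferentiableOn ℂ (gaussTransform μ g N) rightHalf := by
  have key : ∀ w : ℂ, 0 < w.re → DifferentiableAt ℂ
      (fun w => ∫ ω, g ω * Complex.exp (-(N ω / 2 : ℝ) * w) ∂μ) w := by
    intro w hw
    have hs : {v : ℂ | w.re / 2 < v.re} ∈ 𝓝 w :=
      (isOpen_lt continuous_const Complex.continuous_re).mem_nhds (by simpa using hw)
    -- With $a=N/2$ and $\operatorname{Re}v>\operatorname{Re}w/2$, the inequality $t\le e^t$ gives
    -- $ae^{-a\operatorname{Re}v}\le2/\operatorname{Re}w$. This bound is free of `N`, so no moments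
    -- of `N` are required.
    refine (hasDerivAt_integral_of_dominated_loc_of_deriv_le
      (F' := fun v ω => g ω * (Complex.exp (-(N ω / 2 : ℝ) * v) * -(N ω / 2 : ℝ)))
      (bound := fun ω => ‖g ω‖ * (2 / w.re)) hs
      (Eventually.of_forall fun v => aestronglyMeasurable_gauss hg hN v) ?_ ?_ ?_ ?_
      ?_).2.differentiableAt
    · have := integrable_gauss hg hN hN0 (z := w⁻¹) (inv_re_nonneg hw.le)
      simpa using this
    · refine hg.1.mul (Measurable.aestronglyMeasurable ?_)
      fun_prop
    · refine Eventually.of_forall fun ω v hv => ?_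
      rw [norm_mul]
      refine mul_le_mul_of_nonneg_left ?_ (norm_nonneg _)
      have hv' : w.re / 2 < v.re := hv
      have hn := div_nonneg (hN0 ω) zero_le_two
      rw [norm_mul, Complex.norm_exp, norm_neg, Complex.norm_real, Real.norm_of_nonneg hn, neg_mul,
        Complex.neg_re, Complex.re_ofReal_mul]
      have h1 : N ω / 2 * (w.re / 2) ≤ Real.exp (N ω / 2 * (w.re / 2)) := by
        linarith [Real.add_one_le_exp (N ω / 2 * (w.re / 2))]
      have h2 : Real.exp (-(N ω / 2 * v.re)) ≤ Real.exp (-(N ω / 2 * (w.re / 2))) :=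
        Real.exp_le_exp.2 (by nlinarith)
      have h3 : Real.exp (-(N ω / 2 * (w.re / 2))) * Real.exp (N ω / 2 * (w.re / 2)) = 1 := by
        rw [← Real.exp_add]; simp
      rw [le_div_iff₀ hw]
      nlinarith [mul_le_mul_of_nonneg_left h1 (Real.exp_pos (-(N ω / 2 * (w.re / 2)))).le,
        mul_le_mul_of_nonneg_right h2 (mul_nonneg hn (half_pos hw).le)]
    · exact hg.norm.mul_const _
    · refine Eventually.of_forall fun ω v _ => ?_
      have h1 : HasDerivAt (fun v : ℂ => -((N ω / 2 : ℝ) : ℂ) * v) (-((N ω / 2 : ℝ) : ℂ)) v := by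
        simpa using (hasDerivAt_id v).const_mul (-((N ω / 2 : ℝ) : ℂ))
      exact (h1.cexp).const_mul _
  intro z hz
  have hz' : 0 < z.re := hz
  have hz0 : z ≠ 0 := fun h => by simp [h] at hz'
  have h1 : 0 < z⁻¹.re := by
    rw [Complex.inv_re]; exact div_pos hz' (Complex.normSq_pos.2 hz0)
  exact ((key _ h1).comp z (differentiableAt_inv hz0)).differentiableWithinAt

instance isCountablyGenerated_toFeynman (q : ℝ) : (toFeynman q).IsCountablyGenerated := by
  unfold toFeynman; infer_instance

instance neBot_toFeynman (q : ℝ) : (toFeynman q).NeBot := by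
  refine mem_closure_iff_nhdsWithin_neBot.1 (mem_closure_of_tendsto
    (f := fun n : ℕ => -Complex.I * (q : ℂ) + (1 / ((n : ℝ) + 1) : ℝ)) (b := atTop) ?_ ?_)
  · have := (Complex.continuous_ofReal.tendsto 0).comp
      (tendsto_one_div_add_atTop_nhds_zero_nat (𝕜 := ℝ))
    simpa using this.const_add (-Complex.I * (q : ℂ))
  · refine Eventually.of_forall fun n => ?_
    have h : (0 : ℝ) < 1 / ((n : ℝ) + 1) := by positivity
    change 0 < (-Complex.I * (q : ℂ) + (1 / ((n : ℝ) + 1) : ℝ)).re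
    rw [Complex.add_re, Complex.ofReal_re]
    simpa using h

/-- The Gaussian factors have modulus at most 1 on the half-plane, and $z^{-1}$ is continuous at
$-iq$ because $q\neq0$. -/
lemma tendsto_gaussTransform (hg : Integrable g μ) (hN : Measurable N) (hN0 : ∀ ω, 0 ≤ N ω)
    {q : ℝ} (hq : q ≠ 0) :
    Tendsto (gaussTransform μ g N) (toFeynman q) (𝓝 (gaussTransform μ g N (-Complex.I * q))) := by
  refine tendsto_integral_filter_of_dominated_convergence (fun ω => ‖g ω‖)
    (Eventually.of_forall fun z => aestronglyMeasurable_gauss hg hN _) ?_ hg.norm ?_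
  · filter_upwards [self_mem_nhdsWithin] with z hz
    refine Eventually.of_forall fun ω => ?_
    rw [norm_mul]
    exact mul_le_of_le_one_right (norm_nonneg _)
      (norm_exp_neg_mul_le_one (div_nonneg (hN0 ω) zero_le_two) (inv_re_nonneg (le_of_lt hz)))
  · refine Eventually.of_forall fun ω => ?_
    have h0 : -Complex.I * (q : ℂ) ≠ 0 := by simp [hq]
    have : ContinuousAt (fun z : ℂ => g ω * Complex.exp (-(N ω / 2 : ℝ) * z⁻¹))
        (-Complex.I * q) := by
      have := continuousAt_inv₀ h0
      fun_prop
    exact this.tendsto.mono_left nhdsWithin_le_nhds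

lemma norm_gaussTransform_le (hg : Integrable g μ) (hN0 : ∀ ω, 0 ≤ N ω) {z : ℂ}
    (hz : 0 ≤ z.re) : ‖gaussTransform μ g N z‖ ≤ ∫ ω, ‖g ω‖ ∂μ := by
  refine norm_integral_le_of_norm_le hg.norm (Eventually.of_forall fun ω => ?_)
  rw [norm_mul]
  exact mul_le_of_le_one_right (norm_nonneg _)
    (norm_exp_neg_mul_le_one (div_nonneg (hN0 ω) zero_le_two) (inv_re_nonneg hz))

lemma integrable_prod_exp [SFinite μ] [IsFiniteMeasure m] (hg : Integrable g μ)
    {θ : Ω × C0 T → ℝ} (hθ : AEMeasurable θ (μ.prod m)) (s : ℝ) :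
    Integrable (fun p : Ω × C0 T => g p.1 * Complex.exp (Complex.I * (s * θ p : ℝ)))
      (μ.prod m) := by
  refine (hg.comp_fst m).mul_bdd (c := 1) ?_ (Eventually.of_forall fun p => ?_)
  · exact (((Complex.measurable_ofReal.comp_aemeasurable (hθ.const_mul s)).const_mul
      _).cexp).aestronglyMeasurable
  · rw [mul_comm, Complex.norm_exp_ofReal_mul_I]

/-- The analytic Wiener integral of a superposition of exponentials of Gaussian variables. -/
theorem isAnalyticWienerIntegral_gaussTransform [IsFiniteMeasure μ] [IsProbabilityMeasure m]
    (hg : Integrable g μ) (hN : Measurable N) (hN0 : ∀ ω, 0 ≤ N ω) {θ : Ω → C0 T → ℝ}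
    (hθ : AEMeasurable (fun p : Ω × C0 T => θ p.1 p.2) (μ.prod m))
    (hG : ∀ ω, IsCG m (θ ω) (N ω)) {Ψ : ℝ → C0 T → ℂ}
    (hΨ : ∀ l, 0 < l → ∀ᵐ x ∂m,
      Ψ l x = ∫ ω, g ω * Complex.exp (Complex.I * ((√l)⁻¹ * θ ω x : ℝ)) ∂μ) :
    IsAnalyticWienerIntegral m Ψ (gaussTransform μ g N) := by
  refine ⟨fun l hl => ?_, differentiableOn_gaussTransform hg hN hN0⟩
  have hint := integrable_prod_exp hg hθ (√l)⁻¹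
  refine ⟨(hint.integral_prod_right).congr ((hΨ l hl).mono fun x hx => hx.symm), ?_⟩
  rw [integral_congr_ae (hΨ l hl), ← integral_integral_swap hint]
  refine integral_congr_ae (Eventually.of_forall fun ω => ?_)
  dsimp only
  rw [integral_const_mul, (hG ω).integral_exp]
  congr 2
  rw [inv_pow, Real.sq_sqrt hl.le]
  push_cast
  ring

end AnalyticIntegrals

/-! ### Transforms of functionals represented on a linear set of good paths -/

section Transform

variable {T : ℝ} {m : Measure (C0 T)} {φ : ℕ → ℝ → ℝ}

/-- A linear set of paths that contains almost all paths of the Wiener process and of all the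
processes `𝒵_h`. -/
structure IsGoodSet (m : Measure (C0 T)) (φ : ℕ → ℝ → ℝ) (D : Set (C0 T)) : Prop where
  comb : ∀ x ∈ D, ∀ y ∈ D, ∀ a b : ℝ, a • x + b • y ∈ D
  ae_mem : ∀ᵐ x ∂m, x ∈ D
  ae_proc_mem : ∀ h, MemLp h ∞ (leb T) → ∀ᵐ x ∂m, proc m φ h x ∈ D

lemma IsGoodSet.smul_mem {D : Set (C0 T)} (hD : IsGoodSet m φ D) {x : C0 T} (hx : x ∈ D) (a : ℝ) :
    a • x ∈ D := by
  simpa using hD.comb x hx x hx a 0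

lemma IsGoodSet.add_smul_mem {D : Set (C0 T)} (hD : IsGoodSet m φ D) {x y : C0 T} (hx : x ∈ D)
    (hy : y ∈ D) (b : ℝ) : x + b • y ∈ D := by
  simpa using hD.comb x hx y hy 1 b

lemma IsGoodSet.sae {D : Set (C0 T)} (hD : IsGoodSet m φ D) : SAE m fun y => y ∈ D :=
  fun ρ _ => hD.ae_mem.mono fun _ hx => hD.smul_mem hx ρ

lemma IsGoodSet.inter {D E : Set (C0 T)} (hD : IsGoodSet m φ D) (hE : IsGoodSet m φ E) :
    IsGoodSet m φ (D ∩ E) where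
  comb x hx y hy a b := ⟨hD.comb x hx.1 y hy.1 a b, hE.comb x hx.2 y hy.2 a b⟩
  ae_mem := hD.ae_mem.and hE.ae_mem
  ae_proc_mem h hh := (hD.ae_proc_mem h hh).and (hE.ae_proc_mem h hh)

lemma SAE.mono {P Q : C0 T → Prop} (hP : SAE m P) (h : ∀ y, P y → Q y) : SAE m Q :=
  fun ρ hρ => (hP ρ hρ).mono fun _ hx => h _ hx

lemma SAE.and {P Q : C0 T → Prop} (hP : SAE m P) (hQ : SAE m Q) : SAE m fun y => P y ∧ Q y :=
  fun ρ hρ => (hP ρ hρ).and (hQ ρ hρ)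

/-- The paths against which almost every `u` has a Paley–Wiener–Zygmund integral. -/
def goodPaths (φ : ℕ → ℝ → ℝ) (μ : Measure (L2 T)) : Set (C0 T) :=
  {y | ∀ᵐ u : L2 T ∂μ, PWZExists φ (u : ℝ → ℝ) y}

lemma isGoodSet_goodPaths (hT : 0 < T) (hm : IsWienerMeasure m) (hφ : IsBVBasis T φ)
    (μ : Measure (L2 T)) [SFinite μ] : IsGoodSet m φ (goodPaths φ μ) where
  comb x hx y hy a b := by
    change ∀ᵐ u : L2 T ∂μ, PWZExists φ (u : ℝ → ℝ) (a • x + b • y)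
    filter_upwards [hx, hy] with u h1 h2 using (h1.path hT hφ h2 a b).1
  ae_mem := by
    have := hm.prob
    exact ae_ae_pwzExists (U := fun u : L2 T => u) (A := fun x => x) hφ measurable_id
      (fun j => (measurable_rsIntegral hT (hφ.bv j)).aemeasurable)
      fun u => ae_pwzExists hT hm hφ (Lp.memLp u)
  ae_proc_mem h hh := by
    have := hm.prob
    exact ae_ae_pwzExists (U := fun u : L2 T => u) hφ measurable_id
      (aemeasurable_rsIntegral_proc hT hm hφ hh)
      fun u => ae_pwzExists_proc hT hm hφ hh (Lp.memLp u)

variable {Ω : Type*} [MeasurableSpace Ω] {μ : Measure Ω} {g : Ω → ℂ} {U : Ω → L2 T}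
  {D : Set (C0 T)} {H : C0 T → ℂ}

/-- On the good set `D`, the functional `H` is the superposition, with density `g` with respect to
`μ`, of the exponentials `exp(i⟨U ω, ·⟩)`. -/
structure IsRepr (m : Measure (C0 T)) (φ : ℕ → ℝ → ℝ) (μ : Measure Ω) (g : Ω → ℂ) (U : Ω → L2 T)
    (D : Set (C0 T)) (H : C0 T → ℂ) : Prop where
  good : IsGoodSet m φ D
  integrable : Integrable g μ
  measurable : Measurable U
  exists_pwz : ∀ y ∈ D, ∀ᵐ ω ∂μ, PWZExists φ (U ω) y
  eq : ∀ y ∈ D, H y = ∫ ω, g ω * Complex.exp (Complex.I * (pwz φ (U ω) y : ℝ)) ∂μ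

lemma measurable_pwz_left (hφ : IsBVBasis T φ) (hU : Measurable U) (y : C0 T) :
    Measurable fun ω => pwz φ (U ω) y :=
  (StronglyMeasurable.limUnder (l := atTop) fun _ => (Finset.measurable_sum _ fun j _ =>
    ((measurable_coeff hφ j).comp hU).mul_const (rsIntegral (φ j) y)).stronglyMeasurable).measurable

lemma norm_exp_I_mul (a : ℝ) : ‖Complex.exp (Complex.I * (a : ℂ))‖ = 1 := by
  rw [mul_comm, Complex.norm_exp_ofReal_mul_I]

lemma integrable_mul_exp_pwz (hφ : IsBVBasis T φ) (hU : Measurable U) (hg : Integrable g μ)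
    (y : C0 T) : Integrable (fun ω => g ω * Complex.exp (Complex.I * (pwz φ (U ω) y : ℝ))) μ := by
  refine hg.mul_bdd (c := 1) ?_ (Eventually.of_forall fun ω => (norm_exp_I_mul _).le)
  have := measurable_pwz_left hφ hU y
  exact Measurable.aestronglyMeasurable (by fun_prop)

lemma aemeasurable_integral_exp_pwz [IsFiniteMeasure μ] [IsProbabilityMeasure m]
    (hφ : IsBVBasis T φ) (hU : Measurable U) (hg : Integrable g μ) {A : C0 T → C0 T}
    (hA : ∀ j, AEMeasurable (fun x => rsIntegral (φ j) (A x)) m) :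
    AEMeasurable (fun x => ∫ ω, g ω * Complex.exp (Complex.I * (pwz φ (U ω) (A x) : ℝ)) ∂μ) m := by
  have h := integrable_prod_exp hg (aemeasurable_pwz_prod (μ := μ) hφ hU hA) 1
  simp only [one_mul] at h
  have h2 := h.integral_prod_right
  exact h2.1.aemeasurable

lemma aemeasurable_rsIntegral_smul (hT : 0 < T) (hφ : IsBVBasis T φ) (ρ : ℝ) (j : ℕ) :
    AEMeasurable (fun x : C0 T => rsIntegral (φ j) (ρ • x)) m := by
  simp only [rsIntegral_smul_path hT (hφ.bv j)]
  exact ((measurable_rsIntegral hT (hφ.bv j)).const_mul ρ).aemeasurable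

lemma IsRepr.scaleInvMeasurable [IsFiniteMeasure μ] [IsProbabilityMeasure m] (hT : 0 < T)
    (hφ : IsBVBasis T φ) (hH : IsRepr m φ μ g U D H) : ScaleInvMeasurable m H := by
  intro ρ hρ
  refine (aemeasurable_integral_exp_pwz hφ hH.measurable hH.integrable
    (aemeasurable_rsIntegral_smul hT hφ ρ)).congr ?_
  filter_upwards [hH.good.sae ρ hρ] with x hx using (hH.eq _ hx).symm

/-- The transform `T_{z,h}` of the functional represented by `(μ, g, U)`. -/
def reprTransform (φ : ℕ → ℝ → ℝ) (μ : Measure Ω) (g : Ω → ℂ) (U : Ω → L2 T) (h : ℝ → ℝ) (z : ℂ)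
    (y : C0 T) : ℂ :=
  gaussTransform μ (fun ω => g ω * Complex.exp (Complex.I * (pwz φ (U ω) y : ℝ)))
    (fun ω => ∫ t, (h t * U ω t) ^ 2 ∂(leb T)) z

/-- Moving the Gaussian factor into the density shows the transform to be a superposition of the
same exponentials. -/
lemma reprTransform_eq (h : ℝ → ℝ) (z : ℂ) (y : C0 T) :
    reprTransform φ μ g U h z y = ∫ ω, (g ω * Complex.exp
      (-((∫ t, (h t * U ω t) ^ 2 ∂(leb T)) / 2 : ℝ) * z⁻¹)) *
        Complex.exp (Complex.I * (pwz φ (U ω) y : ℝ)) ∂μ :=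
  integral_congr_ae (Eventually.of_forall fun ω => by dsimp only; ring)

lemma energy_nonneg (h u : ℝ → ℝ) : 0 ≤ ∫ t, (h t * u t) ^ 2 ∂(leb T) :=
  integral_nonneg fun _ => sq_nonneg _

lemma reprTransform_scaleInvMeasurable [IsFiniteMeasure μ] [IsProbabilityMeasure m] (hT : 0 < T)
    (hφ : IsBVBasis T φ) (hU : Measurable U) (hg : Integrable g μ) {h : ℝ → ℝ}
    (hh : MemLp h ∞ (leb T)) {z : ℂ} (hz : 0 ≤ z.re) :
    ScaleInvMeasurable m (reprTransform φ μ g U h z) := by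
  intro ρ _
  simp only [reprTransform_eq]
  exact aemeasurable_integral_exp_pwz hφ hU (integrable_gauss hg
    ((measurable_integral_sq_mul hφ hh).comp hU) (fun ω => energy_nonneg _ _) hz)
    (aemeasurable_rsIntegral_smul hT hφ ρ)

lemma neg_I_mul_re (q : ℝ) : (-Complex.I * (q : ℂ)).re = 0 := by simp

/-- For good `y` almost every shifted path is good by linearity, so the representation applies to
it. Each exponential splits, and the factor containing the process is that of a Gaussian with
variance $\|hU\|^2$. -/
lemma IsRepr.isAnalyticWienerIntegral [IsFiniteMeasure μ] (hT : 0 < T) (hm : IsWienerMeasure m)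
    (hφ : IsBVBasis T φ) (hH : IsRepr m φ μ g U D H) {h : ℝ → ℝ} (hh : MemLp h ∞ (leb T))
    {y : C0 T} (hy : y ∈ D) :
    IsAnalyticWienerIntegral m (fun l x => H (y + (Real.sqrt l)⁻¹ • proc m φ h x))
      (fun z => reprTransform φ μ g U h z y) := by
  have := hm.prob
  refine isAnalyticWienerIntegral_gaussTransform (θ := fun ω x => pwz φ (U ω) (proc m φ h x))
    (integrable_mul_exp_pwz hφ hH.measurable hH.integrable y)
    ((measurable_integral_sq_mul hφ hh).comp hH.measurable) (fun ω => energy_nonneg _ _)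
    (aemeasurable_pwz_prod hφ hH.measurable (aemeasurable_rsIntegral_proc hT hm hφ hh))
    (fun ω => ?_) fun l hl => ?_
  · exact (isCG_pwz hT hm hφ (memLp_mul_of_memLp_top hh (Lp.memLp (U ω)))).congr
      ((ae_pwz_proc hT hm hφ hh (Lp.memLp (U ω))).mono fun x hx => hx.symm)
  · filter_upwards [hH.good.ae_proc_mem h hh] with x hx
    rw [hH.eq _ (hH.good.add_smul_mem hy hx _)]
    refine integral_congr_ae ?_
    filter_upwards [hH.exists_pwz _ hy, hH.exists_pwz _ hx] with ω h1 h2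
    have h3 := (h1.path hT hφ h2 1 (√l)⁻¹).2
    rw [one_smul, one_mul] at h3
    rw [h3, mul_assoc, ← Complex.exp_add]
    congr 2; push_cast; ring

/-- The generalized Fourier–Feynman transform of a represented functional. -/
theorem IsRepr.isGFFT [IsFiniteMeasure μ] (hT : 0 < T) (hm : IsWienerMeasure m)
    (hφ : IsBVBasis T φ) (hH : IsRepr m φ μ g U D H) {h : ℝ → ℝ} (hh : MemLp h ∞ (leb T))
    {q : ℝ} (hq : q ≠ 0) (p : ℝ) {H₁ : C0 T → ℂ}
    (hH₁ : ∀ y ∈ D, H₁ y = reprTransform φ μ g U h (-Complex.I * q) y) :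
    IsGFFT m φ p q h H H₁ := by
  have := hm.prob
  have hN := (measurable_integral_sq_mul hφ hh).comp hH.measurable
  have hN0 : ∀ ω, 0 ≤ ∫ t, (h t * U ω t) ^ 2 ∂(leb T) := fun ω => energy_nonneg _ _
  have hlim : ∀ y ∈ D, Tendsto (fun z => reprTransform φ μ g U h z y) (toFeynman q)
      (𝓝 (H₁ y)) := fun y hy => by
    rw [hH₁ y hy]
    exact tendsto_gaussTransform (integrable_mul_exp_pwz hφ hH.measurable hH.integrable y) hN hN0 hq
  have hmeas₁ : ScaleInvMeasurable m H₁ := fun ρ hρ =>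
    (reprTransform_scaleInvMeasurable hT hφ hH.measurable hH.integrable hh
      (neg_I_mul_re q).ge ρ hρ).congr
      ((hH.good.sae ρ hρ).mono fun x hx => (hH₁ _ hx).symm)
  refine ⟨hH.scaleInvMeasurable hT hφ, hmeas₁, reprTransform φ μ g U h, fun z hz =>
    reprTransform_scaleInvMeasurable hT hφ hH.measurable hH.integrable hh (le_of_lt hz),
    hH.good.sae.mono fun y hy => hH.isAnalyticWienerIntegral hT hm hφ hh hy,
    fun _ => hH.good.sae.mono fun y hy => hlim y hy, fun hp ρ hρ => ?_⟩
  have hp' : 0 < p / (p - 1) := div_pos (by linarith) (by linarith)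
  -- A bound uniform in the parameter and the path upgrades pointwise convergence to convergence in
  -- the mean.
  have hb : ∀ z : ℂ, 0 ≤ z.re → ∀ y, ‖reprTransform φ μ g U h z y‖ ≤ ∫ ω, ‖g ω‖ ∂μ :=
    fun z hz y => by
      refine (norm_gaussTransform_le (integrable_mul_exp_pwz hφ hH.measurable hH.integrable y)
        hN0 hz).trans_eq ?_
      simp only [norm_mul, norm_exp_I_mul, mul_one]
  set K := ∫ ω, ‖g ω‖ ∂μ
  have h0 : ∫⁻ _y : C0 T, (0 : ℝ≥0∞) ∂m = 0 := lintegral_zero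
  rw [← h0]
  refine tendsto_lintegral_filter_of_dominated_convergence'
    (fun _ => ENNReal.ofReal (K + K) ^ (p / (p - 1))) ?_ ?_ ?_ ?_
  · filter_upwards [self_mem_nhdsWithin] with z hz
    exact ((reprTransform_scaleInvMeasurable hT hφ hH.measurable hH.integrable hh (le_of_lt hz) ρ
      hρ).sub (hmeas₁ ρ hρ)).enorm.pow_const _
  · filter_upwards [self_mem_nhdsWithin] with z hz
    filter_upwards [hH.good.sae ρ hρ] with y hy
    refine ENNReal.rpow_le_rpow ?_ hp'.le
    rw [← ofReal_norm]
    refine ENNReal.ofReal_le_ofReal ((norm_sub_le _ _).trans (add_le_add (hb z (le_of_lt hz) _) ?_))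
    rw [hH₁ _ hy]
    exact hb _ (neg_I_mul_re q).ge _
  · rw [lintegral_const]
    exact ENNReal.mul_ne_top (ENNReal.rpow_ne_top_of_nonneg hp'.le ENNReal.ofReal_ne_top)
      (measure_ne_top _ _)
  · filter_upwards [hH.good.sae ρ hρ] with y hy
    have h1 := ((hlim _ hy).sub_const (H₁ (ρ • y))).enorm
    rw [sub_self, enorm_zero] at h1
    have h2 := (ENNReal.continuous_rpow_const (y := p / (p - 1))).tendsto 0 |>.comp h1
    rwa [ENNReal.zero_rpow_of_pos hp'] at h2

/-- Two analytic Wiener integrals of the same integrand agree on the right half-plane. -/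
lemma IsAnalyticWienerIntegral.eqOn {Ψ : ℝ → C0 T → ℂ} {J K : ℂ → ℂ}
    (hJ : IsAnalyticWienerIntegral m Ψ J) (hK : IsAnalyticWienerIntegral m Ψ K) :
    EqOn J K rightHalf := by
  refine AnalyticOnNhd.eqOn_of_preconnected_of_frequently_eq
    (hJ.2.analyticOnNhd isOpen_rightHalf) (hK.2.analyticOnNhd isOpen_rightHalf)
    (convex_halfSpace_re_gt 0).isPreconnected (z₀ := 1) (by simp [rightHalf]) ?_
  -- The two functions agree on the positive reals; a sequence accumulating at 1 is enough for the
  -- identity theorem.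
  have h1 : Tendsto (fun n : ℕ => (((1 : ℝ) + 1 / ((n : ℝ) + 1) : ℝ) : ℂ)) atTop (𝓝[≠] 1) := by
    refine tendsto_nhdsWithin_iff.2 ⟨?_, Eventually.of_forall fun n => ?_⟩
    · have := (Complex.continuous_ofReal.tendsto _).comp
        ((tendsto_one_div_add_atTop_nhds_zero_nat (𝕜 := ℝ)).const_add 1)
      simpa [Function.comp_def] using this
    · have : (1 : ℝ) / ((n : ℝ) + 1) ≠ 0 := by positivity
      intro h
      have h' : (((1 : ℝ) + 1 / ((n : ℝ) + 1) : ℝ) : ℂ) = ((1 : ℝ) : ℂ) := by simpa using h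
      have := Complex.ofReal_injective h'
      simp_all
  refine h1.frequently (Eventually.frequently (Eventually.of_forall fun n => ?_))
  have h2 : (0 : ℝ) < 1 + 1 / ((n : ℝ) + 1) := by positivity
  rw [(hJ.1 _ h2).2, (hK.1 _ h2).2]

/-- The generalized Fourier–Feynman transform is unique up to scale-invariant null sets. -/
theorem IsGFFT.sae_eq {p q : ℝ} {h : ℝ → ℝ} {F A B : C0 T → ℂ} (hp : 1 ≤ p)
    (hA : IsGFFT m φ p q h F A) (hB : IsGFFT m φ p q h F B) : SAE m fun y => A y = B y := by
  obtain ⟨_, hAm, J, hJm, hJ, hJ1, hJp⟩ := hA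
  obtain ⟨_, hBm, K, hKm, hK, hK1, hKp⟩ := hB
  have hJK : SAE m fun y => EqOn (fun z => J z y) (fun z => K z y) rightHalf :=
    (hJ.and hK).mono fun y hy => hy.1.eqOn hy.2
  rcases hp.eq_or_lt with rfl | hp
  · refine ((hJK.and (hJ1 rfl)).and (hK1 rfl)).mono fun y hy => ?_
    refine tendsto_nhds_unique (hy.1.2.congr' ?_) hy.2
    filter_upwards [self_mem_nhdsWithin] with z hz using hy.1.1 hz
  · intro ρ hρ
    set r := p / (p - 1) with hr
    have hr1 : 1 ≤ r := by rw [hr, le_div_iff₀ (by linarith)]; linarith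
    have h1 := ENNReal.Tendsto.const_mul (a := (2 : ℝ≥0∞) ^ (r - 1))
      ((hJp hp ρ hρ).add (hKp hp ρ hρ))
      (Or.inr (ENNReal.rpow_ne_top_of_nonneg (by linarith) ENNReal.ofNat_ne_top))
    simp only [add_zero, mul_zero] at h1
    -- Convexity of $t^r$ gives $|A-B|^r\le2^{r-1}(|J_z-A|^r+|K_z-B|^r)$, since $J_z=K_z$ almost
    -- everywhere at this scale. The left side does not depend on `z`.
    have h2 : ∀ᶠ z in toFeynman q, ∫⁻ y, ‖A (ρ • y) - B (ρ • y)‖ₑ ^ r ∂m ≤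
        (2 : ℝ≥0∞) ^ (r - 1) * (∫⁻ y, ‖J z (ρ • y) - A (ρ • y)‖ₑ ^ r ∂m +
          ∫⁻ y, ‖K z (ρ • y) - B (ρ • y)‖ₑ ^ r ∂m) := by
      filter_upwards [self_mem_nhdsWithin] with z hz
      have hmeas : AEMeasurable (fun y => ‖J z (ρ • y) - A (ρ • y)‖ₑ ^ r) m :=
        ((hJm z hz ρ hρ).sub (hAm ρ hρ)).enorm.pow_const r
      rw [← lintegral_add_left' hmeas, ← lintegral_const_mul']
      · refine lintegral_mono_ae ?_
        filter_upwards [hJK ρ hρ] with y hy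
        refine le_trans ?_ (ENNReal.rpow_add_le_mul_rpow_add_rpow _ _ hr1)
        refine ENNReal.rpow_le_rpow ?_ (by linarith)
        have e : A (ρ • y) - B (ρ • y) =
            -(J z (ρ • y) - A (ρ • y)) + (K z (ρ • y) - B (ρ • y)) := by
          have := hy hz
          dsimp only at this
          rw [this]; ring
        rw [e]
        exact (enorm_add_le _ _).trans_eq (by rw [enorm_neg])
      · exact ENNReal.rpow_ne_top_of_nonneg (by linarith) (by simp)
    have h3 : ∫⁻ y, ‖A (ρ • y) - B (ρ • y)‖ₑ ^ r ∂m = 0 :=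
      le_antisymm (ge_of_tendsto h1 h2) zero_le
    have hmeas : AEMeasurable (fun y => ‖A (ρ • y) - B (ρ • y)‖ₑ ^ r) m :=
      ((hAm ρ hρ).sub (hBm ρ hρ)).enorm.pow_const r
    rw [lintegral_eq_zero_iff' hmeas] at h3
    filter_upwards [h3] with y hy
    have := (ENNReal.rpow_eq_zero_iff_of_pos (by linarith)).1 hy
    exact sub_eq_zero.1 (enorm_eq_zero.1 this)

end Transform

/-! ### Uniqueness of the representing measure -/

section Uniqueness

/-- The positive and negative parts of `r` define finite measures with equal, everywhere finite
moment generating functions in each direction. Analytic continuation makes their characteristic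
functions equal. -/
lemma ae_eq_zero_of_integral_mul_exp_inner_real {E : Type*} [NormedAddCommGroup E]
    [InnerProductSpace ℝ E] [CompleteSpace E] [SecondCountableTopology E] [MeasurableSpace E]
    [BorelSpace E] {κ : Measure E} [IsFiniteMeasure κ] {r : E → ℝ}
    (hr : ∀ v : E, Integrable (fun u => r u * Real.exp (inner ℝ u v)) κ)
    (h : ∀ v : E, ∫ u, r u * Real.exp (inner ℝ u v) ∂κ = 0) : r =ᵐ[κ] 0 := by
  have hr0 : Integrable r κ := by simpa using hr 0
  have hfin : ∀ {s : E → ℝ}, Integrable s κ →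
      IsFiniteMeasure (κ.withDensity fun u => ENNReal.ofReal (s u)) :=
    fun hs => isFiniteMeasure_withDensity_ofReal hs.2
  have hmeas : ∀ {s : E → ℝ}, Integrable s κ → AEMeasurable (fun u => ENNReal.ofReal (s u)) κ :=
    fun hs => hs.1.aemeasurable.ennreal_ofReal
  have hlt : ∀ s : E → ℝ, ∀ᵐ u ∂κ, ENNReal.ofReal (s u) < ∞ :=
    fun s => Eventually.of_forall fun u => ENNReal.ofReal_lt_top
  have hpart : ∀ {s : E → ℝ}, (∀ v, Integrable (fun u => s u * Real.exp (inner ℝ u v)) κ) →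
      ∀ v, Integrable (fun u => max (s u) 0 * Real.exp (inner ℝ u v)) κ := fun {s} hs v => by
    refine (hs v).pos_part.congr (Eventually.of_forall fun u => ?_)
    dsimp only
    rw [max_mul_of_nonneg _ _ (Real.exp_pos _).le, zero_mul]
  have hint : ∀ {s : E → ℝ}, (∀ v, Integrable (fun u => s u * Real.exp (inner ℝ u v)) κ) →
      ∀ v, Integrable (fun u => Real.exp (inner ℝ u v))
        (κ.withDensity fun u => ENNReal.ofReal (s u)) := fun {s} hs v => by
    have hs0 : Integrable s κ := by simpa using hs 0
    rw [integrable_withDensity_iff_integrable_smul₀' (hmeas hs0) (hlt s)]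
    simpa only [smul_eq_mul, ENNReal.toReal_ofReal'] using hpart hs v
  have hval : ∀ {s : E → ℝ}, (∀ v, Integrable (fun u => s u * Real.exp (inner ℝ u v)) κ) →
      ∀ v, ∫ u, Real.exp (inner ℝ u v) ∂(κ.withDensity fun u => ENNReal.ofReal (s u)) =
        ∫ u, max (s u) 0 * Real.exp (inner ℝ u v) ∂κ := fun {s} hs v => by
    have hs0 : Integrable s κ := by simpa using hs 0
    rw [integral_withDensity_eq_integral_toReal_smul₀ (hmeas hs0) (hlt s)]
    simp only [smul_eq_mul, ENNReal.toReal_ofReal']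
  have hr' : ∀ v : E, Integrable (fun u => -r u * Real.exp (inner ℝ u v)) κ := fun v => by
    simpa only [neg_mul] using (hr v).fun_neg
  have hr0' : Integrable (fun u => -r u) κ := hr0.neg
  have heq : ∀ v, ∫ u, Real.exp (inner ℝ u v) ∂(κ.withDensity fun u => ENNReal.ofReal (r u)) =
      ∫ u, Real.exp (inner ℝ u v) ∂(κ.withDensity fun u => ENNReal.ofReal (-r u)) := fun v => by
    rw [hval hr, hval hr', ← sub_eq_zero, ← integral_sub (hpart hr v) (hpart hr' v)]
    refine (integral_congr_ae ?_).trans (h v)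
    refine Eventually.of_forall fun u => ?_
    dsimp only
    rw [← sub_mul]
    congr 1
    rcases le_total 0 (r u) with h0 | h0
    · rw [max_eq_left h0, max_eq_right (by linarith), sub_zero]
    · rw [max_eq_right h0, max_eq_left (by linarith)]; ring
  have := hfin hr0
  have := hfin hr0'
  have hν : (κ.withDensity fun u => ENNReal.ofReal (r u)) =
      κ.withDensity fun u => ENNReal.ofReal (-r u) := by
    refine Measure.ext_of_charFun (funext fun v => ?_)
    have hm : mgf (fun u : E => inner ℝ u v) (κ.withDensity fun u => ENNReal.ofReal (r u)) =
        mgf (fun u : E => inner ℝ u v) (κ.withDensity fun u => ENNReal.ofReal (-r u)) := by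
      ext t
      simpa only [mgf, inner_smul_right] using heq (t • v)
    have huniv : integrableExpSet (fun u : E => inner ℝ u v)
        (κ.withDensity fun u => ENNReal.ofReal (r u)) = univ := by
      refine eq_univ_of_forall fun t => ?_
      simpa only [integrableExpSet, mem_ofPred_eq, inner_smul_right] using hint hr (t • v)
    have h0 := heq 0
    simp only [inner_zero_right, Real.exp_zero, integral_const, smul_eq_mul, mul_one] at h0
    -- The continuation argument needs both measures to vanish or neither; the case `v = 0` shows
    -- that the total masses agree.
    have hz : (κ.withDensity fun u => ENNReal.ofReal (r u)) = 0 ↔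
        (κ.withDensity fun u => ENNReal.ofReal (-r u)) = 0 := by
      rw [← Measure.measure_univ_eq_zero, ← Measure.measure_univ_eq_zero,
        ← measureReal_eq_zero_iff, ← measureReal_eq_zero_iff, h0]
    have h1 := eqOn_complexMGF_of_mgf' hm hz (x := Complex.I) (by rw [huniv]; simp)
    simpa only [complexMGF, charFun_apply, mul_comm Complex.I] using h1
  have h2 := (withDensity_eq_iff (hmeas hr0) (hmeas hr0') hr0.lintegral_lt_top.ne).1 hν
  filter_upwards [h2] with u hu
  have h3 := congrArg ENNReal.toReal hu
  simp only [ENNReal.toReal_ofReal'] at h3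
  rcases le_total 0 (r u) with h0 | h0
  · rw [max_eq_left h0, max_eq_right (by linarith)] at h3; exact h3
  · rw [max_eq_right h0, max_eq_left (by linarith)] at h3
    simpa using h3.symm

lemma ae_eq_zero_of_integral_mul_exp_inner {E : Type*} [NormedAddCommGroup E]
    [InnerProductSpace ℝ E] [CompleteSpace E] [SecondCountableTopology E] [MeasurableSpace E]
    [BorelSpace E] {κ : Measure E} [IsFiniteMeasure κ] {r : E → ℂ}
    (hr : ∀ v : E, Integrable (fun u => r u * (Real.exp (inner ℝ u v) : ℂ)) κ)
    (h : ∀ v : E, ∫ u, r u * (Real.exp (inner ℝ u v) : ℂ) ∂κ = 0) : r =ᵐ[κ] 0 := by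
  have h1 : (fun u => (r u).re) =ᵐ[κ] 0 := by
    refine ae_eq_zero_of_integral_mul_exp_inner_real (fun v => ?_) fun v => ?_
    · simpa only [RCLike.re_eq_complex_re, Complex.re_mul_ofReal] using (hr v).re
    · have := integral_re (hr v)
      rw [h v] at this
      simpa only [RCLike.re_eq_complex_re, Complex.re_mul_ofReal, Complex.zero_re] using this
  have h2 : (fun u => (r u).im) =ᵐ[κ] 0 := by
    refine ae_eq_zero_of_integral_mul_exp_inner_real (fun v => ?_) fun v => ?_
    · simpa only [RCLike.im_eq_complex_im, Complex.im_mul_ofReal] using (hr v).im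
    · have := integral_im (hr v)
      rw [h v] at this
      simpa only [RCLike.im_eq_complex_im, Complex.im_mul_ofReal, Complex.zero_im] using this
  filter_upwards [h1, h2] with u h1 h2 using Complex.ext h1 h2

variable {T : ℝ} {m : Measure (C0 T)} {φ : ℕ → ℝ → ℝ}

lemma integral_exp_pwz_sub (hT : 0 < T) (hm : IsWienerMeasure m) (hφ : IsBVBasis T φ)
    (u v : L2 T) : ∫ x, Complex.exp (Complex.I * ((pwz φ u x - pwz φ v x : ℝ) : ℂ)) ∂m =
      Complex.exp (-(‖u - v‖ ^ 2 / 2 : ℝ)) := by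
  have h1 : IsCG m (fun x => pwz φ u x - pwz φ v x) (‖u - v‖ ^ 2) := by
    refine ((isCG_pwz hT hm hφ (Lp.memLp (u - v))).congr ?_).congr_var ?_
    · filter_upwards [ae_pwz_linear hT hm hφ (Lp.memLp u) (Lp.memLp v) 1 (-1)] with x hx
      have e : (u - v : L2 T) =ᵐ[leb T] fun t => 1 * u t + -1 * v t := by
        filter_upwards [Lp.coeFn_sub u v] with t ht
        rw [ht, Pi.sub_apply]; ring
      rw [pwz_congr e, hx]; ring
    · rw [← real_inner_self_eq_norm_sq, L2.inner_def]
      exact integral_congr_ae (Eventually.of_forall fun t => by simp [sq])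
  simpa using h1.integral_exp 1

/-- A complex measure on `L₂[0,T]` whose Fourier transform along the Wiener process vanishes is
zero. -/
theorem ae_eq_zero_of_integral_exp_pwz (hT : 0 < T) (hm : IsWienerMeasure m)
    (hφ : IsBVBasis T φ) {κ : Measure (L2 T)} [IsFiniteMeasure κ] {d : L2 T → ℂ}
    (hd : Integrable d κ)
    (h : ∀ᵐ x ∂m, ∫ u : L2 T, d u * Complex.exp (Complex.I * (pwz φ u x : ℝ)) ∂κ = 0) :
    d =ᵐ[κ] 0 := by
  have := hm.prob
  -- Multiplying the vanishing transform by $e^{-i\langle v,x\rangle}$ and integrating over Wiener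
  -- space turns the exponentials into Gaussian kernels centered at `v`.
  have hgauss : ∀ v : L2 T, ∫ u, d u * Complex.exp (-(‖u - v‖ ^ 2 / 2 : ℝ)) ∂κ = 0 := by
    intro v
    have hθ : AEMeasurable (fun p : L2 T × C0 T => pwz φ p.1 p.2 - pwz φ v p.2) (κ.prod m) :=
      (aemeasurable_pwz_prod (U := fun u : L2 T => u) (A := fun x => x) hφ measurable_id
        fun j => (measurable_rsIntegral hT (hφ.bv j)).aemeasurable).sub
        ((measurable_pwz hT hφ v).comp measurable_snd).aemeasurable
    have hint := integrable_prod_exp hd hθ 1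
    simp only [one_mul] at hint
    have h1 := integral_integral_swap (f := fun (u : L2 T) (x : C0 T) =>
      d u * Complex.exp (Complex.I * ((pwz φ u x - pwz φ v x : ℝ) : ℂ))) hint
    simp only [integral_const_mul, integral_exp_pwz_sub hT hm hφ] at h1
    rw [h1]
    refine integral_eq_zero_of_ae ?_
    filter_upwards [h] with x hx
    have e : ∀ u : L2 T, d u * Complex.exp (Complex.I * ((pwz φ u x - pwz φ v x : ℝ) : ℂ)) =
        (d u * Complex.exp (Complex.I * (pwz φ u x : ℝ))) *
          Complex.exp (-Complex.I * (pwz φ v x : ℝ)) := fun u => by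
      rw [mul_assoc, ← Complex.exp_add]; congr 2; push_cast; ring
    simp only [e, integral_mul_const, hx, zero_mul, Pi.zero_apply]
  -- Expanding the square puts the weight $e^{-\|u\|^2/2}$ on `d` and leaves a real exponential;
  -- with this weight all exponential moments are finite.
  have hsplit : ∀ u v : L2 T, d u * Complex.exp (-(‖u - v‖ ^ 2 / 2 : ℝ)) =
      (d u * Complex.exp (-(‖u‖ ^ 2 / 2 : ℝ)) * (Real.exp (inner ℝ u v) : ℂ)) *
        Complex.exp (-(‖v‖ ^ 2 / 2 : ℝ)) := fun u v => by
    rw [norm_sub_sq_real, Complex.ofReal_exp, mul_assoc, mul_assoc, ← Complex.exp_add,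
      ← Complex.exp_add]
    congr 2; push_cast; ring
  have hz : (fun u : L2 T => d u * Complex.exp (-(‖u‖ ^ 2 / 2 : ℝ))) =ᵐ[κ] 0 := by
    refine ae_eq_zero_of_integral_mul_exp_inner (fun v => ?_) fun v => ?_
    · have h1 : Integrable (fun u : L2 T => d u * Complex.exp (-(‖u - v‖ ^ 2 / 2 : ℝ))) κ := by
        refine hd.mul_bdd (c := 1) ?_ (Eventually.of_forall fun u => ?_)
        · exact Continuous.aestronglyMeasurable (by fun_prop)
        · rw [← Complex.ofReal_neg, ← Complex.ofReal_exp, Complex.norm_real,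
            Real.norm_of_nonneg (Real.exp_pos _).le, Real.exp_le_one_iff]
          have := sq_nonneg ‖u - v‖
          linarith
      simp only [hsplit] at h1
      exact (integrable_mul_const_iff (isUnit_iff_ne_zero.2 (Complex.exp_ne_zero _)) _).1 h1
    · have h1 := hgauss v
      simp only [hsplit, integral_mul_const] at h1
      exact (mul_eq_zero.1 h1).resolve_right (Complex.exp_ne_zero _)
  filter_upwards [hz] with u hu
  exact (mul_eq_zero.1 hu).resolve_right (Complex.exp_ne_zero _)

end Uniqueness

/-! ### Convolution products and products of represented functionals -/

section Convolution

variable {T : ℝ} {m : Measure (C0 T)} {φ : ℕ → ℝ → ℝ}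

lemma vectorIntegral_exp_pwz (hφ : IsBVBasis T φ) {μ : Measure (L2 T)} {g : L2 T → ℂ}
    (hg : Integrable g μ) (x : C0 T) :
    ∫ᵛ u : L2 T, Complex.exp (Complex.I * (pwz φ (u : ℝ → ℝ) x : ℂ))
      ∂[ContinuousLinearMap.mul ℝ ℂ; μ.withDensityᵥ g] =
      ∫ u : L2 T, g u * Complex.exp (Complex.I * (pwz φ u x : ℝ)) ∂μ := by
  have h := measurable_pwz_left (U := fun u : L2 T => u) hφ measurable_id x
  rw [vectorIntegral_withDensityᵥ_of_bounded hg (C := 1) (by fun_prop)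
    fun u => (norm_exp_I_mul _).le]
  exact integral_congr_ae (Eventually.of_forall fun u => mul_comm _ _)

lemma ae_variation_of_mem_goodPaths {μ : Measure (L2 T)} {g : L2 T → ℂ} (hg : Integrable g μ)
    {x : C0 T} (hx : x ∈ goodPaths φ μ) :
    ∀ᵐ u : L2 T ∂(μ.withDensityᵥ g).variation, PWZExists φ (u : ℝ → ℝ) x := by
  rw [Measure.variation_withDensityᵥ hg]
  exact (withDensity_absolutelyContinuous _ _).ae_le hx

lemma isRepr_of_eq (hT : 0 < T) (hm : IsWienerMeasure m) (hφ : IsBVBasis T φ)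
    {μ : Measure (L2 T)} [IsFiniteMeasure μ] {g : L2 T → ℂ} (hg : Integrable g μ)
    {F : C0 T → ℂ} (hF : ∀ y ∈ goodPaths φ μ,
      F y = ∫ u : L2 T, g u * Complex.exp (Complex.I * (pwz φ u y : ℝ)) ∂μ) :
    IsRepr m φ μ g (fun u => u) (goodPaths φ μ) F :=
  ⟨isGoodSet_goodPaths hT hm hφ μ, hg, measurable_id, fun _ hy => hy, hF⟩

lemma MemS.exists_isRepr (hT : 0 < T) (hm : IsWienerMeasure m) (hφ : IsBVBasis T φ)
    {F : C0 T → ℂ} (hF : MemS φ F) : ∃ (μ : Measure (L2 T)) (g : L2 T → ℂ), IsFiniteMeasure μ ∧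
      IsRepr m φ μ g (fun u => u) (goodPaths φ μ) F := by
  obtain ⟨f, hf⟩ := hF
  obtain ⟨μ, g, hμ, hg, rfl⟩ := exists_eq_withDensityᵥ f
  refine ⟨μ, g, hμ, isRepr_of_eq hT hm hφ hg fun y hy => ?_⟩
  rw [hf y (ae_variation_of_mem_goodPaths hg hy), vectorIntegral_exp_pwz hφ hg]

/-- The formula is used at every path, with the default value of `pwz` where the limit fails, so no
exceptional set arises. -/
lemma memS_integral (hφ : IsBVBasis T φ) {μ : Measure (L2 T)} {g : L2 T → ℂ}
    (hg : Integrable g μ) :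
    MemS φ fun y : C0 T => ∫ u : L2 T, g u * Complex.exp (Complex.I * (pwz φ u y : ℝ)) ∂μ :=
  ⟨μ.withDensityᵥ g, fun x _ => (vectorIntegral_exp_pwz hφ hg x).symm⟩

lemma integrable_variation_exp_pwz (hφ : IsBVBasis T φ) {μ : Measure (L2 T)} {g : L2 T → ℂ}
    (hg : Integrable g μ) (x : C0 T) : (μ.withDensityᵥ g).Integrable
      fun u : L2 T => Complex.exp (Complex.I * (pwz φ u x : ℂ)) := by
  have hfin : IsFiniteMeasure (μ.withDensity fun x => ‖g x‖ₑ) := ⟨by simpa using! hg.2⟩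
  have h := measurable_pwz_left (U := fun u : L2 T => u) hφ measurable_id x
  rw [VectorMeasure.Integrable, Measure.variation_withDensityᵥ hg]
  exact Integrable.of_bound (Measurable.aestronglyMeasurable (by fun_prop)) 1
    (Eventually.of_forall fun u => (norm_exp_I_mul _).le)

/-- A member of `𝒮(L₂[0,T])` is determined, on all good paths, by its values almost everywhere. -/
theorem MemS.eq_of_ae_eq (hT : 0 < T) (hm : IsWienerMeasure m) (hφ : IsBVBasis T φ)
    {F : C0 T → ℂ} (hF : MemS φ F) {μ : Measure (L2 T)} [IsFiniteMeasure μ] {g : L2 T → ℂ}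
    (hg : Integrable g μ)
    (h : ∀ᵐ x ∂m, F x = ∫ u : L2 T, g u * Complex.exp (Complex.I * (pwz φ u x : ℝ)) ∂μ)
    {y : C0 T} (hy : y ∈ goodPaths φ μ) :
    F y = ∫ u : L2 T, g u * Complex.exp (Complex.I * (pwz φ u y : ℝ)) ∂μ := by
  obtain ⟨f, hf⟩ := hF
  obtain ⟨ν, k, hν, hk, rfl⟩ := exists_eq_withDensityᵥ f
  -- The difference of the two candidate measures has a vanishing transform at almost every path, so
  -- it is zero.
  obtain ⟨κ, d, hκ, hd, hdiff⟩ := exists_eq_withDensityᵥ (ν.withDensityᵥ k - μ.withDensityᵥ g)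
  have hd0 : d =ᵐ[κ] 0 := by
    refine ae_eq_zero_of_integral_exp_pwz hT hm hφ hd ?_
    filter_upwards [h, (isGoodSet_goodPaths hT hm hφ ν).ae_mem] with x hx hxν
    rw [← vectorIntegral_exp_pwz hφ hd, ← hdiff, VectorMeasure.integral_sub_vectorMeasure
      (integrable_variation_exp_pwz hφ hk x) (integrable_variation_exp_pwz hφ hg x),
      ← hf x (ae_variation_of_mem_goodPaths hk hxν), hx, vectorIntegral_exp_pwz hφ hg, sub_self]
  have he : ν.withDensityᵥ k = μ.withDensityᵥ g := by
    rw [WithDensityᵥEq.congr_ae hd0, withDensityᵥ_zero] at hdiff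
    exact sub_eq_zero.1 hdiff
  -- Since the measures coincide, a path that is good for `μ` satisfies the condition under which
  -- the formula for `F` is guaranteed.
  rw [hf y (he ▸ ae_variation_of_mem_goodPaths hg hy), he, vectorIntegral_exp_pwz hφ hg]

lemma memLp_top_of_isS {h k s : ℝ → ℝ} (hh : MemLp h ∞ (leb T)) (hk : MemLp k ∞ (leb T))
    (hs : IsS T h k s) : MemLp s ∞ (leb T) := by
  obtain ⟨C, _, hC⟩ := exists_bound_of_memLp_top hh
  obtain ⟨K, _, hK⟩ := exists_bound_of_memLp_top hk
  refine memLp_top_of_bound hs.1.1 √(C + K) ?_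
  filter_upwards [hC, hK, hs.2] with t h1 h2 h3
  exact Real.abs_le_sqrt (by linarith)

section Products

variable {μ ν : Measure (L2 T)} {g k : L2 T → ℂ} {F G : C0 T → ℂ}

/-- The sum `c (u + v)` of the frequencies of two exponentials. -/
def mixFrequency (T c : ℝ) (p : L2 T × L2 T) : L2 T := c • (p.1 + p.2)

lemma mixFrequency_ae (c : ℝ) (p : L2 T × L2 T) :
    (mixFrequency T c p : ℝ → ℝ) =ᵐ[leb T] fun t => c * p.1 t + c * p.2 t := by
  filter_upwards [Lp.coeFn_smul c (p.1 + p.2), Lp.coeFn_add p.1 p.2] with t h1 h2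
  rw [mixFrequency, h1, Pi.smul_apply, h2, Pi.add_apply, smul_eq_mul, mul_add]

lemma measurable_mixFrequency (c : ℝ) : Measurable (mixFrequency T c) :=
  ((continuous_fst.add continuous_snd).const_smul c).measurable

lemma ae_pwz_mixFrequency [SFinite μ] [SFinite ν] (hφ : IsBVBasis T φ) (c : ℝ) {y : C0 T}
    (hy : y ∈ goodPaths φ μ ∩ goodPaths φ ν) : ∀ᵐ p ∂(μ.prod ν),
      PWZExists φ (mixFrequency T c p) y ∧
        pwz φ (mixFrequency T c p) y = c * pwz φ p.1 y + c * pwz φ p.2 y := by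
  have h1 : ∀ᵐ p ∂(μ.prod ν), PWZExists φ (p.1 : ℝ → ℝ) y :=
    Measure.quasiMeasurePreserving_fst.ae hy.1
  have h2 : ∀ᵐ p ∂(μ.prod ν), PWZExists φ (p.2 : ℝ → ℝ) y :=
    Measure.quasiMeasurePreserving_snd.ae hy.2
  filter_upwards [h1, h2] with p h1 h2
  rw [pwzExists_congr (mixFrequency_ae c p), pwz_congr (mixFrequency_ae c p)]
  exact h1.linear hφ (Lp.memLp p.1) (Lp.memLp p.2) c c h2

/-- The product of two represented functionals at two paths. -/
lemma IsRepr.mul_eq [IsFiniteMeasure μ] [IsFiniteMeasure ν]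
    (hF : IsRepr m φ μ g (fun u => u) (goodPaths φ μ) F)
    (hG : IsRepr m φ ν k (fun u => u) (goodPaths φ ν) G) {x y : C0 T}
    (hx : x ∈ goodPaths φ μ) (hy : y ∈ goodPaths φ ν) :
    F x * G y = ∫ p, (g p.1 * k p.2) *
      Complex.exp (Complex.I * (pwz φ p.1 x + pwz φ p.2 y : ℝ)) ∂(μ.prod ν) := by
  rw [hF.eq _ hx, hG.eq _ hy, ← integral_prod_mul]
  refine integral_congr_ae (Eventually.of_forall fun p => ?_)
  dsimp only
  rw [Complex.ofReal_add, mul_add, Complex.exp_add]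
  ring

/-- The representation stays on pairs of frequencies instead of being pushed forward to $L_2$, so
that it can be matched pair by pair with the convolution product. -/
lemma IsRepr.mul [IsFiniteMeasure μ] [IsFiniteMeasure ν] (hT : 0 < T) (hφ : IsBVBasis T φ)
    (hF : IsRepr m φ μ g (fun u => u) (goodPaths φ μ) F)
    (hG : IsRepr m φ ν k (fun u => u) (goodPaths φ ν) G) (c : ℝ) :
    IsRepr m φ (μ.prod ν) (fun p => g p.1 * k p.2) (mixFrequency T c)
      (goodPaths φ μ ∩ goodPaths φ ν) (fun y => F (c • y) * G (c • y)) where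
  good := hF.good.inter hG.good
  integrable := hF.integrable.mul_prod hG.integrable
  measurable := measurable_mixFrequency c
  exists_pwz y hy := (ae_pwz_mixFrequency hφ c hy).mono fun _ h => h.1
  eq y hy := by
    rw [hF.mul_eq hG (hF.good.smul_mem hy.1 c) (hG.good.smul_mem hy.2 c)]
    have h1 : ∀ᵐ p ∂(μ.prod ν), PWZExists φ (p.1 : ℝ → ℝ) y :=
      Measure.quasiMeasurePreserving_fst.ae hy.1
    have h2 : ∀ᵐ p ∂(μ.prod ν), PWZExists φ (p.2 : ℝ → ℝ) y :=
      Measure.quasiMeasurePreserving_snd.ae hy.2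
    refine integral_congr_ae ?_
    filter_upwards [h1, h2, ae_pwz_mixFrequency hφ c hy] with p h1 h2 h3
    have e1 := (h1.path hT hφ h1 c 0).2
    have e2 := (h2.path hT hφ h2 c 0).2
    rw [zero_smul, add_zero, zero_mul, add_zero] at e1 e2
    rw [e1, e2, h3.2]

lemma measurable_energy_sub (hφ : IsBVBasis T φ) {k₁ k₂ : ℝ → ℝ} (hk₁ : MemLp k₁ ∞ (leb T))
    (hk₂ : MemLp k₂ ∞ (leb T)) (c : ℝ) : Measurable fun p : L2 T × L2 T =>
      ∫ t, (c * (k₁ t * p.1 t) + -c * (k₂ t * p.2 t)) ^ 2 ∂(leb T) := by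
  refine measurable_integral_sq hφ (W := fun (p : L2 T × L2 T) t =>
    c * (k₁ t * p.1 t) + -c * (k₂ t * p.2 t)) (fun p =>
    ((memLp_mul_of_memLp_top hk₁ (Lp.memLp p.1)).const_mul c).add
      ((memLp_mul_of_memLp_top hk₂ (Lp.memLp p.2)).const_mul (-c))) fun j => ?_
  have h : ∀ p : L2 T × L2 T,
      ∫ t, (c * (k₁ t * p.1 t) + -c * (k₂ t * p.2 t)) * φ j t ∂(leb T) =
        c * (∫ t, k₁ t * p.1 t * φ j t ∂(leb T)) +
          -c * ∫ t, k₂ t * p.2 t * φ j t ∂(leb T) := fun p => by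
    rw [← integral_const_mul, ← integral_const_mul, ← integral_add]
    · exact integral_congr_ae (Eventually.of_forall fun t => by dsimp only; ring)
    · exact (MemLp.integrable_mul_two (memLp_mul_of_memLp_top hk₁ (Lp.memLp p.1))
        (hφ.memLp j)).const_mul c
    · exact (MemLp.integrable_mul_two (memLp_mul_of_memLp_top hk₂ (Lp.memLp p.2))
        (hφ.memLp j)).const_mul (-c)
  simp only [h]
  exact (((measurable_coeff_mul hφ hk₁ j).comp measurable_fst).const_mul c).add
    (((measurable_coeff_mul hφ hk₂ j).comp measurable_snd).const_mul (-c))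

/-- The generalized convolution product of two represented functionals. -/
theorem IsRepr.isGCP [IsFiniteMeasure μ] [IsFiniteMeasure ν] (hT : 0 < T)
    (hm : IsWienerMeasure m) (hφ : IsBVBasis T φ)
    (hF : IsRepr m φ μ g (fun u => u) (goodPaths φ μ) F)
    (hG : IsRepr m φ ν k (fun u => u) (goodPaths φ ν) G) {k₁ k₂ : ℝ → ℝ}
    (hk₁ : MemLp k₁ ∞ (leb T)) (hk₂ : MemLp k₂ ∞ (leb T)) {q : ℝ} (hq : q ≠ 0) {y : C0 T}
    (hy : y ∈ goodPaths φ μ ∩ goodPaths φ ν) :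
    IsGCP m φ q k₁ k₂ F G y (gaussTransform (μ.prod ν)
      (fun p => g p.1 * k p.2 *
        Complex.exp (Complex.I * (pwz φ (mixFrequency T (√2)⁻¹ p) y : ℝ)))
      (fun p => ∫ t, ((√2)⁻¹ * (k₁ t * p.1 t) + -(√2)⁻¹ * (k₂ t * p.2 t)) ^ 2 ∂(leb T))
      (-Complex.I * q)) := by
  have := hm.prob
  set c := (√2)⁻¹
  have hg : Integrable (fun p : L2 T × L2 T => g p.1 * k p.2 *
      Complex.exp (Complex.I * (pwz φ (mixFrequency T c p) y : ℝ))) (μ.prod ν) :=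
    integrable_mul_exp_pwz hφ (measurable_mixFrequency c) (hF.integrable.mul_prod hG.integrable) y
  have hN := measurable_energy_sub hφ hk₁ hk₂ c
  have hN0 : ∀ p : L2 T × L2 T,
      0 ≤ ∫ t, (c * (k₁ t * p.1 t) + -c * (k₂ t * p.2 t)) ^ 2 ∂(leb T) :=
    fun p => integral_nonneg fun _ => sq_nonneg _
  refine ⟨_, ?_, tendsto_gaussTransform hg hN hN0 hq⟩
  -- Both processes are driven by the same `x`, so the phase is the single integral
  -- $\langle(k_1u-k_2v)/\sqrt2,x\rangle$. Its variance contains the cross term in $k_1k_2$ that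
  -- later cancels against $h^2$.
  refine isAnalyticWienerIntegral_gaussTransform hg hN hN0
    (θ := fun p x => c * pwz φ p.1 (proc m φ k₁ x) + -c * pwz φ p.2 (proc m φ k₂ x))
    ?_ (fun p => ?_) fun l hl => ?_
  · exact ((aemeasurable_pwz_prod hφ measurable_fst
      (aemeasurable_rsIntegral_proc hT hm hφ hk₁)).const_mul c).add
      ((aemeasurable_pwz_prod hφ measurable_snd
        (aemeasurable_rsIntegral_proc hT hm hφ hk₂)).const_mul (-c))
  · refine (isCG_pwz hT hm hφ (((memLp_mul_of_memLp_top hk₁ (Lp.memLp p.1)).const_mul c).add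
      ((memLp_mul_of_memLp_top hk₂ (Lp.memLp p.2)).const_mul (-c)))).congr ?_
    filter_upwards [ae_pwz_linear hT hm hφ (memLp_mul_of_memLp_top hk₁ (Lp.memLp p.1))
      (memLp_mul_of_memLp_top hk₂ (Lp.memLp p.2)) c (-c), ae_pwz_proc hT hm hφ hk₁ (Lp.memLp p.1),
      ae_pwz_proc hT hm hφ hk₂ (Lp.memLp p.2)] with x h1 h2 h3
    rw [h2, h3, ← h1]
    rfl
  · filter_upwards [hF.good.ae_proc_mem k₁ hk₁, hG.good.ae_proc_mem k₂ hk₂] with x hx₁ hx₂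
    have m1 := hF.good.smul_mem (hF.good.add_smul_mem hy.1 hx₁ (√l)⁻¹) c
    have m2 := hG.good.smul_mem (hG.good.add_smul_mem hy.2 hx₂ (-(√l)⁻¹)) c
    have es : y + -(√l)⁻¹ • proc m φ k₂ x = y - (√l)⁻¹ • proc m φ k₂ x := by module
    rw [es] at m2
    rw [hF.mul_eq hG m1 m2]
    have a1 : ∀ᵐ p ∂(μ.prod ν), PWZExists φ (p.1 : ℝ → ℝ) y :=
      Measure.quasiMeasurePreserving_fst.ae hy.1
    have a2 : ∀ᵐ p ∂(μ.prod ν), PWZExists φ (p.2 : ℝ → ℝ) y :=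
      Measure.quasiMeasurePreserving_snd.ae hy.2
    have a3 : ∀ᵐ p ∂(μ.prod ν), PWZExists φ (p.1 : ℝ → ℝ) (proc m φ k₁ x) :=
      Measure.quasiMeasurePreserving_fst.ae hx₁
    have a4 : ∀ᵐ p ∂(μ.prod ν), PWZExists φ (p.2 : ℝ → ℝ) (proc m φ k₂ x) :=
      Measure.quasiMeasurePreserving_snd.ae hx₂
    refine integral_congr_ae ?_
    filter_upwards [a1, a2, a3, a4, ae_pwz_mixFrequency hφ c hy] with p h1 h2 h3 h4 h5
    have e1 := (h1.path hT hφ h3 c (c * (√l)⁻¹)).2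
    have e2 := (h2.path hT hφ h4 c (c * -(√l)⁻¹)).2
    rw [mul_smul, ← smul_add] at e1 e2
    rw [es] at e2
    rw [e1, e2, h5.2, mul_assoc (g p.1 * k p.2), ← Complex.exp_add]
    congr 2; push_cast; ring

end Products

end Convolution

/-! ### Transforms in the class and the identity of exponents -/

section Conclusion

variable {T : ℝ} {m : Measure (C0 T)} {φ : ℕ → ℝ → ℝ}

/-- The transform of a member of `𝒮(L₂[0,T])` has a version in `𝒮(L₂[0,T])`. -/
lemma IsRepr.exists_memS_isGFFT (hT : 0 < T) (hm : IsWienerMeasure m) (hφ : IsBVBasis T φ)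
    {μ : Measure (L2 T)} [IsFiniteMeasure μ] {g : L2 T → ℂ} {F : C0 T → ℂ}
    (hF : IsRepr m φ μ g (fun u => u) (goodPaths φ μ) F) {h : ℝ → ℝ} (hh : MemLp h ∞ (leb T))
    {q : ℝ} (hq : q ≠ 0) (p : ℝ) : ∃ F₁, MemS φ F₁ ∧ IsGFFT m φ p q h F F₁ := by
  refine ⟨_, memS_integral hφ (integrable_gauss hF.integrable (measurable_integral_sq_mul hφ hh)
    (fun u => energy_nonneg _ _) (neg_I_mul_re q).ge), hF.isGFFT hT hm hφ hh hq p fun y _ => ?_⟩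
  rw [reprTransform_eq]

/-- Every version in `𝒮(L₂[0,T])` of the transform is given, on the good paths, by the density
multiplied with the Gaussian factor. -/
lemma IsRepr.isRepr_transform (hT : 0 < T) (hm : IsWienerMeasure m) (hφ : IsBVBasis T φ)
    {μ : Measure (L2 T)} [IsFiniteMeasure μ] {g : L2 T → ℂ} {F : C0 T → ℂ}
    (hF : IsRepr m φ μ g (fun u => u) (goodPaths φ μ) F) {h : ℝ → ℝ} (hh : MemLp h ∞ (leb T))
    {q p : ℝ} (hq : q ≠ 0) (hp : 1 ≤ p) {F₁ : C0 T → ℂ} (hS : MemS φ F₁)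
    (hF₁ : IsGFFT m φ p q h F F₁) :
    IsRepr m φ μ (fun u => g u * Complex.exp
      (-((∫ t, (h t * u t) ^ 2 ∂(leb T)) / 2 : ℝ) * (-Complex.I * q)⁻¹))
      (fun u => u) (goodPaths φ μ) F₁ := by
  have hg := integrable_gauss hF.integrable (measurable_integral_sq_mul hφ hh)
    (fun u => energy_nonneg _ _) (neg_I_mul_re q).ge
  refine isRepr_of_eq hT hm hφ hg fun y hy => hS.eq_of_ae_eq hT hm hφ hg ?_ hy
  -- Scale 1 suffices, since almost everywhere equality already determines a member of the class on
  -- good paths.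
  have h1 := hF₁.sae_eq hp (hF.isGFFT hT hm hφ hh hq p fun y _ => rfl) 1 one_pos
  filter_upwards [h1] with x hx
  rw [one_smul] at hx
  rw [hx, reprTransform_eq]

/-- As $(-iq)^{-1}=i/q$, the factors $q_j/q$ bring both transforms to the common parameter `q`. The
parameter `-q` reverses the sign of `N`, leaving $E=A+B-N$. -/
lemma gaussian_exponent_identity {q q₁ q₂ A B N E : ℝ} (hq : q ≠ 0) (hq₁ : q₁ ≠ 0)
    (hq₂ : q₂ ≠ 0) (h : E + N = A + B) :
    -((q₁ / q * A / 2 : ℝ) : ℂ) * (-Complex.I * q₁)⁻¹ +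
      -((q₂ / q * B / 2 : ℝ) : ℂ) * (-Complex.I * q₂)⁻¹ +
      -((N / 2 : ℝ) : ℂ) * (-Complex.I * (-q : ℝ))⁻¹ =
    -((E / 2 : ℝ) : ℂ) * (-Complex.I * q)⁻¹ := by
  obtain rfl : N = A + B - E := by linear_combination h
  have h0 : (q : ℂ) ≠ 0 := by exact_mod_cast hq
  have h1 : (q₁ : ℂ) ≠ 0 := by exact_mod_cast hq₁
  have h2 : (q₂ : ℂ) ≠ 0 := by exact_mod_cast hq₂
  have hI := Complex.I_ne_zero
  push_cast
  field_simp
  ring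

/-- Equal signs make the radicand positive, so the square root squares back to it. -/
lemma integral_scaled_sq {q q' : ℝ} (hqq : 0 < q' / q) {s u : ℝ → ℝ} :
    ∫ t, (√(q' / (2 * q)) * s t * u t) ^ 2 ∂(leb T) =
      q' / q * ∫ t, (s t * u t) ^ 2 / 2 ∂(leb T) := by
  have h : 0 ≤ q' / (2 * q) := by
    have : q' / (2 * q) = q' / q / 2 := by field_simp
    rw [this]; positivity
  rw [← integral_const_mul]
  refine integral_congr_ae (Eventually.of_forall fun t => ?_)
  dsimp only
  rw [mul_assoc, mul_pow, Real.sq_sqrt h]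
  ring

/-- Pointwise expansion: the cross terms are $(h^2-k_1k_2)uv=0$, and the squares collect into
$s_1^2u^2/2$ and $s_2^2v^2/2$. -/
lemma energy_identity {h k₁ k₂ s₁ s₂ : ℝ → ℝ} (hh : MemLp h ∞ (leb T))
    (hk₁ : MemLp k₁ ∞ (leb T)) (hk₂ : MemLp k₂ ∞ (leb T))
    (hhk : ∀ᵐ t ∂(leb T), h t ^ 2 = k₁ t * k₂ t) (hs₁ : IsS T h k₁ s₁) (hs₂ : IsS T h k₂ s₂)
    (p : L2 T × L2 T) :
    (∫ t, (h t * mixFrequency T (√2)⁻¹ p t) ^ 2 ∂(leb T)) +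
      (∫ t, ((√2)⁻¹ * (k₁ t * p.1 t) + -(√2)⁻¹ * (k₂ t * p.2 t)) ^ 2 ∂(leb T)) =
    (∫ t, (s₁ t * p.1 t) ^ 2 / 2 ∂(leb T)) + ∫ t, (s₂ t * p.2 t) ^ 2 / 2 ∂(leb T) := by
  have i1 := (memLp_mul_of_memLp_top hh (Lp.memLp (mixFrequency T (√2)⁻¹ p))).integrable_sq
  have i2 : Integrable
      (fun t => ((√2)⁻¹ * (k₁ t * p.1 t) + -(√2)⁻¹ * (k₂ t * p.2 t)) ^ 2) (leb T) :=
    (((memLp_mul_of_memLp_top hk₁ (Lp.memLp p.1)).const_mul (√2)⁻¹).add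
    ((memLp_mul_of_memLp_top hk₂ (Lp.memLp p.2)).const_mul (-(√2)⁻¹))).integrable_sq
  have i3 := (memLp_mul_of_memLp_top (memLp_top_of_isS hh hk₁ hs₁)
    (Lp.memLp p.1)).integrable_sq.div_const 2
  have i4 := (memLp_mul_of_memLp_top (memLp_top_of_isS hh hk₂ hs₂)
    (Lp.memLp p.2)).integrable_sq.div_const 2
  rw [← integral_add i1 i2, ← integral_add i3 i4]
  refine integral_congr_ae ?_
  filter_upwards [hhk, hs₁.2, hs₂.2, mixFrequency_ae (√2)⁻¹ p] with t h1 h2 h3 h4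
  have hc : ((√2)⁻¹ : ℝ) ^ 2 = 1 / 2 := by rw [inv_pow, Real.sq_sqrt zero_le_two]; norm_num
  rw [h4]
  linear_combination (h t ^ 2 * (p.1 t + p.2 t) ^ 2 + (k₁ t * p.1 t - k₂ t * p.2 t) ^ 2) * hc +
    p.1 t * p.2 t * h1 - p.1 t ^ 2 / 2 * h2 - p.2 t ^ 2 / 2 * h3

lemma div_pos_of_sign_eq {q q' : ℝ} (hq : q ≠ 0) (h : SignType.sign q = SignType.sign q') :
    0 < q' / q := by
  rcases hq.lt_or_gt with hq | hq
  · rw [sign_neg hq, eq_comm, sign_eq_neg_one_iff] at h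
    exact div_pos_of_neg_of_neg h hq
  · rw [sign_pos hq, eq_comm, sign_eq_one_iff] at h
    exact div_pos h hq

end Conclusion

end WienerGFFT

end

theorem lemma6p2 (T : ℝ) (hT : 0 < T)
    (m : MeasureTheory.Measure (WienerGFFT.C0 T)) (hm : WienerGFFT.IsWienerMeasure m)
    (φ : ℕ → ℝ → ℝ) (hφ : WienerGFFT.IsBVBasis T φ)
    (h k₁ k₂ s₁ s₂ : ℝ → ℝ)
    (hh : WienerGFFT.IsNonzeroLinfty T h)
    (hk₁ : WienerGFFT.IsNonzeroLinfty T k₁) (hk₂ : WienerGFFT.IsNonzeroLinfty T k₂)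
    (hhk : ∀ᵐ t ∂(WienerGFFT.leb T), h t ^ 2 = k₁ t * k₂ t)
    (hs₁ : WienerGFFT.IsS T h k₁ s₁) (hs₂ : WienerGFFT.IsS T h k₂ s₂)
    (F G : WienerGFFT.C0 T → ℂ) (hF : WienerGFFT.MemS φ F) (hG : WienerGFFT.MemS φ G)
    (q q₁ q₂ : ℝ) (hq : q ≠ 0) (hq₁ : q₁ ≠ 0) (hq₂ : q₂ ≠ 0)
    (hsgn₁ : SignType.sign q = SignType.sign q₁) (hsgn₂ : SignType.sign q = SignType.sign q₂)
    (p : ℝ) (hp : p ∈ Set.Icc (1 : ℝ) 2) :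
    (∃ F₁, WienerGFFT.MemS φ F₁ ∧
      WienerGFFT.IsGFFT m φ p q₁ (fun t => Real.sqrt (q₁ / (2 * q)) * s₁ t) F F₁) ∧
    (∃ G₁, WienerGFFT.MemS φ G₁ ∧
      WienerGFFT.IsGFFT m φ p q₂ (fun t => Real.sqrt (q₂ / (2 * q)) * s₂ t) G G₁) ∧
    (∃ R, WienerGFFT.IsGFFT m φ p q h
      (fun y => F ((Real.sqrt 2)⁻¹ • y) * G ((Real.sqrt 2)⁻¹ • y)) R) ∧
    ∀ F₁ G₁ R : WienerGFFT.C0 T → ℂ,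
      WienerGFFT.MemS φ F₁ →
      WienerGFFT.IsGFFT m φ p q₁ (fun t => Real.sqrt (q₁ / (2 * q)) * s₁ t) F F₁ →
      WienerGFFT.MemS φ G₁ →
      WienerGFFT.IsGFFT m φ p q₂ (fun t => Real.sqrt (q₂ / (2 * q)) * s₂ t) G G₁ →
      WienerGFFT.IsGFFT m φ p q h
        (fun y => F ((Real.sqrt 2)⁻¹ • y) * G ((Real.sqrt 2)⁻¹ • y)) R →
      WienerGFFT.SAE m fun y => WienerGFFT.IsGCP m φ (-q) k₁ k₂ F₁ G₁ y (R y) := by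
  have hsq₁ := WienerGFFT.memLp_top_of_isS hh.1 hk₁.1 hs₁
  have hsq₂ := WienerGFFT.memLp_top_of_isS hh.1 hk₂.1 hs₂
  obtain ⟨μ, g, hμ, hFr⟩ := WienerGFFT.MemS.exists_isRepr hT hm hφ hF
  obtain ⟨ν, k, hν, hGr⟩ := WienerGFFT.MemS.exists_isRepr hT hm hφ hG
  have ha₁ := hsq₁.const_mul (Real.sqrt (q₁ / (2 * q)))
  have ha₂ := hsq₂.const_mul (Real.sqrt (q₂ / (2 * q)))
  have hprod := hFr.mul hT hφ hGr (Real.sqrt 2)⁻¹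
  refine ⟨hFr.exists_memS_isGFFT hT hm hφ ha₁ hq₁ p, hGr.exists_memS_isGFFT hT hm hφ ha₂ hq₂ p,
    ⟨_, hprod.isGFFT hT hm hφ hh.1 hq p fun _ _ => rfl⟩, fun F₁ G₁ R hSF hF₁ hSG hG₁ hR => ?_⟩
  have hFr₁ := hFr.isRepr_transform hT hm hφ ha₁ hq₁ hp.1 hSF hF₁
  have hGr₁ := hGr.isRepr_transform hT hm hφ ha₂ hq₂ hp.1 hSG hG₁
  -- The version `R` is arbitrary; for s-a.e. `y` it equals the explicit transform of the product.
  have hR' := hR.sae_eq hp.1 (hprod.isGFFT hT hm hφ hh.1 hq p fun _ _ => rfl)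
  refine (hprod.good.sae.and hR').mono fun y hy => ?_
  have hgcp := hFr₁.isGCP hT hm hφ hGr₁ hk₁.1 hk₂.1 (neg_ne_zero.2 hq) hy.1
  rw [hy.2]
  convert hgcp using 1
  -- Both sides integrate the same density and oscillation over pairs of frequencies, so only the
  -- Gaussian factors have to be compared, pair by pair.
  refine MeasureTheory.integral_congr_ae (Filter.Eventually.of_forall fun x => ?_)
  have hid := WienerGFFT.energy_identity hh.1 hk₁.1 hk₂.1 hhk hs₁ hs₂ x
  dsimp only
  rw [WienerGFFT.integral_scaled_sq (WienerGFFT.div_pos_of_sign_eq hq hsgn₁),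
    WienerGFFT.integral_scaled_sq (WienerGFFT.div_pos_of_sign_eq hq hsgn₂)]
  have hexp := WienerGFFT.gaussian_exponent_identity hq hq₁ hq₂ hid
  rw [← hexp, Complex.exp_add, Complex.exp_add]
  ring
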